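/- Let $R$ be a commutative ring, $A$ a commutative $R$-algebra, and let $(A,L',L'')$ be an almost twilled Lie–Rinehart algebra: $(A,L')$ and $(A,L'')$ are Lie–Rinehart algebras over $R$ (with brackets $[\cdot,\cdot]'$, $[\cdot,\cdot]''$), $L''$ carries a left $(A,L')$-module structure $(x,\xi)\mapsto x\cdot\xi$ and $L'$ carries a left $(A,L'')$-module structure $(\xi,x)\mapsto \xi\cdot x$; that is, both are Lie algebra actions and, for $a\in A$, $x\in L'$, $\xi\in L''$, $(ax)\cdot\xi=a(x\cdot\xi)$, $x\cdot(a\xi)=x(a)\xi+a(x\cdot\xi)$, $(a\xi)\cdot x=a(\xi\cdot x)$, $\xi\cdot(ax)=\xi(a)x+a(\xi\cdot x)$. Suppose that $L'$ and $L''$ are finitely generated and projective as $A$-modules. **Notation.** (a) Let $\mathcal G=\mathrm{Alt}_A(L'',\Lambda_AL')$, bigraded by $\mathcal G^{p,q}=\mathrm{Alt}^p_A(L'',\Lambda^q_AL')$; write $|f|=p+q$ for $f\in\mathcal G^{p,q}$. The product on $\mathcal G\cong\mathrm{Alt}_A(L'',A)\otimes_A\Lambda_AL'$ is $(b\otimes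 u)(c\otimes v)=(-1)^{|u||c|}(b\wedge c)\otimes uv$, where $\wedge$ is the shuffle product. The differential $d''$ is the Lie–Rinehart differential with values in the $(A,L'')$-module $\Lambda_AL'$ ($L''$ acting by derivations that extend its actions on $A$ and $L'$): $$(d''f)(\xi_0,\dots,\xi_p)=\sum_i(-1)^i\,\xi_i\cdot f(\dots,\widehat{\xi_i},\dots)+\sum_{i<j}(-1)^{i+j}f([\xi_i,\xi_j]'',\dots,\widehat{\xi_i},\dots,\widehat{\xi_j},\dots).$$ The crossed product bracket $[\cdot,\cdot]'$ on $\mathcal G$ is the unique $R$-bilinear bracket of bidegree $(0,-1)$ with $[fg,h]=f[g,h]+(-1)^{|f||g|}g[f,h]$ and $[f,g]=-(-1)^{(|f|-1)(|g|-1)}[g,f]$ for homogeneous $f,g$ which extends the bracket of $L'$ and for which $[x,b]$, for $x\in L'$ and $b\in\mathrm{Alt}^p_A(L'',A)$, is $x\cdot b$, where $(x\cdot b)(\xi_1,\dots,\xi_p)=x(b(\xi_1,\dots,\xi_p))-\sum_k b(\dots,x\cdot\xi_k,\dots)$. (b) $(\mathcal G,[\cdot,\cdot]',d'')$ is a *differential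 bigraded Gerstenhaber algebra* if $\mathcal G$ is a bigraded commutative $R$-algebra (signs by total degree); the bracket has bidegree $(0,-1)$, is a bigraded Lie bracket after the second degree has been lowered by one, and $[f,\cdot]'$ is a derivation of total degree $|f|-1$ for homogeneous $f$; and $d''$ is a differential of bidegree $(1,0)$ which is a derivation of the product and satisfies $d''[f,g]'=[d''f,g]'-(-1)^{|f|}[f,d''g]'$. (c) Let $L=L'\ltimes L''^*$ and $D=L''\ltimes L'^*$, where ${}^*$ denotes the $A$-dual with the induced action and is regarded as an abelian Lie algebra; thus $[(x,\varphi),(y,\psi)]=([x,y]',x\cdot\psi-y\cdot\varphi)$ on $L$, $L$ acts on $A$ through $L'$, and likewise for $D$. They are in duality by the pairing $\langle(x,\varphi),(\xi,\psi)\rangle=\varphi(\xi)+\psi(x)$. Let $[\cdot,\cdot]$ be the Gerstenhaber bracket on $\Lambda_AL$ induced by the Lie–Rinehart structure of $(A,L)$, and let $d_*$ be the operator on $\Lambda_AL$ which under $\Lambda_AL\cong\mathrm{Alt}_A(D,A)$, $x_1\wedge\dots\wedge x_n\mapsto\big((\delta_1,\dots,\delta_n)\mapsto\det\langle x_i,\delta_j\rangle\big)$,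 corresponds to the Lie–Rinehart differential of $(A,D)$. $(A,L,D)$ is a *Lie–Rinehart bialgebra* if $d_*[u,v]=[d_*u,v]-(-1)^{|u|}[u,d_*v]$ for all $u,v\in\Lambda_AL$ ($u$ homogeneous). (d) $(A,L',L'')$ is a *twilled* Lie–Rinehart algebra if $L'\oplus L''$, with the bracket $$[(x,\xi),(y,\eta)]=\big([x,y]'+\xi\cdot y-\eta\cdot x,\ [\xi,\eta]''+x\cdot\eta-y\cdot\xi\big)$$ and the action $(x,\xi)(a)=x(a)+\xi(a)$ on $A$, is a Lie–Rinehart algebra over $A$. **Theorem.** The brackets and the operator $d_*$ described in (a) and (c) exist and are unique, and: 1. $(\mathrm{Alt}_A(L'',\Lambda_AL'),[\cdot,\cdot]',d'')$ is a differential bigraded Gerstenhaber algebra if and only if $(A,\,L'\ltimes L''^*,\,L''\ltimes L'^*)$ is a Lie–Rinehart bialgebra. 2. $(A,L',L'')$ is a twilled Lie–Rinehart algebra if and only if $(A,\,L'\ltimes L''^*,\,L''\ltimes L'^*)$ is a Lie–Rinehart bialgebra. -/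

import Mathlib

open scoped DirectSum

set_option linter.unusedSectionVars false

noncomputable section

namespace LR

section Modules

/-- A left `(A, L)`-module over a Lie-Rinehart algebra `(A, L)`: an `A`-module `M` with a
Lie algebra action of `L` such that `(a x) m = a (x m)` and `x (a m) = x(a) m + a (x m)`. -/
class LieRinehartModule (A L M : Type*) [CommRing A] [LieRing L] [Module A L] [LieRingModule L A]
    [AddCommGroup M] [Module A M] [LieRingModule L M] : Prop where
  smul_lie_act (a : A) (x : L) (m : M) : ⁅a • x, m⁆ = a • ⁅x, m⁆
  lie_smul_act (x : L) (a : A) (m : M) : ⁅x, a • m⁆ = ⁅x, a⁆ • m + a • ⁅x, m⁆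

variable {R A L : Type*} [CommRing R] [CommRing A] [Algebra R A]
  [LieRing L] [Module A L] [LieRingModule L A] [LieRinehartRing A L] [LieAlgebra R L]
  [LieRinehartAlgebra R A L]

theorem lie_one (x : L) : ⁅x, (1 : A)⁆ = 0 := by
  have h := LieRinehartRing.leibniz_mul_right x (1 : A) 1
  simpa using h

theorem lie_algebraMap (x : L) (r : R) : ⁅x, algebraMap R A r⁆ = 0 := by
  have h : ⁅x, r • (1 : A)⁆ = r • ⁅x, (1 : A)⁆ := LieModule.lie_smul r x (1 : A)
  rw [Algebra.algebraMap_eq_smul_one, h, lie_one, smul_zero]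

/-- An `(A, L)`-connection on an `A`-module `N`. -/
structure Connection (R A L N : Type*) [CommRing R] [CommRing A] [Algebra R A]
    [LieRing L] [Module A L] [LieRingModule L A]
    [AddCommGroup N] [Module A N] [Module R N] [IsScalarTower R A N] where
  toFun : L →ₗ[A] Module.End R N
  leibniz (x : L) (a : A) (n : N) : toFun x (a • n) = ⁅x, a⁆ • n + a • toFun x n

variable (R A L) in
/-- The tautological action of `L` on `A`, as an `(A, L)`-connection on `A`. -/
def Connection.base : Connection R A L A where
  toFun :=
    { toFun := fun x => LieModule.toEnd R L A x
      map_add' := fun x y => by ext; simp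
      map_smul' := fun a x => by ext; simp }
  leibniz x a n := by simp [mul_comm, add_comm]

end Modules


section DerDual

variable {A L M : Type*} [CommRing A] [AddCommGroup M] [Module A M]

/-- The dual numbers over the exterior algebra of `M`, as an `A`-algebra along
`a ↦ a + x(a) ε`. -/
def DerDual (A M : Type*) {L : Type*} [CommRing A] [AddCommGroup M] [Module A M] (_ : L) : Type _ :=
  DualNumber (ExteriorAlgebra A M)

instance (x : L) : Ring (DerDual A M x) := inferInstanceAs (Ring (DualNumber (ExteriorAlgebra A M)))

/-- The dual number `u + v ε`. -/
def DerDual.mk (x : L) (u v : ExteriorAlgebra A M) : DerDual A M x :=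
  (TrivSqZeroExt.inl u + TrivSqZeroExt.inr v : DualNumber (ExteriorAlgebra A M))

def DerDual.fst {x : L} (z : DerDual A M x) : ExteriorAlgebra A M :=
  TrivSqZeroExt.fst (z : DualNumber (ExteriorAlgebra A M))

def DerDual.snd {x : L} (z : DerDual A M x) : ExteriorAlgebra A M :=
  TrivSqZeroExt.snd (z : DualNumber (ExteriorAlgebra A M))

theorem DerDual.ext {x : L} {z w : DerDual A M x} (h : z.fst = w.fst) (h' : z.snd = w.snd) :
    z = w := TrivSqZeroExt.ext h h'

theorem DerDual.fst_mk (x : L) (u v : ExteriorAlgebra A M) : (DerDual.mk x u v).fst = u := by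
  simp only [DerDual.mk, DerDual.fst, TrivSqZeroExt.fst_add, TrivSqZeroExt.fst_inl,
    TrivSqZeroExt.fst_inr, add_zero]

theorem DerDual.snd_mk (x : L) (u v : ExteriorAlgebra A M) : (DerDual.mk x u v).snd = v := by
  simp only [DerDual.mk, DerDual.snd, TrivSqZeroExt.snd_add, TrivSqZeroExt.snd_inl,
    TrivSqZeroExt.snd_inr, zero_add]

theorem DerDual.fst_one (x : L) : (1 : DerDual A M x).fst = 1 := rfl
theorem DerDual.snd_one (x : L) : (1 : DerDual A M x).snd = 0 := rfl
theorem DerDual.fst_zero (x : L) : (0 : DerDual A M x).fst = 0 := rfl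
theorem DerDual.snd_zero (x : L) : (0 : DerDual A M x).snd = 0 := rfl

theorem DerDual.fst_add {x : L} (z w : DerDual A M x) : (z + w).fst = z.fst + w.fst := rfl
theorem DerDual.snd_add {x : L} (z w : DerDual A M x) : (z + w).snd = z.snd + w.snd := rfl
theorem DerDual.fst_mul {x : L} (z w : DerDual A M x) : (z * w).fst = z.fst * w.fst := rfl
theorem DerDual.snd_mul {x : L} (z w : DerDual A M x) :
    (z * w).snd = z.fst * w.snd + z.snd * w.fst := rfl

end DerDual

section Exterior

variable {R A L M : Type*} [CommRing R] [CommRing A] [Algebra R A]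
  [LieRing L] [Module A L] [LieRingModule L A] [LieRinehartRing A L] [LieAlgebra R L]
  [LieRinehartAlgebra R A L]
  [AddCommGroup M] [Module A M] [LieRingModule L M] [LieRinehartModule A L M]

/-- The ring homomorphism `a ↦ a + x(a) ε`. -/
def derDualHom (M : Type*) [AddCommGroup M] [Module A M] (x : L) : A →+* DerDual A M x where
  toFun a := DerDual.mk x (algebraMap A _ a) (algebraMap A _ ⁅x, a⁆)
  map_one' := DerDual.ext (by simp [DerDual.fst_mk, DerDual.fst_one])
    (by simp [DerDual.snd_mk, DerDual.snd_one, lie_one])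
  map_zero' := DerDual.ext (by simp [DerDual.fst_mk, DerDual.fst_zero])
    (by simp [DerDual.snd_mk, DerDual.snd_zero])
  map_add' a b := DerDual.ext (by simp [DerDual.fst_mk, DerDual.fst_add])
    (by simp only [DerDual.snd_mk, DerDual.snd_add, lie_add, map_add])
  map_mul' a b := DerDual.ext (by simp [DerDual.fst_mk, DerDual.fst_mul])
    (by simp only [DerDual.snd_mk, DerDual.snd_mul, DerDual.fst_mk,
          LieRinehartRing.leibniz_mul_right, map_add, map_mul, smul_eq_mul])

theorem derDualHom_fst (x : L) (a : A) : (derDualHom M x a).fst = algebraMap A _ a :=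
  DerDual.fst_mk _ _ _

theorem derDualHom_snd (x : L) (a : A) : (derDualHom M x a).snd = algebraMap A _ ⁅x, a⁆ :=
  DerDual.snd_mk _ _ _

instance (x : L) : Algebra A (DerDual A M x) :=
  RingHom.toAlgebra' (derDualHom M x) fun a u =>
    DerDual.ext (by simp only [DerDual.fst_mul, derDualHom_fst, Algebra.commutes])
      (by simp only [DerDual.snd_mul, derDualHom_fst, derDualHom_snd, Algebra.commutes, add_comm])

theorem derDual_algebraMap (x : L) (a : A) :
    algebraMap A (DerDual A M x) a = derDualHom M x a := rfl

/-- The algebra homomorphism `u ↦ u + x(u) ε` that describes the derivation of the exterior algebra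
induced by `x`. -/
def extDerHom (M : Type*) [AddCommGroup M] [Module A M] [LieRingModule L M]
    [LieRinehartModule A L M] (x : L) : ExteriorAlgebra A M →ₐ[A] DerDual A M x :=
  ExteriorAlgebra.lift A
    ⟨{ toFun := fun m => DerDual.mk x (ExteriorAlgebra.ι A m) (ExteriorAlgebra.ι A ⁅x, m⁆)
       map_add' := fun m n => DerDual.ext
        (by simp only [DerDual.fst_mk, DerDual.fst_add, map_add])
        (by simp only [DerDual.snd_mk, DerDual.snd_add, lie_add, map_add])
       map_smul' := fun a m => by
        rw [Algebra.smul_def, derDual_algebraMap]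
        exact DerDual.ext
          (by simp only [DerDual.fst_mk, DerDual.fst_mul, derDualHom_fst, map_smul,
                Algebra.smul_def, RingHom.id_apply])
          (by simp only [DerDual.fst_mk, DerDual.snd_mk, DerDual.snd_mul, derDualHom_fst,
                derDualHom_snd, map_smul, LieRinehartModule.lie_smul_act, map_add,
                Algebra.smul_def, RingHom.id_apply, add_comm]) },
      fun m => DerDual.ext
        (by simp only [LinearMap.coe_mk, AddHom.coe_mk, DerDual.fst_mk, DerDual.fst_mul,
              ExteriorAlgebra.ι_sq_zero, DerDual.fst_zero])
        (by simp only [LinearMap.coe_mk, AddHom.coe_mk, DerDual.fst_mk, DerDual.snd_mk,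
              DerDual.snd_mul, ExteriorAlgebra.ι_add_mul_swap, DerDual.snd_zero])⟩

/-- The derivation `u ↦ x · u` of the exterior algebra induced by the action of `x` on `A`
and on `M`. -/
def extDer (M : Type*) [AddCommGroup M] [Module A M] [LieRingModule L M]
    [LieRinehartModule A L M] (x : L) (u : ExteriorAlgebra A M) : ExteriorAlgebra A M :=
  (extDerHom M x u).snd

theorem extDerHom_fst (x : L) (u : ExteriorAlgebra A M) : (extDerHom M x u).fst = u := by
  induction u using ExteriorAlgebra.induction with
  | algebraMap a => rw [AlgHom.commutes, derDual_algebraMap, derDualHom_fst]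
  | ι m => rw [extDerHom, ExteriorAlgebra.lift_ι_apply]; exact DerDual.fst_mk _ _ _
  | mul u v hu hv => rw [map_mul, DerDual.fst_mul, hu, hv]
  | add u v hu hv => rw [map_add, DerDual.fst_add, hu, hv]

theorem extDer_algebraMap (x : L) (a : A) :
    extDer M x (algebraMap A (ExteriorAlgebra A M) a) = algebraMap A _ ⁅x, a⁆ := by
  rw [extDer, AlgHom.commutes, derDual_algebraMap, derDualHom_snd]

theorem extDer_ι (x : L) (m : M) :
    extDer M x (ExteriorAlgebra.ι A m) = ExteriorAlgebra.ι A ⁅x, m⁆ := by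
  rw [extDer, extDerHom, ExteriorAlgebra.lift_ι_apply]
  exact DerDual.snd_mk _ _ _

theorem extDer_add (x : L) (u v : ExteriorAlgebra A M) :
    extDer M x (u + v) = extDer M x u + extDer M x v := by
  rw [extDer, map_add, DerDual.snd_add]; rfl

theorem extDer_mul (x : L) (u v : ExteriorAlgebra A M) :
    extDer M x (u * v) = u * extDer M x v + extDer M x u * v := by
  rw [extDer, map_mul, DerDual.snd_mul, extDerHom_fst, extDerHom_fst]; rfl

theorem extDer_smul (x : L) (a : A) (u : ExteriorAlgebra A M) :
    extDer M x (a • u) = ⁅x, a⁆ • u + a • extDer M x u := by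
  rw [Algebra.smul_def, extDer_mul, extDer_algebraMap, Algebra.smul_def, Algebra.smul_def, add_comm]

theorem extDer_add_left (x y : L) (u : ExteriorAlgebra A M) :
    extDer M (x + y) u = extDer M x u + extDer M y u := by
  induction u using ExteriorAlgebra.induction with
  | algebraMap a => simp [extDer_algebraMap]
  | ι m => simp [extDer_ι]
  | mul u v hu hv => simp only [extDer_mul, hu, hv, mul_add, add_mul]; abel
  | add u v hu hv => simp only [extDer_add, hu, hv]; abel

theorem extDer_smul_left (a : A) (x : L) (u : ExteriorAlgebra A M) :
    extDer M (a • x) u = a • extDer M x u := by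
  induction u using ExteriorAlgebra.induction with
  | algebraMap b => simp [extDer_algebraMap, Algebra.smul_def]
  | ι m => simp [extDer_ι, LieRinehartModule.smul_lie_act]
  | mul u v hu hv => simp only [extDer_mul, hu, hv, smul_add, mul_smul_comm, smul_mul_assoc]
  | add u v hu hv => simp only [extDer_add, hu, hv, smul_add]

variable [Module R M] [IsScalarTower R A M]

variable (R A L M) in
/-- The `(A, L)`-module structure on the exterior algebra `Λ_A M` induced by that on `M`:
`L` acts by derivations that extend the actions on `A` and on `M`. -/
def Connection.exterior : Connection R A L (ExteriorAlgebra A M) where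
  toFun :=
    { toFun := fun x =>
        { toFun := extDer M x
          map_add' := extDer_add x
          map_smul' := fun r u => by
            rw [← algebraMap_smul A r u, extDer_smul, lie_algebraMap x r, zero_smul, zero_add,
              algebraMap_smul, RingHom.id_apply] }
      map_add' := fun x y => LinearMap.ext fun u => extDer_add_left x y u
      map_smul' := fun a x => LinearMap.ext fun u => extDer_smul_left a x u }
  leibniz x a u := extDer_smul x a u

end Exterior

section Differential

theorem removeNth_swap {A L N : Type*} [CommRing A] [AddCommGroup L] [Module A L]
    [AddCommGroup N] [Module A N] {p : ℕ} (f : L [⋀^Fin p]→ₗ[A] N) (v : Fin (p + 1) → L)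
    {i j : Fin (p + 1)} (h : v i = v j) (hij : i ≠ j) :
    (-1 : ℤ) ^ (i : ℕ) • f (i.removeNth v) = - ((-1 : ℤ) ^ (j : ℕ) • f (j.removeNth v)) :=
  eq_neg_of_add_eq_zero_left (f.neg_one_pow_smul_map_removeNth_add_eq_zero_of_eq h hij)

theorem exists_removeNth_update {L : Type*} {p : ℕ} {i j : Fin (p + 1)} (hij : i ≠ j) :
    ∃ k : Fin p, j.succAbove k = i ∧ ∀ (ξ : Fin (p + 1) → L) (y : L),
      j.removeNth (Function.update ξ i y) = Function.update (j.removeNth ξ) k y := by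
  obtain ⟨k, rfl⟩ := Fin.exists_succAbove_eq hij
  exact ⟨k, rfl, fun ξ y => Fin.removeNth_update_succAbove j k y ξ⟩

/-- Splitting off the terms that involve the index `k` from a sum over pairs `i < j`. -/
theorem sum_pairs_split {N : Type*} [AddCommGroup N] {n : ℕ} (F : Fin n → Fin n → N)
    (hF : ∀ i j, i ≠ j → F i j = F j i) (k : Fin n) :
    (∑ i, ∑ j, if i < j then F i j else 0) =
      (∑ i, if i = k then 0 else F i k) +
        ∑ i, ∑ j, if i < j then (if i = k ∨ j = k then 0 else F i j) else 0 := by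
  have h1 : ∀ i j, (if i < j then F i j else 0) =
      (if j = k then (if i < k then F i k else 0) else 0) +
      (if i = k then (if k < j then F j k else 0) else 0) +
      (if i < j then (if i = k ∨ j = k then 0 else F i j) else 0) := by
    intro i j
    by_cases hj : j = k
    · subst hj
      by_cases hi : i = j
      · subst hi; simp
      · simp [hi]
    · by_cases hi : i = k
      · subst hi
        by_cases hlt : i < j
        · simp only [hj, hlt, hF i j hlt.ne, if_true, if_false, true_or, zero_add, add_zero]
        · simp [hj, hlt]
      · rw [if_neg hj, if_neg hi, if_neg (not_or.mpr ⟨hi, hj⟩), zero_add, zero_add]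
  rw [Finset.sum_congr rfl fun i _ => Finset.sum_congr rfl fun j _ => h1 i j]
  simp only [Finset.sum_add_distrib]
  congr 1
  have e1 : (∑ i, ∑ j, if j = k then (if i < k then F i k else 0) else 0) =
      ∑ i, if i < k then F i k else 0 := by simp
  have e2 : (∑ i, ∑ j, if i = k then (if k < j then F j k else 0) else 0) =
      ∑ i, if k < i then F i k else 0 := by
    rw [Finset.sum_comm]; simp
  rw [e1, e2, ← Finset.sum_add_distrib]
  refine Finset.sum_congr rfl fun i _ => ?_
  rcases lt_trichotomy i k with h | h | h
  · simp [h, h.ne, h.not_gt]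
  · simp [h]
  · simp [h, h.ne', h.not_gt]

variable {R A L N : Type*} [CommRing R] [CommRing A] [Algebra R A]
  [LieRing L] [Module A L] [LieRingModule L A] [LieRinehartRing A L]
  [AddCommGroup N] [Module A N] [Module R N] [IsScalarTower R A N]

/-- `(-1)^j f(..., [ξ_i, ξ_j], ..., ξ̂_j, ...)`, the bracket standing in the place of `ξ_i`. For
`i < j` (positions being counted from `0`) this is
`(-1)^(i+j) f([ξ_i, ξ_j], ξ_0, ..., ξ̂_i, ..., ξ̂_j, ..., ξ_p)`. -/
def ceTerm {p : ℕ} (f : L [⋀^Fin p]→ₗ[A] N) (ξ : Fin (p + 1) → L) (i j : Fin (p + 1)) : N :=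
  (-1 : ℤ) ^ (j : ℕ) • f (j.removeNth (Function.update ξ i ⁅ξ i, ξ j⁆))

/-- The Cartan-Chevalley-Eilenberg formula
`∑ i, (-1)^i ∇_{ξ_i} f(ξ_0, ..., ξ̂_i, ..., ξ_p)
  + ∑ i < j, (-1)^(i+j) f([ξ_i, ξ_j], ξ_0, ..., ξ̂_i, ..., ξ̂_j, ..., ξ_p)`. -/
def ceFun (D : Connection R A L N) {p : ℕ} (f : L [⋀^Fin p]→ₗ[A] N) (ξ : Fin (p + 1) → L) : N :=
  (∑ i : Fin (p + 1), (-1 : ℤ) ^ (i : ℕ) • D.toFun (ξ i) (f (i.removeNth ξ))) +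
    ∑ i : Fin (p + 1), ∑ j : Fin (p + 1), if i < j then ceTerm f ξ i j else 0

theorem ceTerm_symm {p : ℕ} (f : L [⋀^Fin p]→ₗ[A] N) (ξ : Fin (p + 1) → L) (i j : Fin (p + 1))
    (hij : i ≠ j) : ceTerm f ξ i j = ceTerm f ξ j i := by
  unfold ceTerm
  obtain ⟨k, -, hk⟩ := exists_removeNth_update (L := L) hij.symm
  have h := removeNth_swap f (Function.update (Function.update ξ i ⁅ξ i, ξ j⁆) j ⁅ξ i, ξ j⁆)
    (i := i) (j := j) (by simp [hij]) hij
  rw [Fin.removeNth_update, Function.update_comm hij, Fin.removeNth_update] at h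
  have e : ⁅ξ j, ξ i⁆ = -⁅ξ i, ξ j⁆ := (lie_skew (ξ j) (ξ i)).symm
  rw [e, hk, f.map_update_neg, smul_neg, ← hk, h, neg_neg]

/-- The summand of `ceFun` in which the argument number `k` is differentiated by, or bracketed
with, the argument number `i`, as a function of the argument number `k`. -/
def ceAux (D : Connection R A L N) {p : ℕ} (f : L [⋀^Fin p]→ₗ[A] N) (ξ : Fin (p + 1) → L)
    (k i : Fin (p + 1)) (y : L) : N :=
  (-1 : ℤ) ^ (i : ℕ) • D.toFun (ξ i) (f (i.removeNth (Function.update ξ k y))) +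
    (-1 : ℤ) ^ (k : ℕ) • f (k.removeNth (Function.update ξ i ⁅ξ i, y⁆))

theorem ceAux_add (D : Connection R A L N) {p : ℕ} (f : L [⋀^Fin p]→ₗ[A] N)
    (ξ : Fin (p + 1) → L) {k i : Fin (p + 1)} (hik : i ≠ k) (y z : L) :
    ceAux D f ξ k i (y + z) = ceAux D f ξ k i y + ceAux D f ξ k i z := by
  obtain ⟨m, -, hm⟩ := exists_removeNth_update (L := L) hik
  obtain ⟨m', -, hm'⟩ := exists_removeNth_update (L := L) hik.symm
  simp only [ceAux, hm, hm', lie_add, f.map_update_add, map_add, smul_add]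
  abel

theorem ceAux_smul (D : Connection R A L N) {p : ℕ} (f : L [⋀^Fin p]→ₗ[A] N)
    (ξ : Fin (p + 1) → L) {k i : Fin (p + 1)} (hik : i ≠ k) (a : A) (y : L) :
    ceAux D f ξ k i (a • y) = a • ceAux D f ξ k i y := by
  obtain ⟨m, -, hm⟩ := exists_removeNth_update (L := L) hik
  obtain ⟨m', -, hm'⟩ := exists_removeNth_update (L := L) hik.symm
  have h := removeNth_swap f (Function.update (Function.update ξ i y) k y)
    (i := i) (j := k) (by simp [hik]) hik
  rw [Fin.removeNth_update, Function.update_comm hik, Fin.removeNth_update] at h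
  have h2 : (-1 : ℤ) ^ (k : ℕ) • ⁅ξ i, a⁆ • f (k.removeNth (Function.update ξ i y)) =
      -((-1 : ℤ) ^ (i : ℕ) • ⁅ξ i, a⁆ • f (i.removeNth (Function.update ξ k y))) := by
    rw [smul_comm, ← neg_eq_iff_eq_neg.mpr h, smul_neg, smul_comm]
  simp only [hm, hm'] at h2
  simp only [ceAux, hm, hm', LieRinehartRing.leibniz_smul_right, f.map_update_add,
    f.map_update_smul, D.leibniz, smul_add, h2, smul_comm a]
  abel

theorem ceFun_update (D : Connection R A L N) {p : ℕ} (f : L [⋀^Fin p]→ₗ[A] N)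
    (ξ : Fin (p + 1) → L) (k : Fin (p + 1)) (y : L) :
    ceFun D f (Function.update ξ k y) =
      (-1 : ℤ) ^ (k : ℕ) • D.toFun y (f (k.removeNth ξ)) +
      (∑ i, if i = k then 0 else ceAux D f ξ k i y) +
      ∑ i, ∑ j, if i < j then (if i = k ∨ j = k then 0 else
        (-1 : ℤ) ^ (j : ℕ) •
          f (j.removeNth (Function.update (Function.update ξ i ⁅ξ i, ξ j⁆) k y))) else 0 := by
  rw [ceFun, sum_pairs_split _ (fun i j h => ceTerm_symm f _ i j h) k, ← add_assoc]
  congr 1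
  · have e : ∀ i : Fin (p + 1), (-1 : ℤ) ^ (i : ℕ) • D.toFun (Function.update ξ k y i)
          (f (i.removeNth (Function.update ξ k y))) =
        (if i = k then (-1 : ℤ) ^ (k : ℕ) • D.toFun y (f (k.removeNth ξ)) else 0) +
        (if i = k then 0 else (-1 : ℤ) ^ (i : ℕ) • D.toFun (ξ i)
          (f (i.removeNth (Function.update ξ k y)))) := by
      intro i
      by_cases h : i = k
      · subst h; simp
      · simp [h]
    simp_rw [e, Finset.sum_add_distrib]
    rw [add_assoc, ← Finset.sum_add_distrib]
    congr 1
    · simp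
    · refine Finset.sum_congr rfl fun i _ => ?_
      by_cases h : i = k
      · simp [h]
      · simp only [h, if_false, ceAux, ceTerm, Function.update_self, ne_eq, not_false_eq_true,
          Function.update_of_ne]
        rw [Function.update_comm (Ne.symm h), Fin.removeNth_update]
  · refine Finset.sum_congr rfl fun i _ => Finset.sum_congr rfl fun j _ => ?_
    by_cases h : i = k ∨ j = k
    · simp [h]
    · push Not at h
      simp only [h.1, h.2, or_self, if_false, ceTerm, ne_eq, not_false_eq_true,
        Function.update_of_ne]
      rw [Function.update_comm (Ne.symm h.1)]

theorem ceFun_update_add (D : Connection R A L N) {p : ℕ} (f : L [⋀^Fin p]→ₗ[A] N)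
    (ξ : Fin (p + 1) → L) (k : Fin (p + 1)) (y z : L) :
    ceFun D f (Function.update ξ k (y + z)) =
      ceFun D f (Function.update ξ k y) + ceFun D f (Function.update ξ k z) := by
  have e1 : ∀ i, (if i = k then (0 : N) else ceAux D f ξ k i (y + z)) =
      (if i = k then 0 else ceAux D f ξ k i y) + (if i = k then 0 else ceAux D f ξ k i z) := by
    intro i
    by_cases h : i = k
    · simp [h]
    · simp [h, ceAux_add]
  have e2 : ∀ i j, (if i < j then (if i = k ∨ j = k then (0 : N) else
        (-1 : ℤ) ^ (j : ℕ) •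
          f (j.removeNth (Function.update (Function.update ξ i ⁅ξ i, ξ j⁆) k (y + z)))) else 0) =
      (if i < j then (if i = k ∨ j = k then 0 else
        (-1 : ℤ) ^ (j : ℕ) •
          f (j.removeNth (Function.update (Function.update ξ i ⁅ξ i, ξ j⁆) k y))) else 0) +
      (if i < j then (if i = k ∨ j = k then 0 else
        (-1 : ℤ) ^ (j : ℕ) •
          f (j.removeNth (Function.update (Function.update ξ i ⁅ξ i, ξ j⁆) k z))) else 0) := by
    intro i j
    split_ifs with h1 h2
    · simp
    · push Not at h2
      obtain ⟨m, -, hm⟩ := exists_removeNth_update (L := L) (Ne.symm h2.2)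
      simp only [hm, f.map_update_add, smul_add]
    · simp
  simp_rw [ceFun_update, e1, e2, Finset.sum_add_distrib, map_add, LinearMap.add_apply, smul_add]
  abel

theorem ceFun_update_smul (D : Connection R A L N) {p : ℕ} (f : L [⋀^Fin p]→ₗ[A] N)
    (ξ : Fin (p + 1) → L) (k : Fin (p + 1)) (a : A) (y : L) :
    ceFun D f (Function.update ξ k (a • y)) = a • ceFun D f (Function.update ξ k y) := by
  have e1 : ∀ i, (if i = k then (0 : N) else ceAux D f ξ k i (a • y)) =
      a • (if i = k then 0 else ceAux D f ξ k i y) := by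
    intro i
    by_cases h : i = k
    · simp [h]
    · simp [h, ceAux_smul]
  have e2 : ∀ i j, (if i < j then (if i = k ∨ j = k then (0 : N) else
        (-1 : ℤ) ^ (j : ℕ) •
          f (j.removeNth (Function.update (Function.update ξ i ⁅ξ i, ξ j⁆) k (a • y)))) else 0) =
      a • (if i < j then (if i = k ∨ j = k then 0 else
        (-1 : ℤ) ^ (j : ℕ) •
          f (j.removeNth (Function.update (Function.update ξ i ⁅ξ i, ξ j⁆) k y))) else 0) := by
    intro i j
    split_ifs with h1 h2
    · simp
    · push Not at h2
      obtain ⟨m, -, hm⟩ := exists_removeNth_update (L := L) (Ne.symm h2.2)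
      simp only [hm, f.map_update_smul, smul_comm a]
    · simp
  simp_rw [ceFun_update, e1, e2, ← Finset.smul_sum, map_smul, LinearMap.smul_apply, smul_add,
    smul_comm a]

theorem ceFun_eq_zero (D : Connection R A L N) {p : ℕ} (f : L [⋀^Fin p]→ₗ[A] N)
    (ξ : Fin (p + 1) → L) {a b : Fin (p + 1)} (h : ξ a = ξ b) (hab : a ≠ b) :
    ceFun D f ξ = 0 := by
  have hrep : ∀ i : Fin (p + 1), a ≠ i → b ≠ i → ∀ v : Fin (p + 1) → L, v a = v b →
      f (i.removeNth v) = 0 := by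
    intro i hai hbi v hv
    obtain ⟨m, rfl⟩ := Fin.exists_succAbove_eq hai
    obtain ⟨m', rfl⟩ := Fin.exists_succAbove_eq hbi
    refine f.map_eq_zero_of_eq _ (i := m) (j := m') hv ?_
    rintro rfl
    exact hab rfl
  have h0 : ∀ i j, i ≠ j → a ≠ i → a ≠ j → b ≠ i → b ≠ j → ceTerm f ξ i j = 0 := by
    intro i j _ h1 h2 h3 h4
    rw [ceTerm, hrep j h2 h4 _ (by simp [h1, h3, h]), smul_zero]
  have h1 : ceTerm f ξ b a = 0 := by
    obtain ⟨m, -, hm⟩ := exists_removeNth_update (L := L) hab.symm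
    rw [ceTerm, h, lie_self, hm, f.map_update_zero, smul_zero]
  have h2 : ∀ c, c ≠ a → c ≠ b → ceTerm f ξ c a + ceTerm f ξ c b = 0 := by
    intro c hca hcb
    rw [ceTerm, ceTerm, h, removeNth_swap f _ (i := a) (j := b) _ hab]
    · simp
    · simp [hca.symm, hcb.symm, h]
  have hfirst : (∑ i : Fin (p + 1), (-1 : ℤ) ^ (i : ℕ) • D.toFun (ξ i) (f (i.removeNth ξ))) = 0 := by
    rw [Fintype.sum_eq_add a b hab]
    · rw [h, ← map_zsmul (D.toFun (ξ b)), ← map_zsmul (D.toFun (ξ b)), removeNth_swap f ξ h hab,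
        map_neg, neg_add_cancel]
    · rintro x ⟨hxa, hxb⟩
      rw [hrep x hxa.symm hxb.symm ξ h, map_zero, smul_zero]
  rw [ceFun, hfirst, zero_add, sum_pairs_split _ (fun i j h => ceTerm_symm f _ i j h) a,
    sum_pairs_split (fun i j => if i = a ∨ j = a then 0 else ceTerm f ξ i j) _ b, ← add_assoc,
    ← Finset.sum_add_distrib]
  · have z : ∀ i, ((if i = a then 0 else ceTerm f ξ i a) +
        if i = b then 0 else if i = a ∨ b = a then 0 else ceTerm f ξ i b) = 0 := by
      intro i
      by_cases hia : i = a
      · simp [hia]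
      · by_cases hib : i = b
        · subst hib; simp [hia, h1]
        · simp [hia, hib, hab.symm, h2]
    have z' : ∀ i j, (if i < j then if i = b ∨ j = b then 0 else
        if i = a ∨ j = a then 0 else ceTerm f ξ i j else 0) = 0 := by
      intro i j
      split_ifs with g1 g2 g3
      · rfl
      · rfl
      · push Not at g2 g3
        exact h0 i j g1.ne g3.1.symm g3.2.symm g2.1.symm g2.2.symm
      · rfl
    simp [z, z']
  · intro i j hij
    simp only [or_comm, ceTerm_symm f ξ i j hij]

/-- The Lie-Rinehart differential `Alt^p_A(L, N) → Alt^{p+1}_A(L, N)` of a connection. -/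
def ceDiff (D : Connection R A L N) (p : ℕ) :
    (L [⋀^Fin p]→ₗ[A] N) →ₗ[R] (L [⋀^Fin (p + 1)]→ₗ[A] N) where
  toFun f :=
    { toFun := ceFun D f
      map_update_add' := fun {inst} ξ k y z => by
        rw [Subsingleton.elim inst (instDecidableEqFin _)]
        exact ceFun_update_add D f ξ k y z
      map_update_smul' := fun {inst} ξ k a y => by
        rw [Subsingleton.elim inst (instDecidableEqFin _)]
        exact ceFun_update_smul D f ξ k a y
      map_eq_zero_of_eq' := fun ξ _ _ h hab => ceFun_eq_zero D f ξ h hab }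
  map_add' f g := by
    ext ξ
    have e : ∀ i j, (if i < j then ceTerm (f + g) ξ i j else 0) =
        (if i < j then ceTerm f ξ i j else 0) + (if i < j then ceTerm g ξ i j else 0) := by
      intro i j
      split_ifs <;> simp [ceTerm]
    change ceFun D (f + g) ξ = ceFun D f ξ + ceFun D g ξ
    simp only [ceFun, e, Finset.sum_add_distrib, AlternatingMap.add_apply, map_add, smul_add]
    abel
  map_smul' r f := by
    ext ξ
    have e : ∀ i j, (if i < j then ceTerm (r • f) ξ i j else 0) =
        r • (if i < j then ceTerm f ξ i j else 0) := by
      intro i j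
      split_ifs <;> simp [ceTerm, smul_comm r]
    change ceFun D (r • f) ξ = r • ceFun D f ξ
    simp only [ceFun, e, Finset.smul_sum, AlternatingMap.smul_apply, map_smul, smul_add,
      smul_comm _ r]

end Differential
section FormAction

variable {R A L M : Type*} [CommRing R] [CommRing A] [Algebra R A]
  [LieRing L] [Module A L] [LieRingModule L A] [LieRinehartRing A L]
  [AddCommGroup M] [Module A M] [LieRingModule L M] [LieRinehartModule A L M]

theorem formAct_sum (x : L) {p : ℕ} (b : M [⋀^Fin p]→ₗ[A] A) (ξ : Fin p → M) (k : Fin p) (y : M) :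
    (∑ j, b (Function.update (Function.update ξ k y) j ⁅x, Function.update ξ k y j⁆)) =
      b (Function.update ξ k ⁅x, y⁆) +
        ∑ j, if j = k then 0 else b (Function.update (Function.update ξ j ⁅x, ξ j⁆) k y) := by
  have e : ∀ j, b (Function.update (Function.update ξ k y) j ⁅x, Function.update ξ k y j⁆) =
      (if j = k then b (Function.update ξ k ⁅x, y⁆) else 0) +
        if j = k then 0 else b (Function.update (Function.update ξ j ⁅x, ξ j⁆) k y) := by
    intro j
    by_cases h : j = k
    · subst h; simp
    · rw [if_neg h, if_neg h, zero_add, Function.update_of_ne h, Function.update_comm (Ne.symm h)]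
  simp only [e, Finset.sum_add_distrib, Finset.sum_ite_eq', Finset.mem_univ, if_true]

theorem formAct_add (x : L) {p : ℕ} (b : M [⋀^Fin p]→ₗ[A] A) (ξ : Fin p → M) (k : Fin p)
    (y z : M) :
    (∑ j, if j = k then 0 else b (Function.update (Function.update ξ j ⁅x, ξ j⁆) k (y + z))) =
      (∑ j, if j = k then 0 else b (Function.update (Function.update ξ j ⁅x, ξ j⁆) k y)) +
      ∑ j, if j = k then 0 else b (Function.update (Function.update ξ j ⁅x, ξ j⁆) k z) := by
  rw [← Finset.sum_add_distrib]
  refine Finset.sum_congr rfl fun j _ => ?_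
  split_ifs
  · simp
  · rw [b.map_update_add]

theorem formAct_smul (x : L) {p : ℕ} (b : M [⋀^Fin p]→ₗ[A] A) (ξ : Fin p → M) (k : Fin p)
    (a : A) (y : M) :
    (∑ j, if j = k then 0 else b (Function.update (Function.update ξ j ⁅x, ξ j⁆) k (a • y))) =
      a * ∑ j, if j = k then 0 else b (Function.update (Function.update ξ j ⁅x, ξ j⁆) k y) := by
  rw [Finset.mul_sum]
  refine Finset.sum_congr rfl fun j _ => ?_
  split_ifs
  · simp
  · rw [b.map_update_smul, smul_eq_mul]

/-- The action of `x ∈ L` on `Alt^p_A(M, A)` that is induced by the actions on `A` and `M`: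
`(x · b)(ξ_1, ..., ξ_p) = x(b(ξ_1, ..., ξ_p)) - ∑ k, b(ξ_1, ..., x · ξ_k, ..., ξ_p)`. -/
def formAct (x : L) {p : ℕ} (b : M [⋀^Fin p]→ₗ[A] A) : M [⋀^Fin p]→ₗ[A] A where
  toFun ξ := ⁅x, b ξ⁆ - ∑ k, b (Function.update ξ k ⁅x, ξ k⁆)
  map_update_add' := fun {inst} ξ k y z => by
    rw [Subsingleton.elim inst (instDecidableEqFin _)]
    simp only [formAct_sum, formAct_add]
    simp only [b.map_update_add, lie_add]
    abel
  map_update_smul' := fun {inst} ξ k a y => by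
    rw [Subsingleton.elim inst (instDecidableEqFin _)]
    simp only [formAct_sum, formAct_smul]
    simp only [b.map_update_smul, b.map_update_add,
      LieRinehartModule.lie_smul_act, smul_eq_mul, LieRinehartRing.leibniz_mul_right]
    ring
  map_eq_zero_of_eq' := fun ξ i j h hij => by
    have hsum : (∑ k, b (Function.update ξ k ⁅x, ξ k⁆)) = 0 := by
      rw [Fintype.sum_eq_add i j hij]
      · have e : Function.update ξ j ⁅x, ξ j⁆ = Function.update ξ i ⁅x, ξ i⁆ ∘ Equiv.swap i j := by
          funext l
          by_cases hli : l = i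
          · subst hli; simp [hij, hij.symm, h]
          · by_cases hlj : l = j
            · subst hlj; simp [h]
            · simp [hli, hlj, Equiv.swap_apply_of_ne_of_ne]
        rw [e, b.map_swap _ hij, add_neg_cancel]
      · rintro k ⟨hki, hkj⟩
        exact b.map_eq_zero_of_eq _ (by simp [hki.symm, hkj.symm, h]) hij
    change ⁅x, b ξ⁆ - _ = 0
    rw [hsum, b.map_eq_zero_of_eq ξ h hij, lie_zero, sub_zero]

/-- The action of `x ∈ L` on the dual `M^* = Hom_A(M, A)`. -/
def dualAct (x : L) (φ : Module.Dual A M) : Module.Dual A M where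
  toFun m := ⁅x, φ m⁆ - φ ⁅x, m⁆
  map_add' m n := by simp only [map_add, lie_add]; abel
  map_smul' a m := by
    simp only [map_smul, LieRinehartRing.leibniz_mul_right, LieRinehartModule.lie_smul_act,
      map_add, RingHom.id_apply, smul_eq_mul]
    ring

end FormAction

section Semidirect

/-- The underlying `A`-module `L ⊕ M^*` of the semidirect product `L ⋉ M^*`. -/
def Semidirect (A L M : Type*) [CommRing A] [AddCommGroup M] [Module A M] : Type _ :=
  L × Module.Dual A M

variable {R A L M : Type*} [CommRing R] [CommRing A] [Algebra R A]
  [LieRing L] [Module A L] [LieRingModule L A] [LieRinehartRing A L] [LieAlgebra R L]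
  [LieRinehartAlgebra R A L]
  [AddCommGroup M] [Module A M] [LieRingModule L M] [LieRinehartModule A L M]

instance : AddCommGroup (Semidirect A L M) := inferInstanceAs (AddCommGroup (L × Module.Dual A M))

instance : Module A (Semidirect A L M) := inferInstanceAs (Module A (L × Module.Dual A M))

instance : Module R (Semidirect A L M) := inferInstanceAs (Module R (L × Module.Dual A M))

/-- The semidirect product Lie bracket, with `M^*` as an abelian ideal:
`[(x, φ), (y, ψ)] = ([x, y], x · ψ - y · φ)`. -/
instance : LieRing (Semidirect A L M) where
  bracket u v := (⁅u.1, v.1⁆, dualAct u.1 v.2 - dualAct v.1 u.2)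
  add_lie u v w := by
    refine Prod.ext (add_lie u.1 v.1 w.1) (LinearMap.ext fun m => ?_)
    change ⁅u.1 + v.1, w.2 m⁆ - w.2 ⁅u.1 + v.1, m⁆ -
      (⁅w.1, (u.2 + v.2) m⁆ - (u.2 + v.2) ⁅w.1, m⁆) =
      (⁅u.1, w.2 m⁆ - w.2 ⁅u.1, m⁆ - (⁅w.1, u.2 m⁆ - u.2 ⁅w.1, m⁆)) +
      (⁅v.1, w.2 m⁆ - w.2 ⁅v.1, m⁆ - (⁅w.1, v.2 m⁆ - v.2 ⁅w.1, m⁆))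
    simp only [add_lie, LinearMap.add_apply, map_add, lie_add]
    abel
  lie_add u v w := by
    refine Prod.ext (lie_add u.1 v.1 w.1) (LinearMap.ext fun m => ?_)
    change ⁅u.1, (v.2 + w.2) m⁆ - (v.2 + w.2) ⁅u.1, m⁆ -
      (⁅v.1 + w.1, u.2 m⁆ - u.2 ⁅v.1 + w.1, m⁆) =
      (⁅u.1, v.2 m⁆ - v.2 ⁅u.1, m⁆ - (⁅v.1, u.2 m⁆ - u.2 ⁅v.1, m⁆)) +
      (⁅u.1, w.2 m⁆ - w.2 ⁅u.1, m⁆ - (⁅w.1, u.2 m⁆ - u.2 ⁅w.1, m⁆))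
    simp only [add_lie, LinearMap.add_apply, map_add, lie_add]
    abel
  lie_self u := Prod.ext (lie_self u.1) (sub_self _)
  leibniz_lie u v w := by
    refine Prod.ext (leibniz_lie u.1 v.1 w.1) (LinearMap.ext fun m => ?_)
    change (⁅u.1, ⁅v.1, w.2 m⁆ - w.2 ⁅v.1, m⁆ - (⁅w.1, v.2 m⁆ - v.2 ⁅w.1, m⁆)⁆ -
        (⁅v.1, w.2 ⁅u.1, m⁆⁆ - w.2 ⁅v.1, ⁅u.1, m⁆⁆ - (⁅w.1, v.2 ⁅u.1, m⁆⁆ - v.2 ⁅w.1, ⁅u.1, m⁆⁆))) -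
        (⁅⁅v.1, w.1⁆, u.2 m⁆ - u.2 ⁅⁅v.1, w.1⁆, m⁆) =
      ((⁅⁅u.1, v.1⁆, w.2 m⁆ - w.2 ⁅⁅u.1, v.1⁆, m⁆) -
        (⁅w.1, ⁅u.1, v.2 m⁆ - v.2 ⁅u.1, m⁆ - (⁅v.1, u.2 m⁆ - u.2 ⁅v.1, m⁆)⁆ -
        (⁅u.1, v.2 ⁅w.1, m⁆⁆ - v.2 ⁅u.1, ⁅w.1, m⁆⁆ - (⁅v.1, u.2 ⁅w.1, m⁆⁆ - u.2 ⁅v.1, ⁅w.1, m⁆⁆)))) +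
      ((⁅v.1, ⁅u.1, w.2 m⁆ - w.2 ⁅u.1, m⁆ - (⁅w.1, u.2 m⁆ - u.2 ⁅w.1, m⁆)⁆ -
        (⁅u.1, w.2 ⁅v.1, m⁆⁆ - w.2 ⁅u.1, ⁅v.1, m⁆⁆ - (⁅w.1, u.2 ⁅v.1, m⁆⁆ - u.2 ⁅w.1, ⁅v.1, m⁆⁆))) -
        (⁅⁅u.1, w.1⁆, v.2 m⁆ - v.2 ⁅⁅u.1, w.1⁆, m⁆))
    simp only [lie_sub, lie_lie, map_sub]
    abel

/-- The semidirect product acts on `A` through the projection to `L`. -/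
instance : LieRingModule (Semidirect A L M) A where
  bracket u a := ⁅u.1, a⁆
  add_lie u v a := add_lie u.1 v.1 a
  lie_add u a b := lie_add u.1 a b
  leibniz_lie u v a := leibniz_lie u.1 v.1 a

instance : LieRinehartRing A (Semidirect A L M) where
  lie_smul_eq_mul' a b u := LieRinehartRing.lie_smul_eq_mul a b u.1
  leibniz_mul_right' u a b := LieRinehartRing.leibniz_mul_right u.1 a b
  leibniz_smul_right' u v a := by
    refine Prod.ext (LieRinehartRing.leibniz_smul_right u.1 v.1 a) (LinearMap.ext fun m => ?_)
    change (⁅u.1, a • v.2 m⁆ - a • v.2 ⁅u.1, m⁆) - (⁅a • v.1, u.2 m⁆ - u.2 ⁅a • v.1, m⁆) =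
      a • ((⁅u.1, v.2 m⁆ - v.2 ⁅u.1, m⁆) - (⁅v.1, u.2 m⁆ - u.2 ⁅v.1, m⁆)) + ⁅u.1, a⁆ • v.2 m
    simp only [LieRinehartRing.leibniz_mul_right, LieRinehartRing.lie_smul_eq_mul,
      LieRinehartModule.smul_lie_act, map_smul, smul_eq_mul]
    ring

instance : IsScalarTower R A (Semidirect A L M) :=
  inferInstanceAs (IsScalarTower R A (L × Module.Dual A M))

instance : LieAlgebra R (Semidirect A L M) where
  lie_smul r u v := by
    rw [← algebraMap_smul A r v, LieRinehartRing.leibniz_smul_right]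
    have h : ⁅u, algebraMap R A r⁆ = 0 := lie_algebraMap u.1 r
    rw [h, zero_smul, add_zero, algebraMap_smul]

instance : LieRinehartAlgebra R A (Semidirect A L M) where
  smul_lie r u a := smul_lie r u.1 a
  lie_smul r u a := LieModule.lie_smul r u.1 a

end Semidirect

section Forms

variable (R A L M : Type*) [CommRing R] [CommRing A] [Algebra R A]
  [AddCommGroup L] [Module A L] [Module R L] [IsScalarTower R A L]
  [AddCommGroup M] [Module A M]

/-- `Alt_A(M, Λ_A L)`, the alternating `A`-multilinear forms on `M` with values in the exterior
algebra of `L`. -/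
abbrev Forms : Type _ := ⨁ p : ℕ, (M [⋀^Fin p]→ₗ[A] ExteriorAlgebra A L)

variable {R A L M}

/-- The shuffle product of forms (a sum over `(p, r)`-shuffles with their signs), composed with the
product of `Λ_A L`. -/
def shuffle {p r : ℕ} (f : M [⋀^Fin p]→ₗ[A] ExteriorAlgebra A L)
    (g : M [⋀^Fin r]→ₗ[A] ExteriorAlgebra A L) : M [⋀^Fin (p + r)]→ₗ[A] ExteriorAlgebra A L :=
  ((LinearMap.mul' A (ExteriorAlgebra A L)).compAlternatingMap
    (AlternatingMap.domCoprod f g)).domDomCongr finSumFinEquiv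

theorem form_smul (r : R) {p : ℕ} (f : M [⋀^Fin p]→ₗ[A] ExteriorAlgebra A L) :
    r • f = algebraMap R A r • f := by
  ext ξ
  rw [AlternatingMap.smul_apply, AlternatingMap.smul_apply, algebraMap_smul]

theorem shuffle_smul_left (r : R) {p q : ℕ} (f : M [⋀^Fin p]→ₗ[A] ExteriorAlgebra A L)
    (g : M [⋀^Fin q]→ₗ[A] ExteriorAlgebra A L) : shuffle (r • f) g = r • shuffle f g := by
  rw [form_smul r f, form_smul r (shuffle f g)]
  simp only [shuffle, ← AlternatingMap.domCoprod'_apply, ← TensorProduct.smul_tmul', map_smul,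
    LinearMap.compAlternatingMap_smul]
  rfl

theorem shuffle_smul_right (r : R) {p q : ℕ} (f : M [⋀^Fin p]→ₗ[A] ExteriorAlgebra A L)
    (g : M [⋀^Fin q]→ₗ[A] ExteriorAlgebra A L) : shuffle f (r • g) = r • shuffle f g := by
  rw [form_smul r g, form_smul r (shuffle f g)]
  simp only [shuffle, ← AlternatingMap.domCoprod'_apply, TensorProduct.tmul_smul, map_smul,
    LinearMap.compAlternatingMap_smul]
  rfl

theorem shuffle_add_left {p q : ℕ} (f f' : M [⋀^Fin p]→ₗ[A] ExteriorAlgebra A L)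
    (g : M [⋀^Fin q]→ₗ[A] ExteriorAlgebra A L) :
    shuffle (f + f') g = shuffle f g + shuffle f' g := by
  simp only [shuffle, ← AlternatingMap.domCoprod'_apply, TensorProduct.add_tmul, map_add,
    LinearMap.compAlternatingMap_add]
  rfl

theorem shuffle_add_right {p q : ℕ} (f : M [⋀^Fin p]→ₗ[A] ExteriorAlgebra A L)
    (g g' : M [⋀^Fin q]→ₗ[A] ExteriorAlgebra A L) :
    shuffle f (g + g') = shuffle f g + shuffle f g' := by
  simp only [shuffle, ← AlternatingMap.domCoprod'_apply, TensorProduct.tmul_add, map_add,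
    LinearMap.compAlternatingMap_add]
  rfl

variable (R A L M)

/-- The product of forms of degrees `p` and `r`. For `f = b ⊗ u` and `g = c ⊗ v` with `A`-valued
forms `b`, `c` and `u ∈ Λ^q L` it is `(-1)^(q r) (b ∧ c) ⊗ u v`, the sign being implemented by the
grading involution of `Λ_A L`. -/
def formMul (p r : ℕ) : (M [⋀^Fin p]→ₗ[A] ExteriorAlgebra A L) →ₗ[R]
    (M [⋀^Fin r]→ₗ[A] ExteriorAlgebra A L) →ₗ[R] M [⋀^Fin (p + r)]→ₗ[A] ExteriorAlgebra A L :=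
  LinearMap.mk₂ R
    (fun f g => shuffle
      (((CliffordAlgebra.involute (Q := (0 : QuadraticForm A L))).toLinearMap ^ r).compAlternatingMap
        f) g)
    (fun f f' g => by rw [LinearMap.compAlternatingMap_add, shuffle_add_left])
    (fun c f g => by rw [LinearMap.compAlternatingMap_smul, shuffle_smul_left])
    (fun f g g' => shuffle_add_right _ _ _)
    (fun c f g => shuffle_smul_right _ _ _)

/-- The product of `Alt_A(M, Λ_A L)`. -/
def Forms.mul : Forms A L M →ₗ[R] Forms A L M →ₗ[R] Forms A L M :=
  DirectSum.toModule R ℕ _ fun p => LinearMap.flip <|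
    DirectSum.toModule R ℕ _ fun r => LinearMap.flip <|
      (formMul R A L M p r).compr₂
        (DirectSum.lof R ℕ (fun p => M [⋀^Fin p]→ₗ[A] ExteriorAlgebra A L) (p + r))

variable {A L M}

/-- The elements `u` of `Λ_A L`, as forms of degree zero. -/
def Forms.const (u : ExteriorAlgebra A L) : Forms A L M :=
  DirectSum.of (fun p => M [⋀^Fin p]→ₗ[A] ExteriorAlgebra A L) 0
    (AlternatingMap.constOfIsEmpty A M (Fin 0) u)

/-- The `A`-valued forms, as forms with values in `Λ^0_A L = A`. -/
def Forms.ofForm {p : ℕ} (b : M [⋀^Fin p]→ₗ[A] A) : Forms A L M :=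
  DirectSum.of (fun p => M [⋀^Fin p]→ₗ[A] ExteriorAlgebra A L) p
    ((Algebra.linearMap A (ExteriorAlgebra A L)).compAlternatingMap b)

variable (A L M)

/-- The homogeneous component `Alt^p_A(M, Λ^q_A L)`. -/
def Forms.bideg (p q : ℕ) : Submodule R (Forms A L M) :=
  Submodule.map (DirectSum.lof R ℕ (fun p => M [⋀^Fin p]→ₗ[A] ExteriorAlgebra A L) p)
    { carrier := {f | ∀ ξ, f ξ ∈ ⋀[A]^q L}
      add_mem' := fun hf hg ξ => add_mem (hf ξ) (hg ξ)
      zero_mem' := fun _ => zero_mem _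
      smul_mem' := fun r f hf ξ => by
        rw [AlternatingMap.smul_apply, ← algebraMap_smul A r (f ξ)]
        exact Submodule.smul_mem _ _ (hf ξ) }

end Forms

section FormsStructure

variable (R A L M : Type*) [CommRing R] [CommRing A] [Algebra R A]

/-- The Lie-Rinehart differential on `Alt_A(M, Λ_A L)` of a Lie-Rinehart algebra `(A, M)` and an
`(A, M)`-module `L`, with coefficients in the induced `(A, M)`-module `Λ_A L`. -/
def Forms.d [AddCommGroup L] [Module A L] [Module R L] [IsScalarTower R A L]
    [LieRing M] [Module A M] [LieRingModule M A] [LieRinehartRing A M] [LieAlgebra R M]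
    [LieRinehartAlgebra R A M] [LieRingModule M L] [LieRinehartModule A M L] :
    Forms A L M →ₗ[R] Forms A L M :=
  DirectSum.toModule R ℕ _ fun p =>
    (DirectSum.lof R ℕ (fun p => M [⋀^Fin p]→ₗ[A] ExteriorAlgebra A L) (p + 1)).comp
      (ceDiff (Connection.exterior R A M L) p)

/-- The (bigraded) crossed product bracket on `Alt_A(M, Λ_A L)`, for a Lie-Rinehart algebra `(A, L)`
and an `(A, L)`-module `M`: the bracket of bidegree `(0, -1)` which on generators is given by the
bracket of `L` and by the action of `L` on `Alt_A(M, A)`, and which obeys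
`[f g, h] = f [g, h] + (-1)^(|f| |g|) g [f, h]` and
`[f, g] = -(-1)^((|f| - 1) (|g| - 1)) [g, f]`, where `|·|` is the total degree. (In the exponents we
write `|f| + 1` for `|f| - 1`, which has the same parity.) -/
structure IsCrossedProductBracket [LieRing L] [Module A L] [LieRingModule L A] [LieRinehartRing A L]
    [LieAlgebra R L] [LieRinehartAlgebra R A L]
    [AddCommGroup M] [Module A M] [LieRingModule L M] [LieRinehartModule A L M]
    (br : Forms A L M →ₗ[R] Forms A L M →ₗ[R] Forms A L M) : Prop where
  mem {p q p' q' n : ℕ} {f g : Forms A L M} : f ∈ Forms.bideg R A L M p q →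
    g ∈ Forms.bideg R A L M p' q' → q + q' = n + 1 → br f g ∈ Forms.bideg R A L M (p + p') n
  eq_zero {p p' : ℕ} {f g : Forms A L M} : f ∈ Forms.bideg R A L M p 0 →
    g ∈ Forms.bideg R A L M p' 0 → br f g = 0
  lie_lie (x y : L) : br (Forms.const (ExteriorAlgebra.ι A x)) (Forms.const (ExteriorAlgebra.ι A y)) =
    Forms.const (ExteriorAlgebra.ι A ⁅x, y⁆)
  lie_form (x : L) {p : ℕ} (b : M [⋀^Fin p]→ₗ[A] A) :
    br (Forms.const (ExteriorAlgebra.ι A x)) (Forms.ofForm b) = Forms.ofForm (formAct x b)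
  leibniz {p q p' q' : ℕ} {f g : Forms A L M} (h : Forms A L M) : f ∈ Forms.bideg R A L M p q →
    g ∈ Forms.bideg R A L M p' q' → br (Forms.mul R A L M f g) h =
      Forms.mul R A L M f (br g h) + (-1 : ℤ) ^ ((p + q) * (p' + q')) • Forms.mul R A L M g (br f h)
  skew {p q p' q' : ℕ} {f g : Forms A L M} : f ∈ Forms.bideg R A L M p q →
    g ∈ Forms.bideg R A L M p' q' → br f g =
      -((-1 : ℤ) ^ ((p + q + 1) * (p' + q' + 1)) • br g f)

end FormsStructure

section BigradedGerstenhaber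

variable (R : Type*) {B : Type*} [CommRing R] [AddCommGroup B] [Module R B]
  (V : ℕ → ℕ → Submodule R B) (mul : B →ₗ[R] B →ₗ[R] B) (one : B)
  (br : B →ₗ[R] B →ₗ[R] B) (d : B →ₗ[R] B)

/-- `B`, with the homogeneous components `V p q`, the product `mul` and the unit `one`, is a bigraded
commutative algebra over `R` (with signs according to the total degree). -/
structure IsBigradedCommAlgebra : Prop where
  isInternal : DirectSum.IsInternal fun i : ℕ × ℕ => V i.1 i.2
  mul_mem {p q p' q' : ℕ} {f g : B} : f ∈ V p q → g ∈ V p' q' → mul f g ∈ V (p + p') (q + q')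
  one_mem : one ∈ V 0 0
  one_mul (f : B) : mul one f = f
  mul_assoc (f g h : B) : mul (mul f g) h = mul f (mul g h)
  mul_comm {p q p' q' : ℕ} {f g : B} : f ∈ V p q → g ∈ V p' q' →
    mul f g = (-1 : ℤ) ^ ((p + q) * (p' + q')) • mul g f

/-- `br` is a bigraded Gerstenhaber bracket: of bidegree `(0, -1)`, a bigraded Lie bracket once the
second degree is lowered by one, and such that `[f, ·]` is a derivation of total degree `|f| - 1`. (In
the exponents we write `|f| + 1` for `|f| - 1`, which has the same parity.) -/
structure IsBigradedGerstenhaberBracket : Prop where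
  mem {p q p' q' n : ℕ} {f g : B} : f ∈ V p q → g ∈ V p' q' → q + q' = n + 1 →
    br f g ∈ V (p + p') n
  eq_zero {p p' : ℕ} {f g : B} : f ∈ V p 0 → g ∈ V p' 0 → br f g = 0
  skew {p q p' q' : ℕ} {f g : B} : f ∈ V p q → g ∈ V p' q' →
    br f g = -((-1 : ℤ) ^ ((p + q + 1) * (p' + q' + 1)) • br g f)
  jacobi {p q p' q' : ℕ} {f g : B} (h : B) : f ∈ V p q → g ∈ V p' q' →
    br f (br g h) = br (br f g) h + (-1 : ℤ) ^ ((p + q + 1) * (p' + q' + 1)) • br g (br f h)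
  derivation {p q p' q' : ℕ} {f g : B} (h : B) : f ∈ V p q → g ∈ V p' q' →
    br f (mul g h) = mul (br f g) h + (-1 : ℤ) ^ ((p + q + 1) * (p' + q')) • mul g (br f h)

/-- `(B, br, d)` is a differential bigraded Gerstenhaber algebra: `d` is a differential of bidegree
`(1, 0)`, a derivation of the product, and a derivation of the Gerstenhaber bracket. -/
structure IsDifferentialBigradedGerstenhaber : Prop extends
    IsBigradedCommAlgebra R V mul one, IsBigradedGerstenhaberBracket R V mul br where
  d_mem {p q : ℕ} {f : B} : f ∈ V p q → d f ∈ V (p + 1) q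
  d_d (f : B) : d (d f) = 0
  d_mul {p q : ℕ} {f : B} (g : B) : f ∈ V p q →
    d (mul f g) = mul (d f) g + (-1 : ℤ) ^ (p + q) • mul f (d g)
  d_bracket {p q : ℕ} {f : B} (g : B) : f ∈ V p q →
    d (br f g) = br (d f) g - (-1 : ℤ) ^ (p + q) • br f (d g)

end BigradedGerstenhaber

section Bialgebra

variable (R A L D : Type*) [CommRing R] [CommRing A] [Algebra R A]

/-- The Gerstenhaber bracket on the exterior algebra `Λ_A L` of a Lie-Rinehart algebra `(A, L)`: the
bracket of degree `-1` which on generators is given by the bracket of `L` and by the action of `L` on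
`A`, and which obeys `[u v, w] = u [v, w] + (-1)^(|u| |v|) v [u, w]` and
`[u, v] = -(-1)^((|u| - 1) (|v| - 1)) [v, u]`. -/
structure IsGerstenhaberBracket [LieRing L] [Module A L] [LieRingModule L A] [LieRinehartRing A L]
    [LieAlgebra R L] [LieRinehartAlgebra R A L]
    (br : ExteriorAlgebra A L →ₗ[R] ExteriorAlgebra A L →ₗ[R] ExteriorAlgebra A L) : Prop where
  mem {m n k : ℕ} {u v : ExteriorAlgebra A L} : u ∈ ⋀[A]^m L → v ∈ ⋀[A]^n L → m + n = k + 1 →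
    br u v ∈ ⋀[A]^k L
  eq_zero (a b : A) : br (algebraMap A _ a) (algebraMap A _ b) = 0
  lie_lie (x y : L) : br (ExteriorAlgebra.ι A x) (ExteriorAlgebra.ι A y) =
    ExteriorAlgebra.ι A ⁅x, y⁆
  lie_base (x : L) (a : A) : br (ExteriorAlgebra.ι A x) (algebraMap A _ a) = algebraMap A _ ⁅x, a⁆
  leibniz {m n : ℕ} {u v : ExteriorAlgebra A L} (w : ExteriorAlgebra A L) : u ∈ ⋀[A]^m L →
    v ∈ ⋀[A]^n L → br (u * v) w = u * br v w + (-1 : ℤ) ^ (m * n) • (v * br u w)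
  skew {m n : ℕ} {u v : ExteriorAlgebra A L} : u ∈ ⋀[A]^m L → v ∈ ⋀[A]^n L →
    br u v = -((-1 : ℤ) ^ ((m + 1) * (n + 1)) • br v u)

section Pairing

variable {A L D} [AddCommGroup L] [Module A L] [AddCommGroup D] [Module A D]

theorem det_update (e : L →ₗ[A] D →ₗ[A] A) {n : ℕ} (x : Fin n → L) (k : Fin n) (y : L)
    (δ : Fin n → D) :
    Matrix.det (fun j i => e (Function.update x k y i) (δ j)) =
      Matrix.det (Matrix.updateCol (Matrix.of fun j i => e (x i) (δ j)) k fun j => e y (δ j)) := by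
  congr 1
  ext j i
  by_cases h : i = k
  · subst h; simp
  · simp [h]

theorem detPairing_add (e : L →ₗ[A] D →ₗ[A] A) {n : ℕ} (x : Fin n → L) (k : Fin n) (y z : L)
    (δ : Fin n → D) :
    Matrix.det (fun j i => e (Function.update x k (y + z) i) (δ j)) =
      Matrix.det (fun j i => e (Function.update x k y i) (δ j)) +
      Matrix.det (fun j i => e (Function.update x k z i) (δ j)) := by
  rw [det_update, det_update, det_update, ← Matrix.det_updateCol_add]
  congr 2
  ext j
  simp

theorem detPairing_smul (e : L →ₗ[A] D →ₗ[A] A) {n : ℕ} (x : Fin n → L) (k : Fin n) (a : A) (y : L)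
    (δ : Fin n → D) :
    Matrix.det (fun j i => e (Function.update x k (a • y) i) (δ j)) =
      a * Matrix.det (fun j i => e (Function.update x k y i) (δ j)) := by
  rw [det_update, det_update, ← Matrix.det_updateCol_smul]
  congr 2
  ext j
  simp

/-- The map `(x_1, ..., x_n) ↦ ((δ_1, ..., δ_n) ↦ det ⟨x_i, δ_j⟩)`. -/
def detPairing (e : L →ₗ[A] D →ₗ[A] A) (n : ℕ) : L [⋀^Fin n]→ₗ[A] (D [⋀^Fin n]→ₗ[A] A) where
  toFun x := Matrix.detRowAlternating.compLinearMap (LinearMap.pi fun i => e (x i))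
  map_update_add' := fun {inst} x k y z => by
    rw [Subsingleton.elim inst (instDecidableEqFin _)]
    ext δ
    exact detPairing_add e x k y z δ
  map_update_smul' := fun {inst} x k a y => by
    rw [Subsingleton.elim inst (instDecidableEqFin _)]
    ext δ
    exact detPairing_smul e x k a y δ
  map_eq_zero_of_eq' := fun x i j h hij => by
    ext δ
    exact Matrix.det_zero_of_column_eq hij fun k => by simp [h]

/-- The component in `Alt^n_A(D, A)` of the morphism of algebras `Λ_A L → Alt_A(D, A)` that is
induced by a pairing `L ⊗_A D → A`; it sends `x_1 ∧ ... ∧ x_n` to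
`(δ_1, ..., δ_n) ↦ det ⟨x_i, δ_j⟩`, and it vanishes on `Λ^m_A L` for `m ≠ n`. -/
def toForm (e : L →ₗ[A] D →ₗ[A] A) (n : ℕ) : ExteriorAlgebra A L →ₗ[A] (D [⋀^Fin n]→ₗ[A] A) :=
  ExteriorAlgebra.liftAlternating (Pi.single n (detPairing e n))

end Pairing

/-- `δ` is the operator `d_*` on `Λ_A L ≅ Alt_A(D, A)` that corresponds to the Lie-Rinehart
differential of `(A, D)`. -/
def IsDualDifferential [AddCommGroup L] [Module A L] [Module R L] [IsScalarTower R A L]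
    [LieRing D] [Module A D] [LieRingModule D A] [LieRinehartRing A D] [LieAlgebra R D]
    [LieRinehartAlgebra R A D] (e : L →ₗ[A] D →ₗ[A] A)
    (δ : ExteriorAlgebra A L →ₗ[R] ExteriorAlgebra A L) : Prop :=
  ∀ u, toForm e 0 (δ u) = 0 ∧
    ∀ n, toForm e (n + 1) (δ u) = ceDiff (Connection.base R A D) n (toForm e n u)

/-- `(A, L, D)` is a Lie-Rinehart bialgebra: the Lie-Rinehart algebras `(A, L)` and `(A, D)` are in
duality by means of the pairing `e`, and the differential `d_*` on `Λ_A L ≅ Alt_A(D, A)` that comes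
from `D` is a derivation of the Gerstenhaber bracket on `Λ_A L` that comes from `L`. -/
structure IsLieRinehartBialgebra
    [LieRing L] [Module A L] [LieRingModule L A] [LieRinehartRing A L] [LieAlgebra R L]
    [LieRinehartAlgebra R A L]
    [LieRing D] [Module A D] [LieRingModule D A] [LieRinehartRing A D] [LieAlgebra R D]
    [LieRinehartAlgebra R A D] (e : L →ₗ[A] D →ₗ[A] A) : Prop where
  finite_left : Module.Finite A L
  projective_left : Module.Projective A L
  finite_right : Module.Finite A D
  projective_right : Module.Projective A D
  perfect : e.IsPerfPair
  derivation : ∃ (br : ExteriorAlgebra A L →ₗ[R] ExteriorAlgebra A L →ₗ[R] ExteriorAlgebra A L)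
    (δ : ExteriorAlgebra A L →ₗ[R] ExteriorAlgebra A L),
    IsGerstenhaberBracket R A L br ∧ IsDualDifferential R A L D e δ ∧
    ∀ (m : ℕ) (u v : ExteriorAlgebra A L), u ∈ ⋀[A]^m L →
      δ (br u v) = br (δ u) v - (-1 : ℤ) ^ m • br u (δ v)

end Bialgebra

section Twilled

/-- The module `L`, with the bracket `br` and the action `act` on `A`, is an `(R, A)`-Lie algebra, that
is, `(A, L)` is a Lie-Rinehart algebra. -/
structure IsLieRinehart (R A L : Type*) [CommRing R] [CommRing A] [Algebra R A] [AddCommGroup L]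
    [Module A L] [Module R L] (br : L → L → L) (act : L → A → A) : Prop where
  add_bracket (u v w : L) : br (u + v) w = br u w + br v w
  bracket_add (u v w : L) : br u (v + w) = br u v + br u w
  smul_bracket (r : R) (u v : L) : br (r • u) v = r • br u v
  bracket_smul (r : R) (u v : L) : br u (r • v) = r • br u v
  bracket_self (u : L) : br u u = 0
  jacobi (u v w : L) : br u (br v w) = br (br u v) w + br v (br u w)
  add_act (u v : L) (a : A) : act (u + v) a = act u a + act v a
  smul_act (a : A) (u : L) (b : A) : act (a • u) b = a * act u b
  act_add (u : L) (a b : A) : act u (a + b) = act u a + act u b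
  act_smul (r : R) (u : L) (a : A) : act u (r • a) = r • act u a
  act_mul (u : L) (a b : A) : act u (a * b) = act u a * b + a * act u b
  bracket_act (u v : L) (a : A) : act (br u v) a = act u (act v a) - act v (act u a)
  leibniz (u v : L) (a : A) : br u (a • v) = act u a • v + a • br u v

variable (R A L' L'' : Type*) [CommRing R] [CommRing A] [Algebra R A]
  [LieRing L'] [Module A L'] [LieRingModule L' A] [LieRinehartRing A L'] [LieAlgebra R L']
  [LieRinehartAlgebra R A L']
  [LieRing L''] [Module A L''] [LieRingModule L'' A] [LieRinehartRing A L''] [LieAlgebra R L'']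
  [LieRinehartAlgebra R A L'']
  [LieRingModule L' L''] [LieRinehartModule A L' L'']
  [LieRingModule L'' L'] [LieRinehartModule A L'' L']

variable {L' L''} in
/-- The bracket on `L' ⊕ L''` with components
`[x, y]' + ξ · y - η · x` and `[ξ, η]'' + x · η - y · ξ`. -/
def twilledBracket (u v : L' × L'') : L' × L'' :=
  (⁅u.1, v.1⁆ + ⁅u.2, v.1⁆ - ⁅v.2, u.1⁆, ⁅u.2, v.2⁆ + ⁅u.1, v.2⁆ - ⁅v.1, u.2⁆)

variable {A L' L''} in
/-- The action of `L' ⊕ L''` on `A`. -/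
def twilledAct (u : L' × L'') (a : A) : A := ⁅u.1, a⁆ + ⁅u.2, a⁆

/-- The almost twilled Lie-Rinehart algebra `(A, L', L'')` is a twilled Lie-Rinehart algebra. -/
def IsTwilled : Prop :=
  IsLieRinehart R A (L' × L'') twilledBracket (twilledAct (A := A))

/-- `(Alt_A(L'', Λ_A L'), [·,·]', d'')` is a differential bigraded Gerstenhaber algebra. -/
def IsFormsDifferentialGerstenhaber : Prop :=
  ∃ br : Forms A L' L'' →ₗ[R] Forms A L' L'' →ₗ[R] Forms A L' L'',
    IsCrossedProductBracket R A L' L'' br ∧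
    IsDifferentialBigradedGerstenhaber R (Forms.bideg R A L' L'') (Forms.mul R A L' L'')
      (Forms.const 1) br (Forms.d R A L' L'')

/-- The pairing `⟨(x, φ), (ξ, ψ)⟩ = φ(ξ) + ψ(x)` between `L' ⋉ L''^*` and `L'' ⋉ L'^*`. -/
def semidirectPairing : Semidirect A L' L'' →ₗ[A] Semidirect A L'' L' →ₗ[A] A :=
  LinearMap.mk₂ A (fun u w => u.2 w.1 + w.2 u.1)
    (fun u v w => by
      change (u.2 + v.2) w.1 + w.2 (u.1 + v.1) = u.2 w.1 + w.2 u.1 + (v.2 w.1 + w.2 v.1)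
      simp only [LinearMap.add_apply, map_add]; abel)
    (fun a u w => by
      change (a • u.2) w.1 + w.2 (a • u.1) = a • (u.2 w.1 + w.2 u.1)
      simp only [LinearMap.smul_apply, map_smul, smul_add])
    (fun u w z => by
      change u.2 (w.1 + z.1) + (w.2 + z.2) u.1 = u.2 w.1 + w.2 u.1 + (u.2 z.1 + z.2 u.1)
      simp only [LinearMap.add_apply, map_add]; abel)
    (fun a u w => by
      change u.2 (a • w.1) + (a • w.2) u.1 = a • (u.2 w.1 + w.2 u.1)
      simp only [LinearMap.smul_apply, map_smul, smul_add])

end Twilled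

end LR

end

open scoped DirectSum

set_option linter.unusedSectionVars false

noncomputable section

/-! Both equivalences pass through one system of equations on the brackets and mutual actions,
`IsMatchedPair`: the commutator of the two actions on `A` (`base`) and two mixed Jacobi identities
(`left`, `right`). The three structures of the theorem are each shown to be equivalent to it.

The bridge between forms and bialgebras is that, `L''` being finitely generated projective,
`Alt_A(L'', Λ_A L')` is the exterior algebra of `L = L' ⊕ L''^*` (`formsEquiv`). An element of `Λ_A
L` gives a form by iterated contraction with elements of `L''` followed by the projection to `Λ_A
L'`. Under this identification the product of forms is the exterior product (`formsEquiv_mul`), the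
crossed product bracket is the Gerstenhaber bracket of the semidirect product (`crossedBracket`,
`IsCrossedProductBracket.unique`), and `d''` is `d_*` (`formsEquiv_d`). All the other axioms of a
differential bigraded Gerstenhaber algebra hold unconditionally, so what remains on either side is
that `d_*` is a derivation of the bracket.

The failure of this, `defect`, is a graded derivation in its second argument and graded skew, so it
vanishes as soon as it does so on generators (`defect_eq_zero`). A pair from `A` gives no condition,
because `d_* a` lies in `L''^*`, which acts as zero on `A`. A vector and a function give `base`. Two
vectors give an element of degree two which, contracted with two elements of `D`, becomes a
combination of `left`, `right` and `base` tested against functionals (`defect_semidirect_ι`,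
`isMatchedPair_of_defect`).

For twilled algebras, `base` is the statement that mixed brackets act as commutators on `A`, while
`left` and `right` are the components of the Jacobi identity on mixed arguments (`isTwilled_iff`).

Existence of brackets and differentials rests on `exists_isGradedDer`, which extends prescribed
values on `A` and on vectors to a graded derivation. Uniqueness rests on the fact that graded
derivations are determined by those values, and on the perfect pairing, through which contractions
detect elements of the exterior algebra (`FormModel.eq_of_contr`). -/

namespace LR

/-! ### Graded derivations of exterior algebras, with signs carried by the parity operators. -/

section GradedDerivations

variable {A M : Type*} [CommRing A] [AddCommGroup M] [Module A M]

/-- The parity operators on `Λ_A M`: `twist k u = (-1)^(k |u|) u`. -/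
def twist (k : ℕ) : ExteriorAlgebra A M →ₐ[A] ExteriorAlgebra A M :=
  (CliffordAlgebra.involute (Q := (0 : QuadraticForm A M))) ^ k

theorem twist_zero (u : ExteriorAlgebra A M) : twist 0 u = u := by
  simp [twist]

theorem twist_one (u : ExteriorAlgebra A M) :
    twist 1 u = CliffordAlgebra.involute (Q := (0 : QuadraticForm A M)) u := by
  simp [twist]

theorem twist_twist (j k : ℕ) (u : ExteriorAlgebra A M) : twist j (twist k u) = twist (j + k) u := by
  rw [twist, twist, twist, pow_add]; rfl

theorem twist_one_one (u : ExteriorAlgebra A M) : twist 1 (twist 1 u) = u := by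
  rw [twist_one, twist_one]; exact CliffordAlgebra.involute_involute u

theorem twist_two (u : ExteriorAlgebra A M) : twist 2 u = u := by
  rw [← twist_one_one u, twist_twist, twist_twist]
  change twist (2 + 2) u = _
  rw [← twist_twist 2 2, ← twist_twist 1 1, ← twist_twist 1 1 u, twist_one_one]

theorem twist_add_two (k : ℕ) (u : ExteriorAlgebra A M) : twist (k + 2) u = twist k u := by
  rw [← twist_twist, twist_two]

theorem twist_ι (k : ℕ) (m : M) :
    twist k (ExteriorAlgebra.ι A m) = (-1 : ℤ) ^ k • ExteriorAlgebra.ι A m := by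
  induction k with
  | zero => simp [twist_zero]
  | succ k ih =>
    rw [← twist_twist, twist_one]
    erw [CliffordAlgebra.involute_ι]
    rw [map_neg]
    change - twist k (ExteriorAlgebra.ι A m) = _
    rw [ih, pow_succ]; simp

/-- `u` is an eigenvector of the grading involution, with eigenvalue `(-1)^k`. -/
def HasParity (k : ℕ) (u : ExteriorAlgebra A M) : Prop := twist 1 u = (-1 : ℤ) ^ k • u

theorem HasParity.twist {j : ℕ} {u : ExteriorAlgebra A M} (h : HasParity j u) (k : ℕ) :
    twist k u = (-1 : ℤ) ^ (k * j) • u := by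
  induction k with
  | zero => simp [twist_zero]
  | succ k ih => rw [← twist_twist, h, map_zsmul, ih, smul_smul, ← pow_add]; congr 2; ring

theorem hasParity_algebraMap (a : A) : HasParity 0 (algebraMap A (ExteriorAlgebra A M) a) := by
  rw [HasParity, AlgHom.commutes]; simp

theorem hasParity_ι (m : M) : HasParity 1 (ExteriorAlgebra.ι A m) := by
  rw [HasParity, twist_ι]

theorem HasParity.add {k : ℕ} {u v : ExteriorAlgebra A M} (hu : HasParity k u)
    (hv : HasParity k v) : HasParity k (u + v) := by
  rw [HasParity, map_add, hu, hv, smul_add]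

theorem HasParity.zsmul {k : ℕ} {u : ExteriorAlgebra A M} (hu : HasParity k u) (n : ℤ) :
    HasParity k (n • u) := by
  rw [HasParity, map_zsmul, hu, smul_comm]

theorem HasParity.neg {k : ℕ} {u : ExteriorAlgebra A M} (hu : HasParity k u) :
    HasParity k (-u) := by
  rw [HasParity, map_neg, hu, smul_neg]

theorem HasParity.sum {k : ℕ} {I : Type*} (s : Finset I) (f : I → ExteriorAlgebra A M)
    (h : ∀ i, HasParity k (f i)) : HasParity k (∑ i ∈ s, f i) := by
  rw [HasParity, map_sum, Finset.smul_sum]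
  exact Finset.sum_congr rfl fun i _ => h i

theorem HasParity.mul {j k : ℕ} {u v : ExteriorAlgebra A M} (hu : HasParity j u)
    (hv : HasParity k v) : HasParity (j + k) (u * v) := by
  rw [HasParity, map_mul, hu, hv, pow_add, smul_mul_smul_comm]

theorem HasParity.congr {j k : ℕ} {u : ExteriorAlgebra A M} (hu : HasParity j u)
    (h : (-1 : ℤ) ^ j = (-1) ^ k) : HasParity k u := by
  rw [HasParity, hu, h]

theorem HasParity.add_two {k : ℕ} {u : ExteriorAlgebra A M} (hu : HasParity k u) :
    HasParity (k + 2) u := hu.congr (by simp [pow_add])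

theorem ι_mul_eq (m : M) (u : ExteriorAlgebra A M) :
    ExteriorAlgebra.ι A m * u = twist 1 u * ExteriorAlgebra.ι A m := by
  induction u using ExteriorAlgebra.induction with
  | algebraMap a => rw [AlgHom.commutes, Algebra.commutes]
  | ι n =>
    rw [twist_ι, pow_one, neg_one_smul, neg_mul]
    exact eq_neg_of_add_eq_zero_left (ExteriorAlgebra.ι_add_mul_swap m n)
  | mul u v hu hv => rw [← mul_assoc, hu, mul_assoc, hv, map_mul, mul_assoc]
  | add u v hu hv => rw [mul_add, hu, hv, map_add, add_mul]

/-- Both sides are multiplicative in `u`, which reduces the claim to generators. Since the sign sits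
inside `twist`, the factor `u` need not be homogeneous. -/
theorem HasParity.mul_comm {k : ℕ} {v : ExteriorAlgebra A M} (hv : HasParity k v)
    (u : ExteriorAlgebra A M) : v * u = LR.twist k u * v := by
  induction u using ExteriorAlgebra.induction with
  | algebraMap a => rw [AlgHom.commutes, Algebra.commutes]
  | ι n =>
    rw [twist_ι, smul_mul_assoc, ι_mul_eq, hv, smul_mul_assoc, smul_smul, ← pow_add, ← two_mul]
    simp
  | mul u v hu hv => rw [← mul_assoc, hu, mul_assoc, hv, map_mul, mul_assoc]
  | add u v hu hv => rw [mul_add, hu, hv, map_add, add_mul]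

theorem HasParity.mul_comm_smul {j k : ℕ} {u v : ExteriorAlgebra A M} (hu : HasParity j u)
    (hv : HasParity k v) : u * v = (-1 : ℤ) ^ (j * k) • (v * u) := by
  rw [hu.mul_comm, hv.twist, smul_mul_assoc]

theorem hasParity_of_mem {n : ℕ} {u : ExteriorAlgebra A M} (h : u ∈ ⋀[A]^n M) :
    HasParity n u := by
  induction h using Submodule.pow_induction_on_left' with
  | algebraMap a => exact hasParity_algebraMap a
  | add u v n _ _ hu hv => exact hu.add hv
  | mem_mul m hm n u _ hu =>
    obtain ⟨m, rfl⟩ := hm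
    rw [Nat.succ_eq_add_one, add_comm]
    exact (hasParity_ι m).mul hu

/-- An additive map `D` with `D (u v) = D(u) v + (-1)^(k |u|) u D(v)` and `|D(u)| ≡ |u| + k`. -/
structure IsGradedDer (k : ℕ) (D : ExteriorAlgebra A M →+ ExteriorAlgebra A M) : Prop where
  map_mul (u v : ExteriorAlgebra A M) : D (u * v) = D u * v + twist k u * D v
  map_twist (u : ExteriorAlgebra A M) : D (twist 1 u) = (-1 : ℤ) ^ k • twist 1 (D u)

namespace IsGradedDer

variable {j k : ℕ} {D E : ExteriorAlgebra A M →+ ExteriorAlgebra A M}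

theorem ext (hD : IsGradedDer k D) (hE : IsGradedDer k E)
    (h0 : ∀ a, D (algebraMap A _ a) = E (algebraMap A _ a))
    (h1 : ∀ m, D (ExteriorAlgebra.ι A m) = E (ExteriorAlgebra.ι A m)) : D = E := by
  ext u
  induction u using ExteriorAlgebra.induction with
  | algebraMap a => exact h0 a
  | ι m => exact h1 m
  | mul u v hu hv => rw [hD.map_mul, hE.map_mul, hu, hv]
  | add u v hu hv => rw [map_add, map_add, hu, hv]

theorem ext_apply (hD : IsGradedDer k D) (hE : IsGradedDer k E)
    (h0 : ∀ a, D (algebraMap A _ a) = E (algebraMap A _ a))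
    (h1 : ∀ m, D (ExteriorAlgebra.ι A m) = E (ExteriorAlgebra.ι A m)) (u) : D u = E u := by
  rw [hD.ext hE h0 h1]

theorem eq_zero (hD : IsGradedDer k D) (h0 : ∀ a, D (algebraMap A _ a) = 0)
    (h1 : ∀ m, D (ExteriorAlgebra.ι A m) = 0) (u) : D u = 0 := by
  induction u using ExteriorAlgebra.induction with
  | algebraMap a => exact h0 a
  | ι m => exact h1 m
  | mul u v hu hv => rw [hD.map_mul, hu, hv, zero_mul, mul_zero, add_zero]
  | add u v hu hv => rw [map_add, hu, hv, add_zero]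

theorem hasParity (hD : IsGradedDer k D) {u : ExteriorAlgebra A M} (hu : HasParity j u) :
    HasParity (j + k) (D u) := by
  have h := hD.map_twist u
  rw [hu, map_zsmul] at h
  rw [HasParity, pow_add, mul_comm, mul_smul, h, smul_smul, ← pow_add, ← two_mul]
  simp

theorem map_twist' (hD : IsGradedDer k D) (n : ℕ) (u : ExteriorAlgebra A M) :
    D (twist n u) = (-1 : ℤ) ^ (n * k) • twist n (D u) := by
  induction n generalizing u with
  | zero => simp [twist_zero]
  | succ n ih =>
    rw [← twist_twist, ih, hD.map_twist, map_zsmul, smul_smul, twist_twist, ← pow_add, add_mul,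
      one_mul]

/-- The axioms see `k` only through `(-1)^k`. This is what allows operators of degree `-1`, such as
contractions, to be treated with natural exponents. -/
theorem congr (hD : IsGradedDer k D) (h : (-1 : ℤ) ^ k = (-1) ^ j) : IsGradedDer j D := by
  have ht : ∀ u : ExteriorAlgebra A M, twist k u = twist j u := by
    intro u
    induction u using ExteriorAlgebra.induction with
    | algebraMap a => rw [AlgHom.commutes, AlgHom.commutes]
    | ι m => rw [twist_ι, twist_ι, h]
    | mul u v hu hv => rw [_root_.map_mul, hu, hv, _root_.map_mul]
    | add u v hu hv => rw [map_add, hu, hv, map_add]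
  exact ⟨fun u v => by rw [hD.map_mul, ht], fun u => by rw [hD.map_twist, h]⟩

theorem add_two (hD : IsGradedDer k D) : IsGradedDer (k + 2) D := hD.congr (by simp [pow_add])

theorem of_add_two (hD : IsGradedDer (k + 2) D) : IsGradedDer k D := hD.congr (by simp [pow_add])

theorem add (hD : IsGradedDer k D) (hE : IsGradedDer k E) : IsGradedDer k (D + E) where
  map_mul u v := by
    simp only [AddMonoidHom.add_apply, hD.map_mul, hE.map_mul, mul_add, add_mul]; abel
  map_twist u := by
    simp only [AddMonoidHom.add_apply, hD.map_twist, hE.map_twist, map_add, smul_add]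

theorem neg (hD : IsGradedDer k D) : IsGradedDer k (-D) where
  map_mul u v := by
    simp only [AddMonoidHom.neg_apply, hD.map_mul, mul_neg, neg_mul]; abel
  map_twist u := by simp only [AddMonoidHom.neg_apply, hD.map_twist, map_neg, smul_neg]

theorem sub (hD : IsGradedDer k D) (hE : IsGradedDer k E) : IsGradedDer k (D - E) := by
  rw [sub_eq_add_neg]; exact hD.add hE.neg

theorem zero (k : ℕ) : IsGradedDer k (0 : ExteriorAlgebra A M →+ ExteriorAlgebra A M) where
  map_mul u v := by simp
  map_twist u := by simp

theorem zsmul (hD : IsGradedDer k D) (n : ℤ) : IsGradedDer k (n • D) where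
  map_mul u v := by
    simp only [AddMonoidHom.smul_apply, hD.map_mul, smul_add, mul_smul_comm, smul_mul_assoc]
  map_twist u := by
    simp only [AddMonoidHom.smul_apply, hD.map_twist, map_zsmul]
    rw [smul_comm]

/-- Moving `w` across `twist k u` adds a twist by `j`, which is the sign required of a derivation of
parity `j + k`. -/
theorem mul_left (hD : IsGradedDer k D) {w : ExteriorAlgebra A M} (hw : HasParity j w) :
    IsGradedDer (j + k) ((AddMonoidHom.mulLeft w).comp D) where
  map_mul u v := by
    simp only [AddMonoidHom.comp_apply, AddMonoidHom.coe_mulLeft, hD.map_mul, mul_add, ← mul_assoc]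
    rw [hw.mul_comm (twist k u), twist_twist]
  map_twist u := by
    simp only [AddMonoidHom.comp_apply, AddMonoidHom.coe_mulLeft, hD.map_twist, _root_.map_mul]
    rw [hw, pow_add, smul_mul_assoc, smul_smul, mul_smul_comm]
    congr 1
    rw [mul_comm ((-1 : ℤ) ^ j), mul_assoc, ← mul_pow]
    simp

theorem smul (hD : IsGradedDer k D) (a : A) :
    IsGradedDer k ((AddMonoidHom.mulLeft (algebraMap A _ a)).comp D) := by
  have h := hD.mul_left (hasParity_algebraMap (M := M) a)
  rwa [zero_add] at h

/-- The graded commutator of graded derivations. -/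
theorem commutator (hD : IsGradedDer j D) (hE : IsGradedDer k E) :
    IsGradedDer (j + k) (D.comp E - (-1 : ℤ) ^ (j * k) • E.comp D) where
  map_mul u v := by
    simp only [AddMonoidHom.sub_apply, AddMonoidHom.smul_apply, AddMonoidHom.comp_apply,
      hD.map_mul, hE.map_mul, map_add, hE.map_twist' j, hD.map_twist' k, ← twist_twist j k,
      sub_mul, mul_sub, smul_add, mul_smul_comm, smul_mul_assoc, smul_smul]
    -- The mixed terms cancel: pulling one operator through the twist that belongs to the other
    -- costs `(-1)^(j k)`, which is the sign of the commutator.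
    have e : twist k (twist j u) = twist j (twist k u) := by rw [twist_twist, twist_twist, add_comm]
    have e' : (-1 : ℤ) ^ (j * k) * (-1) ^ (j * k) = 1 := by rw [← mul_pow]; simp
    rw [e, e', mul_comm k j, one_smul]
    abel
  map_twist u := by
    simp only [AddMonoidHom.sub_apply, AddMonoidHom.smul_apply, AddMonoidHom.comp_apply,
      hD.map_twist, hE.map_twist, map_zsmul, map_sub, smul_sub, smul_smul, pow_add]
    congr 2 <;> ring

end IsGradedDer

/-- A graded derivation with prescribed values on the generators. -/
theorem exists_isGradedDer (k : ℕ) (d₀ : A →+ ExteriorAlgebra A M) (d₁ : M →+ ExteriorAlgebra A M)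
    (p₀ : ∀ a, HasParity k (d₀ a)) (p₁ : ∀ m, HasParity (k + 1) (d₁ m))
    (h₀ : ∀ a b, d₀ (a * b) = a • d₀ b + b • d₀ a)
    (h₁ : ∀ a m, d₁ (a • m) = a • d₁ m + d₀ a * ExteriorAlgebra.ι A m) :
    ∃ D : ExteriorAlgebra A M →+ ExteriorAlgebra A M, IsGradedDer k D ∧
      (∀ a, D (algebraMap A _ a) = d₀ a) ∧ ∀ m, D (ExteriorAlgebra.ι A m) = d₁ m := by
  -- The matrices in `T` have rows `(twist k u, w)` and `(0, u)`. Multiplicativity of `u ↦ (twist k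
  -- u, D u; 0, u)` is precisely the graded Leibniz rule for `D`, so `D` comes from the universal
  -- property of the exterior algebra.
  let T : Subring (Matrix (Fin 2) (Fin 2) (ExteriorAlgebra A M)) :=
    { carrier := {m | m 1 0 = 0 ∧ m 0 0 = twist k (m 1 1)}
      mul_mem' := fun {a b} ha hb => by
        simp only [Set.mem_ofPred_eq, Matrix.mul_apply, Fin.sum_univ_two] at *
        rw [ha.1, ha.2, hb.1, hb.2, map_add, map_mul]; simp
      one_mem' := by simp
      add_mem' := fun {a b} ha hb => by
        simp only [Set.mem_ofPred_eq, Matrix.add_apply] at *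
        rw [ha.1, ha.2, hb.1, hb.2, map_add]; simp
      zero_mem' := by simp
      neg_mem' := fun {a} ha => by
        simp only [Set.mem_ofPred_eq, Matrix.neg_apply] at *
        rw [ha.1, ha.2, map_neg]; simp }
  have T_ext : ∀ {x y : T}, x.1 1 1 = y.1 1 1 → x.1 0 1 = y.1 0 1 → x = y := by
    intro x y h h'
    refine Subtype.ext (Matrix.ext fun i j => ?_)
    fin_cases i <;> fin_cases j
    · exact x.2.2.trans ((congrArg _ h).trans y.2.2.symm)
    · exact h'
    · exact x.2.1.trans y.2.1.symm
    · exact h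
  have mul11 : ∀ x y : T, (x * y).1 1 1 = x.1 1 1 * y.1 1 1 := by
    intro x y
    change (x.1 * y.1) 1 1 = _
    rw [Matrix.mul_apply, Fin.sum_univ_two, x.2.1, zero_mul, zero_add]
  have mul01 : ∀ x y : T, (x * y).1 0 1 = twist k (x.1 1 1) * y.1 0 1 + x.1 0 1 * y.1 1 1 := by
    intro x y
    change (x.1 * y.1) 0 1 = _
    rw [Matrix.mul_apply, Fin.sum_univ_two, x.2.2]
  let mk (u w : ExteriorAlgebra A M) : T := ⟨!![twist k u, w; 0, u], by simp, by simp⟩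
  have mk11 : ∀ u w, (mk u w).1 1 1 = u := fun u w => rfl
  have mk01 : ∀ u w, (mk u w).1 0 1 = w := fun u w => rfl
  have d₀_one : d₀ 1 = 0 := by simpa using h₀ 1 1
  let φ : A →+* T :=
    { toFun := fun a => mk (algebraMap A _ a) (d₀ a)
      map_one' := T_ext (by rw [mk11, map_one]; rfl) (by rw [mk01, d₀_one]; rfl)
      map_zero' := T_ext (by rw [mk11, map_zero]; rfl) (by rw [mk01, map_zero]; rfl)
      map_add' := fun a b => T_ext (by rw [mk11, map_add]; rfl) (by rw [mk01, map_add]; rfl)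
      map_mul' := fun a b => T_ext (by rw [mul11, mk11, mk11, mk11, map_mul])
        (by rw [mul01, mk11, mk01, mk01, mk01, mk11, h₀, AlgHom.commutes, ← Algebra.commutes b,
            Algebra.smul_def, Algebra.smul_def]) }
  -- The scalars act through `φ`, with `d₀ a` in the corner, and not diagonally; `A`-linearity of
  -- the lift then encodes `h₁`. The image of `φ` is central because `d₀ a` has parity `k`.
  let : Algebra A T := RingHom.toAlgebra' φ fun a x => T_ext
    (by rw [mul11, mul11]; exact Algebra.commutes a _)
    (by
      rw [mul01, mul01]
      change twist k (algebraMap A _ a) * _ + d₀ a * _ = _ * d₀ a + _ * algebraMap A _ a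
      rw [AlgHom.commutes, (p₀ a).mul_comm, Algebra.commutes, add_comm])
  have hφ : ∀ a, algebraMap A T a = φ a := fun a => rfl
  let F : ExteriorAlgebra A M →ₐ[A] T := ExteriorAlgebra.lift A
    ⟨{ toFun := fun m => mk (ExteriorAlgebra.ι A m) (d₁ m)
       map_add' := fun m n => T_ext (by rw [mk11, map_add]; rfl) (by rw [mk01, map_add]; rfl)
       map_smul' := fun a m => by
        rw [RingHom.id_apply, Algebra.smul_def, hφ]
        refine T_ext ?_ ?_
        · rw [mul11, mk11, mk11, map_smul, Algebra.smul_def]; rfl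
        · rw [mul01, mk01, mk01, mk11, h₁, Algebra.smul_def]
          change _ = twist k (algebraMap A _ a) * _ + d₀ a * _
          rw [AlgHom.commutes] },
      -- Vectors have square zero in `T`: by its parity `k + 1`, the element `d₁ m` passes `m` with
      -- the sign opposite to that of `twist k` on `m`.
      fun m => T_ext
        (by rw [mul11]; exact ExteriorAlgebra.ι_sq_zero m)
        (by
          rw [mul01]
          change twist k (ExteriorAlgebra.ι A m) * d₁ m + d₁ m * ExteriorAlgebra.ι A m = 0
          rw [(p₁ m).mul_comm, twist_ι, twist_ι, pow_succ]
          simp)⟩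
  have F_alg : ∀ a, F (algebraMap A _ a) = mk (algebraMap A _ a) (d₀ a) := fun a => F.commutes a
  have F_ι : ∀ m, F (ExteriorAlgebra.ι A m) = mk (ExteriorAlgebra.ι A m) (d₁ m) := fun m =>
    ExteriorAlgebra.lift_ι_apply _ _ _ _
  have F11 : ∀ u, (F u).1 1 1 = u := by
    intro u
    induction u using ExteriorAlgebra.induction with
    | algebraMap a => rw [F_alg, mk11]
    | ι m => rw [F_ι, mk11]
    | mul u v hu hv => rw [map_mul, mul11, hu, hv]
    | add u v hu hv =>
      rw [map_add]
      change (F u).1 1 1 + (F v).1 1 1 = _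
      rw [hu, hv]
  let D : ExteriorAlgebra A M →+ ExteriorAlgebra A M :=
    { toFun := fun u => (F u).1 0 1
      map_zero' := by rw [map_zero]; rfl
      map_add' := fun u v => by rw [map_add]; rfl }
  have D_alg : ∀ a, D (algebraMap A _ a) = d₀ a := fun a => by
    change (F (algebraMap A _ a)).1 0 1 = _
    rw [F_alg, mk01]
  have D_ι : ∀ m, D (ExteriorAlgebra.ι A m) = d₁ m := fun m => by
    change (F (ExteriorAlgebra.ι A m)).1 0 1 = _
    rw [F_ι, mk01]
  have D_mul : ∀ u v, D (u * v) = D u * v + twist k u * D v := fun u v => by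
    change (F (u * v)).1 0 1 = (F u).1 0 1 * v + twist k u * (F v).1 0 1
    rw [map_mul, mul01, F11, F11, add_comm]
  refine ⟨D, ⟨D_mul, fun u => ?_⟩, D_alg, D_ι⟩
  induction u using ExteriorAlgebra.induction with
  | algebraMap a =>
    rw [AlgHom.commutes, D_alg, p₀ a, smul_smul, ← mul_pow]; simp
  | ι m =>
    rw [twist_ι, map_zsmul, D_ι, p₁ m, smul_smul, ← pow_add, pow_one]
    congr 1
    rw [show k + (k + 1) = 2 * k + 1 by ring, pow_add, pow_mul]; simp
  | mul u v hu hv =>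
    rw [map_mul, D_mul, D_mul, map_add, map_mul, map_mul, hu, hv, twist_twist, twist_twist,
      add_comm 1 k, smul_add, smul_mul_assoc, mul_smul_comm]
  | add u v hu hv => rw [map_add, map_add, hu, hv, map_add, map_add, smul_add]

/-- The contraction with a linear form, as an additive map. -/
def contr (d : Module.Dual A M) : ExteriorAlgebra A M →+ ExteriorAlgebra A M :=
  (CliffordAlgebra.contractLeft (Q := (0 : QuadraticForm A M)) d).toAddMonoidHom

theorem contr_algebraMap (d : Module.Dual A M) (a : A) : contr d (algebraMap A _ a) = 0 :=
  CliffordAlgebra.contractLeft_algebraMap (Q := (0 : QuadraticForm A M)) d a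

theorem contr_ι (d : Module.Dual A M) (m : M) :
    contr d (ExteriorAlgebra.ι A m) = algebraMap A _ (d m) :=
  CliffordAlgebra.contractLeft_ι (Q := (0 : QuadraticForm A M)) d m

theorem contr_ι_mul (d : Module.Dual A M) (m : M) (u : ExteriorAlgebra A M) :
    contr d (ExteriorAlgebra.ι A m * u) = d m • u - ExteriorAlgebra.ι A m * contr d u :=
  CliffordAlgebra.contractLeft_ι_mul (Q := (0 : QuadraticForm A M)) d m u

theorem contr_smul (d : Module.Dual A M) (a : A) (u : ExteriorAlgebra A M) :
    contr d (a • u) = a • contr d u :=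
  (CliffordAlgebra.contractLeft (Q := (0 : QuadraticForm A M)) d).map_smul a u

theorem contr_add_left (d d' : Module.Dual A M) (u : ExteriorAlgebra A M) :
    contr (d + d') u = contr d u + contr d' u :=
  DFunLike.congr_fun (map_add (CliffordAlgebra.contractLeft (Q := (0 : QuadraticForm A M))) d d') u

theorem contr_smul_left (a : A) (d : Module.Dual A M) (u : ExteriorAlgebra A M) :
    contr (a • d) u = a • contr d u :=
  DFunLike.congr_fun (map_smul (CliffordAlgebra.contractLeft (Q := (0 : QuadraticForm A M))) a d) u

theorem isGradedDer_contr (d : Module.Dual A M) : IsGradedDer 1 (contr d) where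
  map_mul u v := by
    induction u using CliffordAlgebra.left_induction generalizing v with
    | algebraMap a =>
      change contr d (algebraMap A (ExteriorAlgebra A M) a * v) =
        contr d (algebraMap A (ExteriorAlgebra A M) a) * v +
          twist 1 (algebraMap A (ExteriorAlgebra A M) a) * contr d v
      rw [contr_algebraMap, AlgHom.commutes, zero_mul, zero_add, ← Algebra.smul_def, contr_smul,
        ← Algebra.smul_def]
    | add u u' hu hu' =>
      rw [add_mul]
      simp only [map_add, hu, hu', add_mul]; abel
    | ι_mul u m hu =>
      change contr d (ExteriorAlgebra.ι A m * u * v) = contr d (ExteriorAlgebra.ι A m * u) * v +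
          twist 1 (ExteriorAlgebra.ι A m * u) * contr d v
      rw [mul_assoc, contr_ι_mul, hu, contr_ι_mul, map_mul, twist_ι, sub_mul, mul_add, smul_mul_assoc,
        mul_assoc, pow_one, neg_one_smul, neg_mul, neg_mul, mul_assoc]
      abel
  map_twist u := by
    rw [pow_one, neg_one_smul]
    induction u using CliffordAlgebra.left_induction with
    | algebraMap a =>
      change contr d (twist 1 (algebraMap A (ExteriorAlgebra A M) a)) =
        -twist 1 (contr d (algebraMap A (ExteriorAlgebra A M) a))
      rw [AlgHom.commutes, contr_algebraMap, map_zero, neg_zero]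
    | add u u' hu hu' => simp only [map_add, hu, hu']; abel
    | ι_mul u m hu =>
      change contr d (twist 1 (ExteriorAlgebra.ι A m * u)) =
        -twist 1 (contr d (ExteriorAlgebra.ι A m * u))
      rw [map_mul, twist_ι, contr_ι_mul, pow_one, neg_one_smul, neg_mul, map_neg, contr_ι_mul, hu,
        map_sub, map_mul, map_smul, twist_ι]
      simp

theorem contr_contr (d d' : Module.Dual A M) (u : ExteriorAlgebra A M) :
    contr d (contr d' u) = -contr d' (contr d u) :=
  CliffordAlgebra.contractLeft_comm (Q := (0 : QuadraticForm A M)) d d' u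

theorem contr_self (d : Module.Dual A M) (u : ExteriorAlgebra A M) :
    contr d (contr d u) = 0 :=
  CliffordAlgebra.contractLeft_contractLeft (Q := (0 : QuadraticForm A M)) d u

end GradedDerivations

/-! ### Degrees in the exterior algebra. -/

section Grading

variable {A M : Type*} [CommRing A] [AddCommGroup M] [Module A M]

theorem algebraMap_mem_exteriorPower (a : A) :
    algebraMap A (ExteriorAlgebra A M) a ∈ ⋀[A]^0 M := by
  rw [ExteriorAlgebra.exteriorPower, pow_zero]
  exact Submodule.algebraMap_mem a

theorem ι_mem_exteriorPower (m : M) : ExteriorAlgebra.ι A m ∈ ⋀[A]^1 M := by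
  rw [ExteriorAlgebra.exteriorPower, pow_one]
  exact LinearMap.mem_range_self _ m

theorem mul_mem_exteriorPower {m n : ℕ} {u v : ExteriorAlgebra A M} (hu : u ∈ ⋀[A]^m M)
    (hv : v ∈ ⋀[A]^n M) : u * v ∈ ⋀[A]^(m + n) M :=
  SetLike.GradedMul.mul_mem hu hv

theorem ι_mul_mem_exteriorPower {n : ℕ} (m : M) {u : ExteriorAlgebra A M} (hu : u ∈ ⋀[A]^n M) :
    ExteriorAlgebra.ι A m * u ∈ ⋀[A]^(n + 1) M := by
  rw [add_comm]; exact mul_mem_exteriorPower (ι_mem_exteriorPower m) hu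

@[elab_as_elim]
theorem exteriorPower_induction {C : (n : ℕ) → (u : ExteriorAlgebra A M) → u ∈ ⋀[A]^n M → Prop}
    (algebraMap : ∀ a, C 0 (algebraMap A _ a) (algebraMap_mem_exteriorPower a))
    (add : ∀ n u v hu hv, C n u hu → C n v hv → C n (u + v) (add_mem hu hv))
    (ι_mul : ∀ n m u hu, C n u hu → C (n + 1) (ExteriorAlgebra.ι A m * u)
      (ι_mul_mem_exteriorPower m hu))
    {n : ℕ} {u : ExteriorAlgebra A M} (hu : u ∈ ⋀[A]^n M) : C n u hu := by
  induction hu using Submodule.pow_induction_on_left' with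
  | algebraMap a => exact algebraMap a
  | add u v n hu hv ihu ihv => exact add n u v hu hv ihu ihv
  | mem_mul m hm n u hu ih =>
    obtain ⟨m, rfl⟩ := hm
    exact ι_mul n m u hu ih

/-- Degree zero is a separate clause because a degree `-1` component cannot be named with natural
exponents. The two clauses are proved together, since the inductive step from degree zero to degree
one needs the vanishing. -/
theorem contr_mem (d : Module.Dual A M) {n : ℕ} {u : ExteriorAlgebra A M} (hu : u ∈ ⋀[A]^n M) :
    (n = 0 → contr d u = 0) ∧ ∀ k, n = k + 1 → contr d u ∈ ⋀[A]^k M := by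
  induction hu using exteriorPower_induction with
  | algebraMap a => exact ⟨fun _ => contr_algebraMap d a, fun k hk => by omega⟩
  | add n u v _ _ hu hv =>
    exact ⟨fun h => by rw [map_add, hu.1 h, hv.1 h, add_zero],
      fun k hk => by rw [map_add]; exact add_mem (hu.2 k hk) (hv.2 k hk)⟩
  | ι_mul n m u hm hu =>
    refine ⟨fun h => by omega, fun k hk => ?_⟩
    obtain rfl : n = k := by omega
    rw [contr_ι_mul]
    refine sub_mem (Submodule.smul_mem _ _ hm) ?_
    cases n with
    | zero => rw [hu.1 rfl, mul_zero]; exact zero_mem _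
    | succ n => exact ι_mul_mem_exteriorPower m (hu.2 n rfl)

theorem addHom_ext_of_mem {B : Type*} [AddCommGroup B] {f g : ExteriorAlgebra A M →+ B}
    (h : ∀ n, ∀ u ∈ ⋀[A]^n M, f u = g u) : f = g := by
  ext u
  induction u using DirectSum.Decomposition.inductionOn fun i => ⋀[A]^i M with
  | zero => rw [map_zero, map_zero]
  | add u v hu hv => rw [map_add, map_add, hu, hv]
  | homogeneous u => exact h _ _ u.2

end Grading

/-! ### Even derivations of the exterior algebra coming from derivations of a pair `(A, M)`. -/

section ModuleDerivations

variable {A M : Type*} [CommRing A] [AddCommGroup M] [Module A M]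

variable (A M) in
/-- A derivation of `A` together with a compatible additive operator on the `A`-module `M`. -/
structure ModuleDer where
  base : A →+ A
  op : M →+ M
  base_mul (a b : A) : base (a * b) = a * base b + b * base a
  op_smul (a : A) (m : M) : op (a • m) = a • op m + base a • m

namespace ModuleDer

theorem exists_ext (D : ModuleDer A M) : ∃ E : ExteriorAlgebra A M →+ ExteriorAlgebra A M,
    IsGradedDer 0 E ∧ (∀ a, E (algebraMap A _ a) = algebraMap A _ (D.base a)) ∧
      ∀ m, E (ExteriorAlgebra.ι A m) = ExteriorAlgebra.ι A (D.op m) :=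
  exists_isGradedDer 0 ((algebraMap A (ExteriorAlgebra A M)).toAddMonoidHom.comp D.base)
    ((ExteriorAlgebra.ι A : M →ₗ[A] _).toAddMonoidHom.comp D.op)
    (fun a => hasParity_algebraMap _) (fun m => hasParity_ι _)
    (fun a b => by
      change algebraMap A _ (D.base (a * b)) = a • algebraMap A _ (D.base b) +
        b • algebraMap A _ (D.base a)
      simp only [D.base_mul, map_add, map_mul, Algebra.smul_def])
    (fun a m => by
      change ExteriorAlgebra.ι A (D.op (a • m)) = a • ExteriorAlgebra.ι A (D.op m) +
        algebraMap A _ (D.base a) * ExteriorAlgebra.ι A m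
      simp only [D.op_smul, map_add, map_smul, Algebra.smul_def])

/-- The derivation of the exterior algebra that extends a derivation of the pair `(A, M)`. -/
def ext (D : ModuleDer A M) : ExteriorAlgebra A M →+ ExteriorAlgebra A M :=
  D.exists_ext.choose

variable (D : ModuleDer A M)

theorem isGradedDer_ext : IsGradedDer 0 D.ext := D.exists_ext.choose_spec.1

theorem ext_algebraMap (a : A) : D.ext (algebraMap A _ a) = algebraMap A _ (D.base a) :=
  D.exists_ext.choose_spec.2.1 a

theorem ext_ι (m : M) : D.ext (ExteriorAlgebra.ι A m) = ExteriorAlgebra.ι A (D.op m) :=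
  D.exists_ext.choose_spec.2.2 m

theorem ext_mul (u v : ExteriorAlgebra A M) : D.ext (u * v) = D.ext u * v + u * D.ext v := by
  rw [D.isGradedDer_ext.map_mul, twist_zero]

theorem ext_mem {n : ℕ} {u : ExteriorAlgebra A M} (hu : u ∈ ⋀[A]^n M) : D.ext u ∈ ⋀[A]^n M := by
  induction hu using exteriorPower_induction with
  | algebraMap a => rw [ext_algebraMap]; exact algebraMap_mem_exteriorPower _
  | add n u v _ _ hu hv => rw [map_add]; exact add_mem hu hv
  | ι_mul n m u hm hu =>
    rw [ext_mul, ext_ι]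
    exact add_mem (ι_mul_mem_exteriorPower _ hm) (ι_mul_mem_exteriorPower _ hu)

/-- The commutator of the extension with a contraction. -/
theorem contr_ext {d d' : Module.Dual A M} (h : ∀ m, d (D.op m) = D.base (d m) - d' m)
    (u : ExteriorAlgebra A M) : contr d (D.ext u) = D.ext (contr d u) - contr d' u := by
  -- The commutator and `-contr d'` are both odd derivations that kill `A`, and on vectors they
  -- agree by `h`.
  have h1 := (isGradedDer_contr d).commutator D.isGradedDer_ext
  have h2 := h1.ext (isGradedDer_contr d').neg
    (fun a => by
      simp [contr_algebraMap, D.ext_algebraMap])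
    (fun m => by
      simp [contr_ι, D.ext_algebraMap, D.ext_ι, h])
  have h3 := DFunLike.congr_fun h2 u
  simp only [AddMonoidHom.sub_apply, AddMonoidHom.comp_apply, mul_zero, pow_zero, one_smul,
    AddMonoidHom.neg_apply] at h3
  rw [eq_sub_iff_add_eq, ← sub_eq_zero, sub_eq_add_neg, ← sub_eq_zero.mpr h3]
  abel

end ModuleDer

end ModuleDerivations

/-! ### The Gerstenhaber bracket of `Λ_A L`: construction and Jacobi identity. -/

section Bracket

variable {R A L : Type*} [CommRing R] [CommRing A] [Algebra R A]
  [LieRing L] [Module A L] [LieRingModule L A] [LieRinehartRing A L] [LieAlgebra R L]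
  [LieRinehartAlgebra R A L]

/-- The adjoint action of `y ∈ L` on `(A, L)`. -/
def adjoint (A : Type*) {L : Type*} [CommRing A] [LieRing L] [Module A L] [LieRingModule L A]
    [LieRinehartRing A L] (y : L) : ModuleDer A L where
  base := AddMonoidHom.mk' (fun a => ⁅y, a⁆) (lie_add y)
  op := AddMonoidHom.mk' (fun z => ⁅y, z⁆) (lie_add y)
  base_mul a b := by
    change ⁅y, a * b⁆ = a * ⁅y, b⁆ + b * ⁅y, a⁆
    rw [LieRinehartRing.leibniz_mul_right, smul_eq_mul, mul_comm b]
  op_smul a m := LieRinehartRing.leibniz_smul_right y m a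

theorem adjoint_base (y : L) (a : A) : (adjoint A y).base a = ⁅y, a⁆ := rfl

theorem adjoint_op (y z : L) : (adjoint A y).op z = ⁅y, z⁆ := rfl

/-- The linear form `y ↦ y(a)`, i.e. the differential of `a`. -/
def diff (L : Type*) {A : Type*} [CommRing A] [LieRing L] [Module A L] [LieRingModule L A]
    [LieRinehartRing A L] (a : A) : Module.Dual A L where
  toFun y := ⁅y, a⁆
  map_add' y z := add_lie y z a
  map_smul' b y := LieRinehartRing.lie_smul_eq_mul b a y

theorem diff_apply (a : A) (y : L) : diff L a y = ⁅y, a⁆ := rfl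

theorem diff_add (a b : A) : diff L (a + b) = diff L a + diff L b :=
  LinearMap.ext fun y => lie_add y a b

theorem diff_mul (a b : A) : diff L (a * b) = a • diff L b + b • diff L a :=
  LinearMap.ext fun y => by
    change ⁅y, a * b⁆ = a * ⁅y, b⁆ + b * ⁅y, a⁆
    rw [LieRinehartRing.leibniz_mul_right, smul_eq_mul, mul_comm b]

theorem diff_algebraMap (r : R) : diff L (algebraMap R A r) = 0 :=
  LinearMap.ext fun y => lie_algebraMap y r

theorem adjoint_ext_add (y z : L) (u : ExteriorAlgebra A L) :
    (adjoint A (y + z)).ext u = (adjoint A y).ext u + (adjoint A z).ext u :=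
  (adjoint A (y + z)).isGradedDer_ext.ext_apply
    ((adjoint A y).isGradedDer_ext.add (adjoint A z).isGradedDer_ext)
    (fun a => by simp [ModuleDer.ext_algebraMap, adjoint_base])
    (fun a => by simp [ModuleDer.ext_ι, adjoint_op]) u

/-- The correction term comes from `[a y, z] = a [y, z] - z(a) y`: the map `z ↦ z(a) y` extends to
the even derivation `y ∧ i(da)`. Comparison on generators suffices. -/
theorem adjoint_ext_smul (a : A) (y : L) (u : ExteriorAlgebra A L) :
    (adjoint A (a • y)).ext u =
      a • (adjoint A y).ext u - ExteriorAlgebra.ι A y * contr (diff L a) u := by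
  have h := ((adjoint A y).isGradedDer_ext.smul a).sub
    ((isGradedDer_contr (diff L a)).mul_left (hasParity_ι y)).of_add_two
  rw [Algebra.smul_def]
  refine (adjoint A (a • y)).isGradedDer_ext.ext_apply h (fun b => ?_) (fun z => ?_) u
  · simp [ModuleDer.ext_algebraMap, adjoint_base, contr_algebraMap]
  · have e : ⁅a • y, z⁆ = a • ⁅y, z⁆ - ⁅z, a⁆ • y := by
      rw [← lie_skew, LieRinehartRing.leibniz_smul_right, ← lie_skew y z, smul_neg]
      abel
    simp [ModuleDer.ext_ι, adjoint_op, contr_ι, diff_apply, e, Algebra.smul_def, Algebra.commutes]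

/-- The values are forced by skew-symmetry, with `[a, v] = -i(da) v` and `[y, v] = ad_y v`. They are
compatible with the relation between `a y` and `a`, `y` by `adjoint_ext_smul`, so they extend to a
derivation `[v, ·]`. -/
theorem exists_bracket {n : ℕ} {v : ExteriorAlgebra A L} (hv : HasParity n v) :
    ∃ D : ExteriorAlgebra A L →+ ExteriorAlgebra A L, IsGradedDer (n + 1) D ∧
      (∀ a, D (algebraMap A _ a) = (-1 : ℤ) ^ (n + 1) • contr (diff L a) v) ∧
      ∀ y, D (ExteriorAlgebra.ι A y) = -(adjoint A y).ext v := by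
  refine exists_isGradedDer (n + 1)
    (AddMonoidHom.mk' (fun a => (-1 : ℤ) ^ (n + 1) • contr (diff L a) v) fun a b => ?_)
    (AddMonoidHom.mk' (fun y => -(adjoint A y).ext v) fun y z => ?_)
    (fun a => ?_) (fun y => ?_) (fun a b => ?_) (fun a y => ?_)
  · rw [diff_add, contr_add_left, smul_add]
  · rw [adjoint_ext_add, neg_add]
  · exact ((isGradedDer_contr _).hasParity hv).zsmul _
  · exact ((adjoint A y).isGradedDer_ext.hasParity hv).neg.add_two
  · simp only [AddMonoidHom.mk'_apply, diff_mul, contr_add_left, contr_smul_left, smul_add]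
    rw [smul_comm a, smul_comm b]
  · simp only [AddMonoidHom.mk'_apply]
    rw [adjoint_ext_smul, ι_mul_eq y (contr (diff L a) v),
      ((isGradedDer_contr (diff L a)).hasParity hv).twist, one_mul, smul_mul_assoc, smul_neg]
    abel

/-- The bracket `[v, ·]` with a homogeneous element `v` of `Λ_A L`. -/
def bracketHom (n : ℕ) : ⋀[A]^n L →+ ExteriorAlgebra A L →+ ExteriorAlgebra A L :=
  AddMonoidHom.mk' (fun v => (exists_bracket (hasParity_of_mem v.2)).choose) fun v w => by
    have hv := (exists_bracket (hasParity_of_mem v.2)).choose_spec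
    have hw := (exists_bracket (hasParity_of_mem w.2)).choose_spec
    have h := (exists_bracket (hasParity_of_mem (v + w).2)).choose_spec
    -- The choices add up because a graded derivation is determined by its values on generators.
    refine h.1.ext (hv.1.add hw.1) (fun a => ?_) fun y => ?_
    · rw [h.2.1, AddMonoidHom.add_apply, hv.2.1, hw.2.1, Submodule.coe_add, map_add, smul_add]
    · rw [h.2.2, AddMonoidHom.add_apply, hv.2.2, hw.2.2, Submodule.coe_add, map_add, neg_add]

variable (A L) in
/-- The Gerstenhaber bracket of `Λ_A L`, as a biadditive map. -/
def gerstHom : ExteriorAlgebra A L →+ ExteriorAlgebra A L →+ ExteriorAlgebra A L :=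
  (DirectSum.toAddMonoid fun n => bracketHom n).comp
    (DirectSum.decomposeAddEquiv fun n => ⋀[A]^n L).toAddMonoidHom

theorem gerstHom_of_mem {n : ℕ} {v : ExteriorAlgebra A L} (hv : v ∈ ⋀[A]^n L) :
    gerstHom A L v = bracketHom n ⟨v, hv⟩ := by
  change DirectSum.toAddMonoid (fun n => bracketHom n)
    (DirectSum.decompose (fun n => ⋀[A]^n L) v) = _
  rw [DirectSum.decompose_of_mem (fun n => ⋀[A]^n L) hv, DirectSum.toAddMonoid_of]

theorem isGradedDer_gerstHom {n : ℕ} {v : ExteriorAlgebra A L} (hv : v ∈ ⋀[A]^n L) :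
    IsGradedDer (n + 1) (gerstHom A L v) := by
  rw [gerstHom_of_mem hv]
  exact (exists_bracket (hasParity_of_mem hv)).choose_spec.1

theorem gerstHom_algebraMap {n : ℕ} {v : ExteriorAlgebra A L} (hv : v ∈ ⋀[A]^n L) (a : A) :
    gerstHom A L v (algebraMap A _ a) = (-1 : ℤ) ^ (n + 1) • contr (diff L a) v := by
  rw [gerstHom_of_mem hv]
  exact (exists_bracket (hasParity_of_mem hv)).choose_spec.2.1 a

/-- The value carries no sign depending on the degree of `v`, so homogeneity of `v` can be dropped.
-/
theorem gerstHom_ι (v : ExteriorAlgebra A L) (y : L) :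
    gerstHom A L v (ExteriorAlgebra.ι A y) = -(adjoint A y).ext v := by
  have h : (gerstHom A L).flip (ExteriorAlgebra.ι A y) = -(adjoint A y).ext := by
    refine addHom_ext_of_mem fun n u hu => ?_
    rw [AddMonoidHom.flip_apply, gerstHom_of_mem hu]
    exact (exists_bracket (hasParity_of_mem hu)).choose_spec.2.2 y
  exact DFunLike.congr_fun h v

theorem algebraMap_gerstHom (a : A) (u : ExteriorAlgebra A L) :
    gerstHom A L (algebraMap A _ a) u = -contr (diff L a) u := by
  have h0 := algebraMap_mem_exteriorPower (M := L) a
  refine (isGradedDer_gerstHom h0).ext_apply (isGradedDer_contr _).neg (fun b => ?_) (fun y => ?_) u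
  · rw [gerstHom_algebraMap h0, AddMonoidHom.neg_apply, contr_algebraMap, contr_algebraMap]; simp
  · rw [gerstHom_ι, ModuleDer.ext_algebraMap, AddMonoidHom.neg_apply, contr_ι]; rfl

theorem ι_gerstHom (y : L) (u : ExteriorAlgebra A L) :
    gerstHom A L (ExteriorAlgebra.ι A y) u = (adjoint A y).ext u := by
  have h1 := ι_mem_exteriorPower (A := A) y
  refine (isGradedDer_gerstHom h1).ext_apply (adjoint A y).isGradedDer_ext.add_two
    (fun b => ?_) (fun z => ?_) u
  · rw [gerstHom_algebraMap h1, ModuleDer.ext_algebraMap, contr_ι]; simp [adjoint_base, diff_apply]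
  · rw [gerstHom_ι, ModuleDer.ext_ι, ModuleDer.ext_ι, ← map_neg, adjoint_op, adjoint_op, lie_skew]

/-- In the variable `w` all terms are derivations of parity `m + n + 1`. On generators the identity
is the Leibniz rule of a contraction and of an adjoint action. -/
theorem gerstHom_mul_left {m n : ℕ} {u v : ExteriorAlgebra A L} (hu : u ∈ ⋀[A]^m L)
    (hv : v ∈ ⋀[A]^n L) (w : ExteriorAlgebra A L) :
    gerstHom A L (u * v) w =
      u * gerstHom A L v w + (-1 : ℤ) ^ (m * n) • (v * gerstHom A L u w) := by
  have h1 := (isGradedDer_gerstHom hv).mul_left (hasParity_of_mem hu)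
  have h2 := ((isGradedDer_gerstHom hu).mul_left (hasParity_of_mem hv)).zsmul ((-1 : ℤ) ^ (m * n))
  rw [show n + (m + 1) = m + (n + 1) by omega] at h2
  refine (isGradedDer_gerstHom (mul_mem_exteriorPower hu hv)).ext_apply (h1.add h2)
    (fun a => ?_) (fun y => ?_) w
  · simp only [AddMonoidHom.add_apply, AddMonoidHom.smul_apply, AddMonoidHom.comp_apply,
      AddMonoidHom.coe_mulLeft, gerstHom_algebraMap hu, gerstHom_algebraMap hv,
      gerstHom_algebraMap (mul_mem_exteriorPower hu hv), (isGradedDer_contr _).map_mul]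
    have hc := ((isGradedDer_contr (diff L a)).hasParity (hasParity_of_mem hu)).mul_comm_smul
      (hasParity_of_mem hv)
    rw [hc, (hasParity_of_mem hu).twist 1]
    simp only [smul_add, smul_smul, smul_mul_assoc, mul_smul_comm]
    rcases neg_one_pow_eq_or ℤ m with h | h <;> rcases neg_one_pow_eq_or ℤ n with h' | h' <;>
      simp [pow_add, pow_mul, add_mul, h, h', add_comm]
  · simp only [AddMonoidHom.add_apply, AddMonoidHom.smul_apply, AddMonoidHom.comp_apply,
      AddMonoidHom.coe_mulLeft, gerstHom_ι, ModuleDer.ext_mul]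
    rw [((adjoint A y).isGradedDer_ext.hasParity (hasParity_of_mem hu)).mul_comm_smul
      (hasParity_of_mem hv), mul_neg, mul_neg, add_zero, smul_neg]
    abel

/-- Induction on `v`: on generators it holds by construction, and a further vector is split off by
the Leibniz rule in the second argument on one side and by `gerstHom_mul_left` on the other. -/
theorem gerstHom_skew {m n : ℕ} {u v : ExteriorAlgebra A L} (hu : u ∈ ⋀[A]^m L)
    (hv : v ∈ ⋀[A]^n L) :
    gerstHom A L u v = -((-1 : ℤ) ^ ((m + 1) * (n + 1)) • gerstHom A L v u) := by
  induction hv using exteriorPower_induction with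
  | algebraMap a => rw [gerstHom_algebraMap hu, algebraMap_gerstHom]; simp
  | add n v w _ _ hv hw => simp only [map_add, AddMonoidHom.add_apply, hv, hw, smul_add]; abel
  | ι_mul n y v hv ih =>
    have hy := ι_mem_exteriorPower (A := A) y
    rw [(isGradedDer_gerstHom hu).map_mul, gerstHom_mul_left hy hv, ih, gerstHom_ι, ι_gerstHom,
      (hasParity_ι y).twist, neg_mul,
      ((adjoint A y).isGradedDer_ext.hasParity (hasParity_of_mem hu)).mul_comm_smul
        (hasParity_of_mem hv)]
    simp only [mul_neg, smul_mul_assoc, mul_smul_comm, smul_add, smul_smul]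
    rcases neg_one_pow_eq_or ℤ m with h | h <;> rcases neg_one_pow_eq_or ℤ n with h' | h' <;>
      simp [pow_add, pow_mul, mul_add, add_mul, h, h']

theorem gerstHom_mem {m n : ℕ} {u v : ExteriorAlgebra A L} (hu : u ∈ ⋀[A]^m L)
    (hv : v ∈ ⋀[A]^n L) : (m + n = 0 → gerstHom A L u v = 0) ∧
      ∀ k, m + n = k + 1 → gerstHom A L u v ∈ ⋀[A]^k L := by
  induction hv using exteriorPower_induction with
  | algebraMap a =>
    rw [gerstHom_algebraMap hu]
    have h := contr_mem (diff L a) hu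
    exact ⟨fun h0 => by rw [h.1 h0, smul_zero], fun k hk => zsmul_mem (h.2 k hk) _⟩
  | add n v w _ _ hv hw =>
    rw [map_add]
    exact ⟨fun h0 => by rw [hv.1 h0, hw.1 h0, add_zero],
      fun k hk => add_mem (hv.2 k hk) (hw.2 k hk)⟩
  | ι_mul n y v hv ih =>
    refine ⟨fun h => by omega, fun k hk => ?_⟩
    obtain rfl : k = m + n := by omega
    rw [(isGradedDer_gerstHom hu).map_mul, gerstHom_ι, (hasParity_ι y).twist]
    refine add_mem (mul_mem_exteriorPower (neg_mem ((adjoint A y).ext_mem hu)) hv) ?_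
    rw [smul_mul_assoc]
    refine zsmul_mem ?_ _
    rcases Nat.eq_zero_or_pos (m + n) with h | h
    · rw [ih.1 h, mul_zero]; exact zero_mem _
    · obtain ⟨k, hk⟩ := Nat.exists_eq_add_of_lt h
      rw [hk, show 0 + k + 1 = k + 1 by omega]
      exact ι_mul_mem_exteriorPower y (ih.2 k (by omega))

/-- When `m + n = 0` the inner bracket has no degree in `ℕ`, but it vanishes, and zero is a
derivation of every parity. -/
theorem isGradedDer_gerstHom_gerstHom {m n : ℕ} {u v : ExteriorAlgebra A L} (hu : u ∈ ⋀[A]^m L)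
    (hv : v ∈ ⋀[A]^n L) : IsGradedDer (m + 1 + (n + 1)) (gerstHom A L (gerstHom A L u v)) := by
  rcases Nat.eq_zero_or_pos (m + n) with h | h
  · rw [(gerstHom_mem hu hv).1 h, map_zero]; exact IsGradedDer.zero _
  · obtain ⟨k, hk⟩ := Nat.exists_eq_add_of_lt h
    have := (isGradedDer_gerstHom ((gerstHom_mem hu hv).2 k (by omega))).add_two
    rwa [show m + 1 + (n + 1) = k + 1 + 2 by omega]

theorem gerstHom_skew_gerstHom {m n k : ℕ} {u v w : ExteriorAlgebra A L} (hu : u ∈ ⋀[A]^m L)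
    (hv : v ∈ ⋀[A]^n L) (hw : w ∈ ⋀[A]^k L) :
    gerstHom A L (gerstHom A L u v) w =
      -((-1 : ℤ) ^ ((m + n) * (k + 1)) • gerstHom A L w (gerstHom A L u v)) := by
  rcases Nat.eq_zero_or_pos (m + n) with h | h
  · rw [(gerstHom_mem hu hv).1 h, map_zero, map_zero]; simp
  · obtain ⟨j, hj⟩ := Nat.exists_eq_add_of_lt h
    rw [show m + n = j + 1 by omega]
    exact gerstHom_skew ((gerstHom_mem hu hv).2 j (by omega)) hw

/-- The graded Jacobi identity for `u`, `v`, `w`, where `m = |u|` and `n = |v|`. -/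
def JacobiAt (m n : ℕ) (u v w : ExteriorAlgebra A L) : Prop :=
  gerstHom A L u (gerstHom A L v w) = gerstHom A L (gerstHom A L u v) w +
    (-1 : ℤ) ^ ((m + 1) * (n + 1)) • gerstHom A L v (gerstHom A L u w)

/-- The graded commutator of `[u, ·]` and `[v, ·]` and the operator `[[u, v], ·]` are derivations of
the same parity. -/
theorem JacobiAt.of_generators {m n : ℕ} {u v : ExteriorAlgebra A L} (hu : u ∈ ⋀[A]^m L)
    (hv : v ∈ ⋀[A]^n L) (h0 : ∀ a, JacobiAt m n u v (algebraMap A _ a))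
    (h1 : ∀ y, JacobiAt m n u v (ExteriorAlgebra.ι A y)) (w : ExteriorAlgebra A L) :
    JacobiAt m n u v w := by
  have hc := (isGradedDer_gerstHom hu).commutator (isGradedDer_gerstHom hv)
  have h := hc.ext_apply (isGradedDer_gerstHom_gerstHom hu hv)
    (fun a => sub_eq_iff_eq_add.mpr (h0 a)) (fun y => sub_eq_iff_eq_add.mpr (h1 y)) w
  exact sub_eq_iff_eq_add.mp h

/-- Together with `JacobiAt.swap_right` this makes the identity symmetric in its three arguments, so
that any of them can be brought to the last place, where `JacobiAt.of_generators` applies. -/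
theorem JacobiAt.swap_left {m n : ℕ} {u v w : ExteriorAlgebra A L} (hu : u ∈ ⋀[A]^m L)
    (hv : v ∈ ⋀[A]^n L) (h : JacobiAt m n u v w) : JacobiAt n m v u w := by
  unfold JacobiAt at *
  rw [h, gerstHom_skew hu hv]
  simp only [map_neg, map_zsmul, AddMonoidHom.neg_apply, AddMonoidHom.smul_apply]
  rcases neg_one_pow_eq_or ℤ m with h | h <;> rcases neg_one_pow_eq_or ℤ n with h' | h' <;>
    simp [pow_add, pow_mul, mul_add, add_mul, h, h']

theorem JacobiAt.swap_right {m n k : ℕ} {u v w : ExteriorAlgebra A L} (hu : u ∈ ⋀[A]^m L)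
    (hv : v ∈ ⋀[A]^n L) (hw : w ∈ ⋀[A]^k L) (h : JacobiAt m n u v w) : JacobiAt m k u w v := by
  unfold JacobiAt at *
  have e := gerstHom_skew_gerstHom hu hv hw
  rw [gerstHom_skew hw hv, map_neg, map_zsmul, h, gerstHom_skew_gerstHom hu hw hv, e]
  simp only [smul_add, smul_neg, smul_smul]
  rcases neg_one_pow_eq_or ℤ m with h | h <;> rcases neg_one_pow_eq_or ℤ n with h' | h' <;>
    rcases neg_one_pow_eq_or ℤ k with h'' | h'' <;>
    simp [pow_add, pow_mul, mul_add, add_mul, h, h', h'', add_comm]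

/-- The generators of `Λ_A L`, with their degrees. -/
inductive IsGenerator : ℕ → ExteriorAlgebra A L → Prop
  | base (a : A) : IsGenerator 0 (algebraMap A _ a)
  | vec (y : L) : IsGenerator 1 (ExteriorAlgebra.ι A y)

theorem IsGenerator.mem {n : ℕ} {u : ExteriorAlgebra A L} (h : IsGenerator n u) :
    u ∈ ⋀[A]^n L := by
  cases h with
  | base a => exact algebraMap_mem_exteriorPower a
  | vec y => exact ι_mem_exteriorPower y

/-- Three vectors give the Jacobi identity of `L`, and two vectors with a function give the action
of `L` on `A`. With at most one vector all terms vanish for reasons of degree. The swaps yield the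
remaining orders. -/
theorem jacobiAt_generators {m n k : ℕ} {u v w : ExteriorAlgebra A L} (hu : IsGenerator m u)
    (hv : IsGenerator n v) (hw : IsGenerator k w) : JacobiAt m n u v w := by
  have h3 : ∀ y z : L, ∀ x : L, JacobiAt (A := A) 1 1 (ExteriorAlgebra.ι A y)
      (ExteriorAlgebra.ι A z) (ExteriorAlgebra.ι A x) := fun y z x => by
    simp only [JacobiAt, ι_gerstHom, ModuleDer.ext_ι, adjoint_op, leibniz_lie y z x]
    simp
  have h2 : ∀ (y z : L) (a : A), JacobiAt 1 1 (ExteriorAlgebra.ι A y)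
      (ExteriorAlgebra.ι A z) (algebraMap A _ a) := fun y z a => by
    simp only [JacobiAt, ι_gerstHom, ModuleDer.ext_ι, ModuleDer.ext_algebraMap, adjoint_op,
      adjoint_base, leibniz_lie y z a]
    simp
  have h1 : ∀ (y : L) (a b : A), JacobiAt 1 0 (ExteriorAlgebra.ι A y)
      (algebraMap A _ a) (algebraMap A _ b) := fun y a b => by
    simp [JacobiAt, ι_gerstHom, ModuleDer.ext_algebraMap, algebraMap_gerstHom, contr_algebraMap]
  have h0 : ∀ (a b c : A), JacobiAt (A := A) (L := L) 0 0 (algebraMap A _ a)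
      (algebraMap A _ b) (algebraMap A _ c) := fun a b c => by
    simp [JacobiAt, algebraMap_gerstHom, contr_algebraMap]
  have h2' : ∀ (y z : L) (a : A), JacobiAt 1 0 (ExteriorAlgebra.ι A y)
      (algebraMap A _ a) (ExteriorAlgebra.ι A z) := fun y z a =>
    (h2 y z a).swap_right (ι_mem_exteriorPower _) (ι_mem_exteriorPower _)
      (algebraMap_mem_exteriorPower _)
  have h1' : ∀ (y : L) (a b : A), JacobiAt 0 1 (algebraMap A _ a) (ExteriorAlgebra.ι A y)
      (algebraMap A _ b) := fun y a b =>
    (h1 y a b).swap_left (ι_mem_exteriorPower _) (algebraMap_mem_exteriorPower _)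
  cases hu with
  | base a =>
    cases hv with
    | base b =>
      cases hw with
      | base c => exact h0 a b c
      | vec y =>
        exact (h1' y a b).swap_right (algebraMap_mem_exteriorPower _)
          (ι_mem_exteriorPower _) (algebraMap_mem_exteriorPower _)
    | vec y =>
      cases hw with
      | base b => exact h1' y a b
      | vec z =>
        exact (h2' y z a).swap_left (ι_mem_exteriorPower _)
          (algebraMap_mem_exteriorPower _)
  | vec y =>
    cases hv with
    | base a =>
      cases hw with
      | base b => exact h1 y a b
      | vec z => exact h2' y z a
    | vec z =>
      cases hw with
      | base a => exact h2 y z a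
      | vec x => exact h3 y z x

/-- Each argument in turn is moved to the last place, replaced there by generators, and moved back.
-/
theorem gerstHom_jacobi {m n : ℕ} {u v : ExteriorAlgebra A L} (hu : u ∈ ⋀[A]^m L)
    (hv : v ∈ ⋀[A]^n L) (w : ExteriorAlgebra A L) : JacobiAt m n u v w := by
  have step1 : ∀ {m n : ℕ} {u v : ExteriorAlgebra A L}, IsGenerator m u → IsGenerator n v →
      ∀ w, JacobiAt m n u v w := fun hu hv =>
    JacobiAt.of_generators hu.mem hv.mem (fun a => jacobiAt_generators hu hv (.base a))
      (fun y => jacobiAt_generators hu hv (.vec y))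
  have step2 : ∀ {m n : ℕ} {u v : ExteriorAlgebra A L}, IsGenerator m u → v ∈ ⋀[A]^n L →
      ∀ w, JacobiAt m n u v w := fun hu hv =>
    JacobiAt.of_generators hu.mem hv
      (fun a => (step1 hu (.base a) _).swap_right hu.mem (IsGenerator.base a).mem hv)
      (fun y => (step1 hu (.vec y) _).swap_right hu.mem (IsGenerator.vec y).mem hv)
  refine JacobiAt.of_generators hu hv (fun a => ?_) (fun y => ?_) w
  · exact ((step2 (.base a) hu v).swap_left (IsGenerator.base a).mem hu).swap_right hu
      (IsGenerator.base a).mem hv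
  · exact ((step2 (.vec y) hu v).swap_left (IsGenerator.vec y).mem hu).swap_right hu
      (IsGenerator.vec y).mem hv

/-- A scalar from `R` is an element of `A` with zero differential, so the Leibniz rule produces no
extra term. -/
theorem gerstHom_smul_right (r : R) (u v : ExteriorAlgebra A L) :
    gerstHom A L u (r • v) = r • gerstHom A L u v := by
  have h : ((gerstHom A L).flip (r • v)) = (DistribSMul.toAddMonoidHom _ r).comp
      ((gerstHom A L).flip v) := by
    refine addHom_ext_of_mem fun n u hu => ?_
    change gerstHom A L u (r • v) = r • gerstHom A L u v
    rw [← algebraMap_smul A r v, Algebra.smul_def, (isGradedDer_gerstHom hu).map_mul,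
      gerstHom_algebraMap hu, diff_algebraMap, AlgHom.commutes, ← Algebra.smul_def, algebraMap_smul,
      ← zero_smul A (0 : Module.Dual A L), contr_smul_left, zero_smul, smul_zero, zero_mul, zero_add]
  exact DFunLike.congr_fun h u

theorem gerstHom_smul_left (r : R) (u v : ExteriorAlgebra A L) :
    gerstHom A L (r • u) v = r • gerstHom A L u v := by
  have h : (gerstHom A L).comp (DistribSMul.toAddMonoidHom (ExteriorAlgebra A L) r) =
      (AddMonoidHom.compHom (DistribSMul.toAddMonoidHom (ExteriorAlgebra A L) r)).comp
        (gerstHom A L) := by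
    refine addHom_ext_of_mem fun n u hu => addHom_ext_of_mem fun k v hv => ?_
    change gerstHom A L (r • u) v = r • gerstHom A L u v
    have hu' : r • u ∈ ⋀[A]^n L := by
      rw [← algebraMap_smul A r u]; exact Submodule.smul_mem _ _ hu
    rw [gerstHom_skew hu' hv, gerstHom_smul_right, gerstHom_skew hu hv, smul_neg, smul_comm]
  exact DFunLike.congr_fun (DFunLike.congr_fun h u) v

variable (R A L) in
/-- The Gerstenhaber bracket of `Λ_A L`. -/
def gerst : ExteriorAlgebra A L →ₗ[R] ExteriorAlgebra A L →ₗ[R] ExteriorAlgebra A L :=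
  LinearMap.mk₂ R (fun u v => gerstHom A L u v)
    (fun u v w => by rw [map_add, AddMonoidHom.add_apply]) gerstHom_smul_left
    (fun u v w => map_add _ v w) gerstHom_smul_right

theorem gerst_apply (u v : ExteriorAlgebra A L) : gerst R A L u v = gerstHom A L u v := rfl

theorem isGerstenhaberBracket_gerst : IsGerstenhaberBracket R A L (gerst R A L) where
  mem hu hv h := (gerstHom_mem hu hv).2 _ h
  eq_zero a b := by rw [gerst_apply, algebraMap_gerstHom, contr_algebraMap, neg_zero]
  lie_lie x y := by rw [gerst_apply, ι_gerstHom, ModuleDer.ext_ι]; rfl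
  lie_base x a := by rw [gerst_apply, ι_gerstHom, ModuleDer.ext_algebraMap]; rfl
  leibniz w hu hv := gerstHom_mul_left hu hv w
  skew hu hv := gerstHom_skew hu hv

end Bracket

/-! ### Brackets are determined by their values on generators. -/

section Uniqueness

variable {A M : Type*} [CommRing A] [AddCommGroup M] [Module A M]

/-- The products `a x_1 ... x_n` in `Λ_A M` with all the `x_i` in `G`. -/
inductive IsMonomial (G : Set M) : ℕ → ExteriorAlgebra A M → Prop
  | base (a : A) : IsMonomial G 0 (algebraMap A _ a)
  | cons {n : ℕ} {u : ExteriorAlgebra A M} {x : M} (hx : x ∈ G) (hu : IsMonomial G n u) :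
      IsMonomial G (n + 1) (ExteriorAlgebra.ι A x * u)

theorem IsMonomial.mem {G : Set M} {n : ℕ} {u : ExteriorAlgebra A M} (h : IsMonomial G n u) :
    u ∈ ⋀[A]^n M := by
  induction h with
  | base a => exact algebraMap_mem_exteriorPower a
  | cons _ _ ih => exact ι_mul_mem_exteriorPower _ ih

theorem isMonomial_ι {G : Set M} {x : M} (hx : x ∈ G) :
    IsMonomial G 1 (ExteriorAlgebra.ι A x) := by
  have h := IsMonomial.cons hx (.base (1 : A))
  rwa [map_one, mul_one] at h

theorem mem_closure_isMonomial {G : Set M} (hG : AddSubgroup.closure G = ⊤)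
    (u : ExteriorAlgebra A M) : u ∈ AddSubgroup.closure {u | ∃ n, IsMonomial (A := A) G n u} := by
  induction u using CliffordAlgebra.left_induction with
  | algebraMap a => exact AddSubgroup.subset_closure ⟨0, .base a⟩
  | add u v hu hv => exact add_mem hu hv
  | ι_mul u m hu =>
    change ExteriorAlgebra.ι A m * u ∈ _
    have hm : m ∈ AddSubgroup.closure G := hG ▸ AddSubgroup.mem_top m
    induction hm using AddSubgroup.closure_induction with
    | zero => rw [map_zero, zero_mul]; exact zero_mem _
    | add x y _ _ hx hy => rw [map_add, add_mul]; exact add_mem hx hy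
    | neg x _ hx => rw [map_neg, neg_mul]; exact neg_mem hx
    | mem x hx =>
      induction hu using AddSubgroup.closure_induction with
      | zero => rw [mul_zero]; exact zero_mem _
      | add u v _ _ hu hv => rw [mul_add]; exact add_mem hu hv
      | neg u _ hu => rw [mul_neg]; exact neg_mem hu
      | mem u hu =>
        obtain ⟨n, hu⟩ := hu
        exact AddSubgroup.subset_closure ⟨n + 1, .cons hx hu⟩

theorem addHom_ext_of_isMonomial {G : Set M} (hG : AddSubgroup.closure G = ⊤) {B : Type*}
    [AddCommGroup B] {f g : ExteriorAlgebra A M →+ B}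
    (h : ∀ n u, IsMonomial G n u → f u = g u) : f = g := by
  ext u
  induction mem_closure_isMonomial hG u using AddSubgroup.closure_induction with
  | zero => rw [map_zero, map_zero]
  | add x y _ _ hx hy => rw [map_add, map_add, hx, hy]
  | neg x _ hx => rw [map_neg, map_neg, hx]
  | mem u hu =>
    obtain ⟨n, hu⟩ := hu
    exact h n u hu

/-- The rules that determine a bracket from its values on generators. -/
structure LeibnizOn (G : Set M)
    (br : ExteriorAlgebra A M →+ ExteriorAlgebra A M →+ ExteriorAlgebra A M) : Prop where
  leibniz {n : ℕ} {x : M} {u : ExteriorAlgebra A M} (w : ExteriorAlgebra A M) : x ∈ G →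
    IsMonomial G n u → br (ExteriorAlgebra.ι A x * u) w =
      ExteriorAlgebra.ι A x * br u w + (-1 : ℤ) ^ n • (u * br (ExteriorAlgebra.ι A x) w)
  skew {m n : ℕ} {u v : ExteriorAlgebra A M} : IsMonomial G m u → IsMonomial G n v →
    br u v = -((-1 : ℤ) ^ ((m + 1) * (n + 1)) • br v u)

/-- The Leibniz rule reduces the first argument to generators, skew-symmetry exchanges the
arguments, and the Leibniz rule is used again. The rules are required only on monomials with factors
in `G`, since a bigraded bracket satisfies them a priori only for bihomogeneous elements. -/
theorem LeibnizOn.ext {G : Set M} (hG : AddSubgroup.closure G = ⊤)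
    {br br' : ExteriorAlgebra A M →+ ExteriorAlgebra A M →+ ExteriorAlgebra A M}
    (h : LeibnizOn G br) (h' : LeibnizOn G br')
    (h00 : ∀ a b : A, br (algebraMap A _ a) (algebraMap A _ b) =
      br' (algebraMap A _ a) (algebraMap A _ b))
    (h10 : ∀ x ∈ G, ∀ a : A, br (ExteriorAlgebra.ι A x) (algebraMap A _ a) =
      br' (ExteriorAlgebra.ι A x) (algebraMap A _ a))
    (h11 : ∀ x ∈ G, ∀ y ∈ G, br (ExteriorAlgebra.ι A x) (ExteriorAlgebra.ι A y) =
      br' (ExteriorAlgebra.ι A x) (ExteriorAlgebra.ι A y)) : br = br' := by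
  have h01 : ∀ x ∈ G, ∀ a : A, br (algebraMap A _ a) (ExteriorAlgebra.ι A x) =
      br' (algebraMap A _ a) (ExteriorAlgebra.ι A x) := fun x hx a => by
    rw [h.skew (.base a) (isMonomial_ι hx), h'.skew (.base a) (isMonomial_ι hx), h10 x hx]
  -- This is applied twice at the top level: first with an arbitrary monomial as the right argument,
  -- then, after exchanging the arguments, with a generator there.
  have key : ∀ v, (∀ a : A, br (algebraMap A _ a) v = br' (algebraMap A _ a) v) →
      (∀ x ∈ G, br (ExteriorAlgebra.ι A x) v = br' (ExteriorAlgebra.ι A x) v) →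
      ∀ m u, IsMonomial G m u → br u v = br' u v := by
    intro v h0 h1 m u hu
    induction hu with
    | base a => exact h0 a
    | cons hx hu ih => rw [h.leibniz v hx hu, h'.leibniz v hx hu, ih, h1 _ hx]
  refine addHom_ext_of_isMonomial hG fun m u hu => addHom_ext_of_isMonomial hG fun n v hv => ?_
  refine key v (fun a => ?_) (fun x hx => ?_) m u hu
  · rw [h.skew (.base a) hv, h'.skew (.base a) hv,
      key _ (fun b => h00 b a) (fun x hx => h10 x hx a) n v hv]
  · rw [h.skew (isMonomial_ι hx) hv, h'.skew (isMonomial_ι hx) hv,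
      key _ (fun b => h01 x hx b) (fun y hy => h11 y hy x hx) n v hv]

/-- A biadditive map from a bilinear one. -/
def toBiadditive {R B : Type*} [CommRing R] [AddCommGroup B] [Module R B] (f : B →ₗ[R] B →ₗ[R] B) :
    B →+ B →+ B :=
  AddMonoidHom.mk' (fun u => (f u).toAddMonoidHom) fun u v => by ext w; simp

variable {R L : Type*} [CommRing R] [Algebra R A]
  [LieRing L] [Module A L] [LieRingModule L A] [LieRinehartRing A L] [LieAlgebra R L]
  [LieRinehartAlgebra R A L]

theorem IsGerstenhaberBracket.leibnizOn
    {br : ExteriorAlgebra A L →ₗ[R] ExteriorAlgebra A L →ₗ[R] ExteriorAlgebra A L}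
    (h : IsGerstenhaberBracket R A L br) (G : Set L) : LeibnizOn G (toBiadditive br) where
  leibniz {n x u} w _ hu := by
    have e := h.leibniz w (ι_mem_exteriorPower x) hu.mem
    rwa [one_mul] at e
  skew hu hv := h.skew hu.mem hv.mem

theorem IsGerstenhaberBracket.eq_gerst
    {br : ExteriorAlgebra A L →ₗ[R] ExteriorAlgebra A L →ₗ[R] ExteriorAlgebra A L}
    (h : IsGerstenhaberBracket R A L br) : br = gerst R A L := by
  have h' := isGerstenhaberBracket_gerst (R := R) (A := A) (L := L)
  have e := (h.leibnizOn Set.univ).ext (by simp) (h'.leibnizOn Set.univ)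
    (fun a b => (h.eq_zero a b).trans (h'.eq_zero a b).symm)
    (fun x _ a => (h.lie_base x a).trans (h'.lie_base x a).symm)
    (fun x _ y _ => (h.lie_lie x y).trans (h'.lie_lie x y).symm)
  ext u v
  exact DFunLike.congr_fun (DFunLike.congr_fun e u) v

end Uniqueness

/-! ### Dual bases of finitely generated projective modules and expansion of alternating forms. -/

section Expansion

variable {A M N : Type*} [CommRing A] [AddCommGroup M] [Module A M] [AddCommGroup N] [Module A N]

theorem alternatingMap_sum_apply {I : Type*} (s : Finset I) {p : ℕ} (f : I → M [⋀^Fin p]→ₗ[A] N)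
    (v : Fin p → M) : (∑ i ∈ s, f i) v = ∑ i ∈ s, f i v :=
  map_sum (AddMonoidHom.mk' (fun g : M [⋀^Fin p]→ₗ[A] N => g v) fun _ _ => rfl) f s

variable (A M) in
/-- A finite dual basis of the `A`-module `M`. -/
structure DualBasis (n : ℕ) where
  vec : Fin n → M
  form : Fin n → Module.Dual A M
  sum_smul (ξ : M) : ∑ i, form i ξ • vec i = ξ

/-- A section `g` of a surjection `f` from `A^n` provides the coordinate forms, and `f` provides the
vectors. These vectors need not be linearly independent. -/
theorem exists_dualBasis [Module.Finite A M] [Module.Projective A M] :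
    ∃ n, Nonempty (DualBasis A M n) := by
  obtain ⟨n, f, g, -, -, h⟩ := Module.Finite.exists_comp_eq_id_of_projective A M
  refine ⟨n, ⟨⟨fun i => f (Pi.single i 1), fun i => (LinearMap.proj i).comp g, fun ξ => ?_⟩⟩⟩
  have e := DFunLike.congr_fun h ξ
  rw [LinearMap.comp_apply, LinearMap.id_apply, pi_eq_sum_univ' (g ξ), map_sum] at e
  conv_rhs => rw [← e]
  refine Finset.sum_congr rfl fun i _ => ?_
  rw [map_smul]
  rfl

/-- The dual basis of the dual module. -/
def DualBasis.dual {n : ℕ} (b : DualBasis A M n) : DualBasis A (Module.Dual A M) n where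
  vec := b.form
  form i := Module.Dual.eval A M (b.vec i)
  sum_smul φ := LinearMap.ext fun ξ => by
    conv_rhs => rw [← b.sum_smul ξ]
    simp [mul_comm]

/-- The increasing sequence of the elements of a finite set of indices. -/
abbrev incr {n p : ℕ} (s : Set.powersetCard (Fin n) p) : Fin p → Fin n :=
  Set.powersetCard.ofFinEmbEquiv.symm s

/-- Expansion of an alternating form along a dual basis. -/
theorem DualBasis.expand {n : ℕ} (b : DualBasis A M n) {p : ℕ} (f : M [⋀^Fin p]→ₗ[A] N)
    (v : Fin p → M) :
    f v = ∑ s : Set.powersetCard (Fin n) p,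
      (Matrix.of fun j i => b.form (incr s i) (v j)).det • f (fun i => b.vec (incr s i)) := by
  -- The vectors are lifted along `π` to the free module `A^n` by their coordinates `c`, and there
  -- the form is expanded in the basis of the exterior power.
  let π : (Fin n → A) →ₗ[A] M := Fintype.linearCombination A b.vec
  let F := exteriorPower.alternatingMapLinearEquiv (f.compLinearMap π)
  let c : Fin p → Fin n → A := fun j i => b.form i (v j)
  let B := (Pi.basisFun A (Fin n)).exteriorPower p
  have h : F (exteriorPower.ιMulti A p c) = f v := by
    rw [exteriorPower.alternatingMapLinearEquiv_apply_ιMulti, AlternatingMap.compLinearMap_apply]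
    congr 1
    ext j
    exact b.sum_smul (v j)
  rw [← h, ← B.sum_repr (exteriorPower.ιMulti A p c), map_sum]
  refine Finset.sum_congr rfl fun s _ => ?_
  rw [map_smul, exteriorPower.basis_repr_apply, exteriorPower.ιMultiDual_apply_ιMulti,
    exteriorPower.basis_apply, exteriorPower.ιMulti_family,
    exteriorPower.alternatingMapLinearEquiv_apply_ιMulti, AlternatingMap.compLinearMap_apply]
  congr 2
  ext i
  simp [π, incr]

end Expansion

/-! ### Alternating forms obtained by iterated contraction. -/

section FormOf

variable {A M S N : Type*} [CommRing A] [AddCommGroup M] [Module A M] [AddCommGroup S] [Module A S]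
  [AddCommGroup N] [Module A N] (e : S →ₗ[A] Module.Dual A M) (ε : ExteriorAlgebra A S →ₗ[A] N)

/-- The contractions with the elements of `M`, as a representation of `Λ_A M`. -/
def contrRep : ExteriorAlgebra A M →ₐ[A] (Module.End A (ExteriorAlgebra A S))ᵐᵒᵖ :=
  -- In the opposite algebra a product acts with its first factor first, which puts the contractions
  -- in the order `i(ξ_p) ... i(ξ_1)`.
  ExteriorAlgebra.lift A ⟨(MulOpposite.opLinearEquiv A).toLinearMap ∘ₗ
    (CliffordAlgebra.contractLeft (Q := (0 : QuadraticForm A S))) ∘ₗ e.flip, fun ξ => by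
      change MulOpposite.op _ * MulOpposite.op _ = _
      rw [← MulOpposite.op_mul, ← MulOpposite.op_zero]
      congr 1
      exact LinearMap.ext fun u => contr_self (e.flip ξ) u⟩

/-- The alternating forms `(ξ_1, ..., ξ_p) ↦ ε(i(ξ_p) ... i(ξ_1) u)` on `M` defined by an element `u`
of `Λ_A S`, where `e` is a pairing between `S` and `M`. -/
def formOf (p : ℕ) : ExteriorAlgebra A S →ₗ[A] M [⋀^Fin p]→ₗ[A] N where
  toFun u := (ε ∘ₗ LinearMap.applyₗ u ∘ₗ (MulOpposite.opLinearEquiv A).symm.toLinearMap ∘ₗ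
    (contrRep e).toLinearMap).compAlternatingMap (ExteriorAlgebra.ιMulti A p)
  map_add' u v := by ext ξ; simp
  map_smul' a u := by ext ξ; simp

theorem formOf_zero (u : ExteriorAlgebra A S) (v : Fin 0 → M) : formOf e ε 0 u v = ε u := by
  simp [formOf]

/-- With `formOf_zero` and linearity, this recursion replaces the definition from here on: the first
argument is contracted first. -/
theorem formOf_cons (p : ℕ) (u : ExteriorAlgebra A S) (ξ : M) (v : Fin p → M) :
    formOf e ε (p + 1) u (Fin.cons ξ v) = formOf e ε p (contr (e.flip ξ) u) v := by
  simp only [formOf, LinearMap.coe_mk, AddHom.coe_mk, LinearMap.compAlternatingMap_apply,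
    ExteriorAlgebra.ιMulti_succ_apply, LinearMap.comp_apply]
  change ε (((contrRep e) (ExteriorAlgebra.ι A ξ * ExteriorAlgebra.ιMulti A p v)).unop u) = _
  rw [map_mul, MulOpposite.unop_mul]
  change ε (((contrRep e) (ExteriorAlgebra.ιMulti A p v)).unop
    (((contrRep e) (ExteriorAlgebra.ι A ξ)).unop u)) = _
  rw [contrRep, ExteriorAlgebra.lift_ι_apply]
  rfl

theorem removeNth_succ_cons {p : ℕ} (ξ : M) (v : Fin (p + 1) → M) (j : Fin (p + 1)) :
    j.succ.removeNth (Fin.cons ξ v : Fin (p + 2) → M) = Fin.cons ξ (j.removeNth v) := by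
  ext i
  refine Fin.cases ?_ (fun i => ?_) i
  · simp [Fin.removeNth]
  · simp [Fin.removeNth]

/-- A Laplace expansion: each argument in turn is contracted with `x`, the sign counting the
contractions that have passed it. The term in which `x` survives all contractions is killed by `ε`.
-/
theorem formOf_ι_mul {x : S} (hx : ∀ w, ε (ExteriorAlgebra.ι A x * w) = 0) (p : ℕ)
    (u : ExteriorAlgebra A S) (v : Fin (p + 1) → M) :
    formOf e ε (p + 1) (ExteriorAlgebra.ι A x * u) v =
      ∑ j : Fin (p + 1), (-1 : A) ^ (j : ℕ) • e x (v j) • formOf e ε p u (j.removeNth v) := by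
  induction p generalizing u with
  | zero =>
    obtain ⟨ξ, w, rfl⟩ : ∃ ξ w, v = Fin.cons ξ w := ⟨v 0, Fin.tail v, (Fin.cons_self_tail v).symm⟩
    rw [formOf_cons, formOf_zero, contr_ι_mul, map_sub, map_smul, hx]
    simp [formOf_zero]
  | succ p ih =>
    obtain ⟨ξ, w, rfl⟩ : ∃ ξ w, v = Fin.cons ξ w := ⟨v 0, Fin.tail v, (Fin.cons_self_tail v).symm⟩
    rw [formOf_cons, contr_ι_mul, map_sub, AlternatingMap.sub_apply, map_smul,
      AlternatingMap.smul_apply, ih, Fin.sum_univ_succ (n := p + 1), sub_eq_add_neg,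
      ← Finset.sum_neg_distrib]
    congr 1
    · simp
    · refine Finset.sum_congr rfl fun j _ => ?_
      rw [removeNth_succ_cons, formOf_cons]
      simp [pow_succ]

theorem formOf_ιMulti_mul_self {p : ℕ} (x : Fin p → S)
    (hx : ∀ i w, ε (ExteriorAlgebra.ι A (x i) * w) = 0) (u : ExteriorAlgebra A S) (v : Fin p → M) :
    formOf e ε p (ExteriorAlgebra.ιMulti A p x * u) v =
      (Matrix.of fun j i => e (x i) (v j)).det • ε u := by
  induction p with
  | zero => simp [formOf_zero]
  | succ p ih =>
    rw [ExteriorAlgebra.ιMulti_succ_apply, mul_assoc, formOf_ι_mul e ε (hx 0),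
      Matrix.det_succ_column_zero, Finset.sum_smul]
    refine Finset.sum_congr rfl fun j _ => ?_
    rw [ih (Matrix.vecTail x) (fun i w => hx i.succ w), smul_smul, smul_smul]
    rfl

/-- With too few contractions some `x i` survives and is killed by `ε`; with too many, one of them
reaches `u` and is zero by `hu`. -/
theorem formOf_ιMulti_mul_of_ne {p k : ℕ} (hpk : p ≠ k) (x : Fin k → S)
    (hx : ∀ i w, ε (ExteriorAlgebra.ι A (x i) * w) = 0) (u : ExteriorAlgebra A S)
    (hu : ∀ ξ, contr (e.flip ξ) u = 0) :
    formOf e ε p (ExteriorAlgebra.ιMulti A k x * u) = 0 := by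
  ext v
  induction k generalizing p with
  | zero =>
    obtain ⟨p, rfl⟩ := Nat.exists_eq_succ_of_ne_zero hpk
    obtain ⟨ξ, w, rfl⟩ : ∃ ξ w, v = Fin.cons ξ w := ⟨v 0, Fin.tail v, (Fin.cons_self_tail v).symm⟩
    rw [ExteriorAlgebra.ιMulti_zero_apply, one_mul, formOf_cons, hu, map_zero]
    rfl
  | succ k ih =>
    rw [ExteriorAlgebra.ιMulti_succ_apply, mul_assoc]
    cases p with
    | zero => rw [formOf_zero, hx]; rfl
    | succ p =>
      rw [formOf_ι_mul e ε (hx 0)]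
      refine Finset.sum_eq_zero fun j _ => ?_
      rw [ih (p := p) (fun h => hpk (by rw [h])) (Matrix.vecTail x) (fun i w => hx i.succ w)]
      simp

end FormOf

/-! ### Identification of an exterior algebra with a space of alternating forms. -/

section Model

variable {A M S N : Type*} [CommRing A] [AddCommGroup M] [Module A M] [AddCommGroup S] [Module A S]
  [AddCommGroup N] [Module A N] (e : S →ₗ[A] Module.Dual A M) (ε : ExteriorAlgebra A S →ₗ[A] N)

/-- Data that identify `Λ_A S` with `Alt_A(M, N)`. -/
structure FormModel where
  lift : Module.Dual A M →ₗ[A] S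
  incl : N →ₗ[A] ExteriorAlgebra A S
  e_lift (φ : Module.Dual A M) : e (lift φ) = φ
  ε_incl (n : N) : ε (incl n) = n
  ε_lift_mul (φ : Module.Dual A M) (w : ExteriorAlgebra A S) :
    ε (ExteriorAlgebra.ι A (lift φ) * w) = 0
  contr_incl (ξ : M) (n : N) : contr (e.flip ξ) (incl n) = 0
  span (u : ExteriorAlgebra A S) : u ∈ AddSubgroup.closure
    {u | ∃ (k : ℕ) (φ : Fin k → Module.Dual A M) (n : N),
      u = ExteriorAlgebra.ιMulti A k (fun i => lift (φ i)) * incl n}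

namespace FormModel

variable {e ε} (T : FormModel e ε) {n : ℕ} (b : DualBasis A M n)

/-- The element of `Λ_A S` that corresponds to an alternating form. -/
def ofForm (p : ℕ) : (M [⋀^Fin p]→ₗ[A] N) →ₗ[A] ExteriorAlgebra A S where
  toFun f := ∑ s : Set.powersetCard (Fin n) p,
    ExteriorAlgebra.ιMulti A p (fun i => T.lift (b.form (incr s i))) *
      T.incl (f fun i => b.vec (incr s i))
  map_add' f g := by simp [mul_add, Finset.sum_add_distrib]
  map_smul' a f := by simp [Finset.smul_sum]

theorem ofForm_apply (p : ℕ) (f : M [⋀^Fin p]→ₗ[A] N) : T.ofForm b p f =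
    ∑ s : Set.powersetCard (Fin n) p,
      ExteriorAlgebra.ιMulti A p (fun i => T.lift (b.form (incr s i))) *
        T.incl (f fun i => b.vec (incr s i)) := rfl

theorem formOf_gen_self {p : ℕ} (φ : Fin p → Module.Dual A M) (n : N) (v : Fin p → M) :
    formOf e ε p (ExteriorAlgebra.ιMulti A p (fun i => T.lift (φ i)) * T.incl n) v =
      (Matrix.of fun j i => φ i (v j)).det • n := by
  rw [formOf_ιMulti_mul_self e ε _ (fun i w => T.ε_lift_mul (φ i) w), T.ε_incl]
  simp only [T.e_lift]

theorem formOf_gen_of_ne {p k : ℕ} (h : p ≠ k) (φ : Fin k → Module.Dual A M) (n : N) :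
    formOf e ε p (ExteriorAlgebra.ιMulti A k (fun i => T.lift (φ i)) * T.incl n) = 0 :=
  formOf_ιMulti_mul_of_ne e ε h _ (fun i w => T.ε_lift_mul (φ i) w) _ fun ξ => T.contr_incl ξ n

theorem formOf_ofForm_self {p : ℕ} (f : M [⋀^Fin p]→ₗ[A] N) :
    formOf e ε p (T.ofForm b p f) = f := by
  ext v
  rw [b.expand f v, ofForm_apply, map_sum, alternatingMap_sum_apply]
  exact Finset.sum_congr rfl fun s _ => T.formOf_gen_self _ _ v

theorem formOf_ofForm_of_ne {p k : ℕ} (h : p ≠ k) (f : M [⋀^Fin k]→ₗ[A] N) :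
    formOf e ε p (T.ofForm b k f) = 0 := by
  rw [ofForm_apply, map_sum]
  exact Finset.sum_eq_zero fun s _ => T.formOf_gen_of_ne h _ _

/-- The right-hand side is alternating in `φ`, hence can be expanded along the dual basis of the
dual module. The coefficients are the determinants that occur on the left, up to transposition. -/
theorem ofForm_formOf_gen {k : ℕ} (φ : Fin k → Module.Dual A M) (n : N) :
    T.ofForm b k (formOf e ε k (ExteriorAlgebra.ιMulti A k (fun i => T.lift (φ i)) * T.incl n)) =
      ExteriorAlgebra.ιMulti A k (fun i => T.lift (φ i)) * T.incl n := by
  let G : Module.Dual A M [⋀^Fin k]→ₗ[A] ExteriorAlgebra A S :=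
    ((LinearMap.mulRight A (T.incl n)).compAlternatingMap
      (ExteriorAlgebra.ιMulti A k)).compLinearMap T.lift
  have h := b.dual.expand G φ
  change _ = G φ
  rw [h, ofForm_apply]
  refine Finset.sum_congr rfl fun s _ => ?_
  rw [T.formOf_gen_self, map_smul, mul_smul_comm, ← Matrix.det_transpose]
  rfl

/-- Each spanning product has a single nonzero component. Asking for all sufficiently long
truncations, and not for one of a given length, makes the property stable under sums. -/
theorem eventually_eq_sum (u : ExteriorAlgebra A S) :
    ∃ K, ∀ K', K ≤ K' → ∑ p ∈ Finset.range K', T.ofForm b p (formOf e ε p u) = u := by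
  induction T.span u using AddSubgroup.closure_induction with
  | zero => exact ⟨0, fun _ _ => by simp⟩
  | add u v _ _ hu hv =>
    obtain ⟨K, hK⟩ := hu
    obtain ⟨J, hJ⟩ := hv
    exact ⟨max K J, fun K' h => by
      simp only [map_add, Finset.sum_add_distrib, hK K' (le_of_max_le_left h),
        hJ K' (le_of_max_le_right h)]⟩
  | neg u _ hu =>
    obtain ⟨K, hK⟩ := hu
    exact ⟨K, fun K' h => by simp only [map_neg, Finset.sum_neg_distrib, hK K' h]⟩
  | mem u hu =>
    obtain ⟨k, φ, n, rfl⟩ := hu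
    refine ⟨k + 1, fun K' h => ?_⟩
    rw [Finset.sum_eq_single_of_mem k (Finset.mem_range.mpr (by omega)), T.ofForm_formOf_gen]
    intro p _ hp
    rw [T.formOf_gen_of_ne hp, map_zero]

include T b in
theorem ext {u v : ExteriorAlgebra A S} (h : ∀ p, formOf e ε p u = formOf e ε p v) : u = v := by
  obtain ⟨K, hK⟩ := T.eventually_eq_sum b u
  obtain ⟨J, hJ⟩ := T.eventually_eq_sum b v
  rw [← hK (max K J) (le_max_left _ _), ← hJ (max K J) (le_max_right _ _)]
  simp only [h]

include T b in
/-- An element of `Λ_A S` vanishes if its contractions and its component in `N` vanish. -/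
theorem eq_of_contr {u v : ExteriorAlgebra A S} (h0 : ε u = ε v)
    (h : ∀ ξ, contr (e.flip ξ) u = contr (e.flip ξ) v) : u = v := by
  refine T.ext b fun p => ?_
  ext w
  cases p with
  | zero => rw [formOf_zero, formOf_zero, h0]
  | succ p =>
    obtain ⟨ξ, w, rfl⟩ : ∃ ξ w', w = Fin.cons ξ w' := ⟨w 0, Fin.tail w, (Fin.cons_self_tail w).symm⟩
    rw [formOf_cons, formOf_cons, h]

variable (R : Type*) [CommRing R] [Algebra R A] [Module R N] [IsScalarTower R A N]
  [Module R S] [IsScalarTower R A S]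

/-- The map `Alt_A(M, N) → Λ_A S`. -/
def total : (⨁ p : ℕ, (M [⋀^Fin p]→ₗ[A] N)) →ₗ[R] ExteriorAlgebra A S :=
  DirectSum.toModule R ℕ _ fun p =>
    { toFun := T.ofForm b p
      map_add' := map_add _
      map_smul' := fun r f => by
        have h : r • f = algebraMap R A r • f := by
          ext ξ
          rw [AlternatingMap.smul_apply, AlternatingMap.smul_apply, algebraMap_smul]
        rw [h, map_smul, algebraMap_smul, RingHom.id_apply] }

theorem total_of (p : ℕ) (f : M [⋀^Fin p]→ₗ[A] N) :
    T.total b R (DirectSum.of (fun p => M [⋀^Fin p]→ₗ[A] N) p f) = T.ofForm b p f := by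
  rw [total, ← DirectSum.lof_eq_of R, DirectSum.toModule_lof]
  rfl

theorem formOf_total (F : ⨁ p : ℕ, (M [⋀^Fin p]→ₗ[A] N)) (p : ℕ) :
    formOf e ε p (T.total b R F) = F p := by
  induction F using DirectSum.induction_on with
  | zero => rw [map_zero, map_zero]; rfl
  | add F G hF hG => rw [map_add, map_add, hF, hG]; rfl
  | of k f =>
    rw [T.total_of]
    by_cases h : p = k
    · subst h
      rw [T.formOf_ofForm_self, DirectSum.of_eq_same]
    · rw [T.formOf_ofForm_of_ne b h, DirectSum.of_eq_of_ne _ _ _ h]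

theorem total_bijective : Function.Bijective (T.total b R) := by
  refine ⟨fun F G h => ?_, fun u => ?_⟩
  · refine DFinsupp.ext fun p => ?_
    rw [← T.formOf_total b R F, ← T.formOf_total b R G, h]
  · obtain ⟨K, hK⟩ := T.eventually_eq_sum b u
    refine ⟨∑ p ∈ Finset.range K,
      DirectSum.of (fun p => M [⋀^Fin p]→ₗ[A] N) p (formOf e ε p u), ?_⟩
    rw [map_sum]
    simp only [T.total_of]
    exact hK K le_rfl

theorem total_eq_iff (F : ⨁ p : ℕ, (M [⋀^Fin p]→ₗ[A] N)) (u : ExteriorAlgebra A S) :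
    T.total b R F = u ↔ ∀ p, formOf e ε p u = F p :=
  ⟨fun h p => by rw [← h, T.formOf_total],
    fun h => T.ext b fun p => by rw [T.formOf_total, h]⟩

end FormModel

end Model

/-! ### Cartan calculus: Lie derivatives and differentials as operators on exterior algebras. -/

section Cartan

variable {R A M N : Type*} [CommRing R] [CommRing A] [Algebra R A]
  [LieRing M] [Module A M] [LieRingModule M A] [LieRinehartRing A M]
  [AddCommGroup N] [Module A N] [Module R N] [IsScalarTower R A N]

theorem eq_cons {T : Type*} {p : ℕ} (v : Fin (p + 1) → T) : ∃ ξ w, v = Fin.cons ξ w :=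
  ⟨v 0, Fin.tail v, (Fin.cons_self_tail v).symm⟩

theorem ceDiff_apply (D : Connection R A M N) {p : ℕ} (f : M [⋀^Fin p]→ₗ[A] N)
    (v : Fin (p + 1) → M) : ceDiff D p f v = ceFun D f v := rfl

theorem ceFun_zero (D : Connection R A M N) (f : M [⋀^Fin 0]→ₗ[A] N) (ξ : M) (v : Fin 0 → M) :
    ceFun D f (Fin.cons ξ v) = D.toFun ξ (f v) := by
  simp only [ceFun, Fin.sum_univ_succ, Fin.sum_univ_zero]
  simp [Fin.removeNth_zero]

/-- Cartan's formula `i(ξ) d = L(ξ) - d i(ξ)`. -/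
theorem ceFun_cons (D : Connection R A M N) {p : ℕ} (f : M [⋀^Fin (p + 1)]→ₗ[A] N) (ξ : M)
    (v : Fin (p + 1) → M) :
    ceFun D f (Fin.cons ξ v) = D.toFun ξ (f v) - ∑ k, f (Function.update v k ⁅ξ, v k⁆) -
      ceFun D (f.curryLeft ξ) v := by
  -- The bracket terms that involve `ξ` form the sum in the Lie derivative. All terms with `ξ` kept
  -- as an argument reassemble into the differential of `f.curryLeft ξ`, with a minus sign caused by
  -- the shift of indices (`h2`, `h3`).
  have h1 : ∀ j : Fin (p + 1), ceTerm f (Fin.cons ξ v) 0 j.succ =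
      -f (Function.update v j ⁅ξ, v j⁆) := by
    intro j
    rw [ceTerm_symm _ _ _ _ (Fin.succ_ne_zero j).symm, ceTerm, Fin.cons_succ, Fin.cons_zero,
      ← Fin.cons_update, Fin.removeNth_zero, Fin.tail_cons, ← lie_skew, f.map_update_neg]
    simp
  have h2 : ∀ i j : Fin (p + 1), ceTerm f (Fin.cons ξ v) i.succ j.succ =
      -ceTerm (f.curryLeft ξ) v i j := by
    intro i j
    rw [ceTerm, Fin.cons_succ, Fin.cons_succ, ← Fin.cons_update, removeNth_succ_cons, ceTerm,
      AlternatingMap.curryLeft_apply_apply, Fin.val_succ, pow_succ]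
    simp [Matrix.vecCons]
  have h3 : ∀ i : Fin (p + 1), (-1 : ℤ) ^ (i.succ : ℕ) •
      D.toFun (v i) (f (i.succ.removeNth (Fin.cons ξ v : Fin (p + 2) → M))) =
      -((-1 : ℤ) ^ (i : ℕ) • D.toFun (v i) (f.curryLeft ξ (i.removeNth v))) := by
    intro i
    rw [removeNth_succ_cons, AlternatingMap.curryLeft_apply_apply, Fin.val_succ, pow_succ]
    simp [Matrix.vecCons]
  rw [ceFun, ceFun, Fin.sum_univ_succ, Fin.sum_univ_succ (n := p + 1)]
  simp only [Fin.cons_succ, h3]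
  rw [Fin.sum_univ_succ (n := p + 1)]
  simp only [Fin.sum_univ_succ (n := p + 1) (fun j => ite _ _ _), Fin.succ_lt_succ_iff, h1, h2,
    Fin.not_lt_zero, lt_self_iff_false, if_false, Fin.succ_pos, if_true, zero_add]
  have h4 : ∀ i j : Fin (p + 1), (if i < j then -ceTerm (f.curryLeft ξ) v i j else 0) =
      -(if i < j then ceTerm (f.curryLeft ξ) v i j else 0) := by
    intro i j; split_ifs <;> simp
  simp only [h4, Finset.sum_neg_distrib, Fin.cons_zero, Fin.removeNth_zero, Fin.tail_cons,
    Fin.val_zero, pow_zero, one_smul]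
  abel

variable {S : Type*} [AddCommGroup S] [Module A S] (e : S →ₗ[A] Module.Dual A M)
  (ε : ExteriorAlgebra A S →ₗ[A] N)

/-- By `ModuleDer.contr_ext`, moving a contraction with `η` past `ℓ.ext` costs a contraction with `s
η`. Doing this for all the arguments gives the sum. -/
theorem formOf_lie {D : N → N} {ℓ : ModuleDer A S} {s : M → M}
    (hop : ∀ x η, e (ℓ.op x) η = ℓ.base (e x η) - e x (s η))
    (hε : ∀ u, ε (ℓ.ext u) = D (ε u)) (p : ℕ) (u : ExteriorAlgebra A S) (v : Fin p → M) :
    formOf e ε p (ℓ.ext u) v =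
      D (formOf e ε p u v) - ∑ k, formOf e ε p u (Function.update v k (s (v k))) := by
  induction p generalizing u with
  | zero => simp [formOf_zero, hε]
  | succ p ih =>
    obtain ⟨η, w, rfl⟩ := eq_cons v
    have h := ℓ.contr_ext (d := e.flip η) (d' := e.flip (s η)) (fun x => hop x η) u
    rw [formOf_cons, h, map_sub, AlternatingMap.sub_apply, ih, formOf_cons, Fin.sum_univ_succ]
    simp only [Fin.cons_zero, Fin.cons_succ, ← Fin.cons_update, Fin.update_cons_zero, formOf_cons]
    abel

/-- Hypothesis `hc` is Cartan's formula at the level of the exterior algebra, and `ceFun_cons` is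
the same recursion for forms. Induction on `p` therefore identifies the two. The statement keeps the
coefficients general because it serves both for `d_*`, with values in `A`, and for `d''`, with
values in `Λ_A L'`. -/
theorem formOf_ceDiff (D : Connection R A M N) {ℓ : M → ModuleDer A S}
    {δ : ExteriorAlgebra A S →+ ExteriorAlgebra A S}
    (hbase : ∀ ξ a, (ℓ ξ).base a = ⁅ξ, a⁆)
    (hop : ∀ ξ x η, e ((ℓ ξ).op x) η = ⁅ξ, e x η⁆ - e x ⁅ξ, η⁆)
    (hε : ∀ ξ u, ε ((ℓ ξ).ext u) = D.toFun ξ (ε u)) (hδ : ∀ u, ε (δ u) = 0)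
    (hc : ∀ ξ u, contr (e.flip ξ) (δ u) = (ℓ ξ).ext u - δ (contr (e.flip ξ) u))
    (p : ℕ) (u : ExteriorAlgebra A S) :
    formOf e ε (p + 1) (δ u) = ceDiff D p (formOf e ε p u) := by
  have hop' : ∀ ξ x η, e ((ℓ ξ).op x) η = (ℓ ξ).base (e x η) - e x ⁅ξ, η⁆ := fun ξ x η => by
    rw [hbase, hop]
  ext v
  obtain ⟨ξ, w, rfl⟩ := eq_cons v
  rw [formOf_cons, hc, map_sub, AlternatingMap.sub_apply, formOf_lie e ε (hop' _) (hε _),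
    ceDiff_apply]
  induction p generalizing u ξ with
  | zero => rw [ceFun_zero, formOf_zero _ _ (δ _), hδ]; simp
  | succ p ih =>
    obtain ⟨η, w, rfl⟩ := eq_cons w
    have hcurry : (formOf e ε (p + 1) u).curryLeft ξ = formOf e ε p (contr (e.flip ξ) u) := by
      ext v
      exact formOf_cons e ε p u ξ v
    rw [ceFun_cons, hcurry, formOf_cons e ε p (δ _), hc, map_sub, AlternatingMap.sub_apply,
      formOf_lie e ε (hop' _) (hε _), ih]

end Cartan

/-! ### The case of a perfect pairing: `Λ_A L` as `Alt_A(D, A)`. -/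

section PerfectPairing

variable {A L D : Type*} [CommRing A] [AddCommGroup L] [Module A L] [AddCommGroup D] [Module A D]
  (e : L →ₗ[A] D →ₗ[A] A)

/-- The augmentation `Λ_A L → A`. -/
abbrev augm (A L : Type*) [CommRing A] [AddCommGroup L] [Module A L] :
    ExteriorAlgebra A L →ₗ[A] A :=
  (ExteriorAlgebra.algebraMapInv : ExteriorAlgebra A L →ₐ[A] A).toLinearMap

theorem augm_algebraMap (a : A) : augm A L (algebraMap A _ a) = a :=
  ExteriorAlgebra.algebraMap_leftInverse L a

theorem augm_ι (x : L) : augm A L (ExteriorAlgebra.ι A x) = 0 := by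
  change ExteriorAlgebra.algebraMapInv (ExteriorAlgebra.ι A x) = 0
  rw [ExteriorAlgebra.algebraMapInv, ExteriorAlgebra.lift_ι_apply]; rfl

theorem augm_mul (u v : ExteriorAlgebra A L) : augm A L (u * v) = augm A L u * augm A L v :=
  map_mul (ExteriorAlgebra.algebraMapInv : ExteriorAlgebra A L →ₐ[A] A) u v

theorem augm_ι_mul (x : L) (u : ExteriorAlgebra A L) :
    augm A L (ExteriorAlgebra.ι A x * u) = 0 := by
  rw [augm_mul, augm_ι, zero_mul]

/-- On `x_1 ∧ ... ∧ x_k`, iterated contraction gives the determinant by Laplace expansion. The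
determinants in the definition of `d_*` are thereby replaced by contractions. -/
theorem toForm_eq_formOf (n : ℕ) : toForm e n = formOf e (augm A L) n := by
  refine ExteriorAlgebra.lhom_ext fun k => ?_
  ext1 x
  rw [LinearMap.compAlternatingMap_apply, LinearMap.compAlternatingMap_apply, toForm,
    ExteriorAlgebra.liftAlternating_apply_ιMulti, ← mul_one (ExteriorAlgebra.ιMulti A k x)]
  by_cases h : n = k
  · subst h
    ext v
    rw [Pi.single_eq_same, formOf_ιMulti_mul_self _ _ _ fun i w => augm_ι_mul (x i) w]
    have h1 : augm A L 1 = 1 := map_one ExteriorAlgebra.algebraMapInv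
    rw [h1, smul_eq_mul, mul_one]
    rfl
  · rw [formOf_ιMulti_mul_of_ne _ _ h _ (fun i w => augm_ι_mul (x i) w) _ fun ξ => by
      rw [← map_one (algebraMap A _), contr_algebraMap], Pi.single_eq_of_ne (Ne.symm h)]
    rfl

variable [e.IsPerfPair]

/-- The identification of `Λ_A L` with `Alt_A(D, A)` by a perfect pairing. -/
def perfectModel : FormModel e (augm A L) where
  lift := e.toPerfPair.symm.toLinearMap
  incl := Algebra.linearMap A (ExteriorAlgebra A L)
  e_lift φ := e.apply_symm_toPerfPair_self φ
  ε_incl a := augm_algebraMap a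
  ε_lift_mul φ w := augm_ι_mul _ w
  contr_incl ξ a := contr_algebraMap _ a
  span u := by
    have hu : u ∈ Submodule.span A (Set.range fun x : Σ n, (Fin n → L) =>
        ExteriorAlgebra.ιMulti A x.1 x.2) := by
      rw [ExteriorAlgebra.ιMulti_span]; exact Submodule.mem_top
    induction hu using Submodule.closure_induction with
    | zero => exact zero_mem _
    | add u v _ _ hu hv => exact add_mem hu hv
    | smul_mem a u hu =>
      obtain ⟨⟨k, x⟩, rfl⟩ := hu
      refine AddSubgroup.subset_closure ⟨k, fun i => e.toPerfPair (x i), a, ?_⟩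
      have h : (fun i => e.toPerfPair.symm (e.toPerfPair (x i))) = x :=
        funext fun i => e.toPerfPair.symm_apply_apply (x i)
      change a • ExteriorAlgebra.ιMulti A k x =
        ExteriorAlgebra.ιMulti A k (fun i => e.toPerfPair.symm (e.toPerfPair (x i))) *
          algebraMap A _ a
      rw [h, Algebra.smul_def, Algebra.commutes]

theorem formOf_one_ι (x : L) (v : Fin 1 → D) :
    formOf e (augm A L) 1 (ExteriorAlgebra.ι A x) v = e x (v 0) := by
  obtain ⟨ξ, w, rfl⟩ := eq_cons v
  rw [formOf_cons, formOf_zero, contr_ι, augm_algebraMap]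
  rfl

theorem formOf_ι_of_ne (x : L) {p : ℕ} (hp : p ≠ 1) :
    formOf e (augm A L) p (ExteriorAlgebra.ι A x) = 0 := by
  have h := formOf_ιMulti_mul_of_ne e (augm A L) hp (fun _ : Fin 1 => x)
    (fun i w => augm_ι_mul x w) 1 fun ξ => by rw [← map_one (algebraMap A _), contr_algebraMap]
  rwa [mul_one, ExteriorAlgebra.ιMulti_succ_apply, ExteriorAlgebra.ιMulti_zero_apply, mul_one] at h

theorem perfPair_ext {x y : L} (h : ∀ η, e x η = e y η) : x = y :=
  e.toPerfPair.injective (LinearMap.ext h)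

end PerfectPairing

/-! ### The dual differential `d_*` on `Λ_A L`. -/

section DualDifferential

variable {R A L D : Type*} [CommRing R] [CommRing A] [Algebra R A]
  [AddCommGroup L] [Module A L] [Module R L] [IsScalarTower R A L]
  [LieRing D] [Module A D] [LieRingModule D A] [LieRinehartRing A D] [LieAlgebra R D]
  [LieRinehartAlgebra R A D] (e : L →ₗ[A] D →ₗ[A] A) [e.IsPerfPair]

/-- The coadjoint action of `ξ ∈ D` on `L ≅ D^*`. -/
def coadjoint (ξ : D) : ModuleDer A L where
  base := AddMonoidHom.mk' (fun a => ⁅ξ, a⁆) (lie_add ξ)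
  op := AddMonoidHom.mk' (fun x => e.toPerfPair.symm
    { toFun := fun η => ⁅ξ, e x η⁆ - e x ⁅ξ, η⁆
      map_add' := fun η ζ => by simp only [map_add, lie_add]; abel
      map_smul' := fun a η => by
        simp only [map_smul, LieRinehartRing.leibniz_smul_right, smul_eq_mul, map_add,
          LieRinehartRing.leibniz_mul_right, RingHom.id_apply]
        ring }) fun x y => by
      rw [← map_add]
      congr 1
      ext η
      simp only [map_add, LinearMap.add_apply, lie_add, LinearMap.coe_mk, AddHom.coe_mk]
      abel
  base_mul a b := by
    change ⁅ξ, a * b⁆ = a * ⁅ξ, b⁆ + b * ⁅ξ, a⁆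
    rw [LieRinehartRing.leibniz_mul_right, smul_eq_mul, mul_comm b]
  op_smul a x := by
    simp only [AddMonoidHom.mk'_apply]
    rw [← map_smul, ← sub_eq_iff_eq_add', ← map_sub, LinearEquiv.symm_apply_eq]
    ext η
    simp only [map_smul, LinearMap.sub_apply, LinearMap.smul_apply, LinearMap.coe_mk,
      AddHom.coe_mk, LinearMap.toPerfPair_apply, smul_eq_mul, LieRinehartRing.leibniz_mul_right]
    ring

theorem coadjoint_base (ξ : D) (a : A) : (coadjoint e ξ).base a = ⁅ξ, a⁆ := rfl

theorem coadjoint_op (ξ : D) (x : L) (η : D) :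
    e ((coadjoint e ξ).op x) η = ⁅ξ, e x η⁆ - e x ⁅ξ, η⁆ := by
  simp [coadjoint]

/-- The differential of an element of `A`, as an element of `L ≅ D^*`. -/
def diffVec (a : A) : L := e.toPerfPair.symm (diff D a)

theorem e_diffVec (a : A) (ξ : D) : e (diffVec e a) ξ = ⁅ξ, a⁆ := by
  simp [diffVec, diff_apply]

theorem diffVec_add (a b : A) : diffVec e (a + b) = diffVec e a + diffVec e b := by
  rw [diffVec, diff_add, map_add]; rfl

theorem diffVec_mul (a b : A) : diffVec e (a * b) = a • diffVec e b + b • diffVec e a := by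
  rw [diffVec, diff_mul, map_add, map_smul, map_smul]; rfl

theorem diffVec_algebraMap (r : R) : diffVec e (algebraMap R A r) = 0 := by
  rw [diffVec, diff_algebraMap, map_zero]

theorem augm_coadjoint (ξ : D) (u : ExteriorAlgebra A L) :
    augm A L ((coadjoint e ξ).ext u) = ⁅ξ, augm A L u⁆ := by
  induction u using ExteriorAlgebra.induction with
  | algebraMap a => rw [ModuleDer.ext_algebraMap, augm_algebraMap, augm_algebraMap]; rfl
  | ι x => rw [ModuleDer.ext_ι, augm_ι, augm_ι, lie_zero]
  | mul u v hu hv =>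
    rw [ModuleDer.ext_mul, map_add, augm_mul, augm_mul, augm_mul, hu, hv,
      LieRinehartRing.leibniz_mul_right, smul_eq_mul, add_comm]
  | add u v hu hv => rw [map_add, map_add, map_add, lie_add, hu, hv]

variable (R) {n : ℕ} (b : DualBasis A D n)

/-- The value of the dual differential on a vector. -/
def dualVec : L →+ ExteriorAlgebra A L :=
  ((perfectModel e).ofForm b 2).toAddMonoidHom.comp <|
    (ceDiff (Connection.base R A D) 1).toAddMonoidHom.comp <|
      (formOf e (augm A L) 1).toAddMonoidHom.comp (ExteriorAlgebra.ι A : L →ₗ[A] _).toAddMonoidHom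

theorem dualVec_apply (x : L) : dualVec R e b x = (perfectModel e).ofForm b 2
    (ceDiff (Connection.base R A D) 1 (formOf e (augm A L) 1 (ExteriorAlgebra.ι A x))) := rfl

theorem augm_dualVec (x : L) : augm A L (dualVec R e b x) = 0 := by
  rw [← formOf_zero e (augm A L) _ (fun i => i.elim0), dualVec_apply,
    (perfectModel e).formOf_ofForm_of_ne b (by decide)]
  rfl

/-- Cartan's formula for the one-form `x`: the contraction of `d x` with `ξ` is the Lie derivative
of `x` minus the differential of the function `⟨x, ξ⟩`. -/
theorem contr_dualVec (x : L) (ξ : D) : contr (e.flip ξ) (dualVec R e b x) =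
    ExteriorAlgebra.ι A ((coadjoint e ξ).op x) - ExteriorAlgebra.ι A (diffVec e (e x ξ)) := by
  refine (perfectModel e).ext b fun p => ?_
  ext v
  rw [← formOf_cons, dualVec_apply, map_sub, AlternatingMap.sub_apply]
  by_cases hp : p = 1
  · subst hp
    rw [(perfectModel e).formOf_ofForm_self b, ceDiff_apply, ceFun_cons]
    obtain ⟨η, w, rfl⟩ := eq_cons v
    rw [ceFun_zero, formOf_one_ι, formOf_one_ι, formOf_one_ι, coadjoint_op, e_diffVec,
      AlternatingMap.curryLeft_apply_apply, formOf_one_ι]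
    simp [formOf_one_ι, Connection.base]
  · rw [(perfectModel e).formOf_ofForm_of_ne b (by omega), formOf_ι_of_ne e _ hp,
      formOf_ι_of_ne e _ hp, sub_self]
    rfl

theorem hasParity_dualVec (x : L) : HasParity 2 (dualVec R e b x) := by
  rw [dualVec_apply, FormModel.ofForm_apply]
  refine HasParity.sum _ _ fun s => ?_
  refine HasParity.mul (j := 2) (k := 0) (hasParity_of_mem ?_) (hasParity_algebraMap _)
  rw [← ExteriorAlgebra.ιMulti_span_fixedDegree]
  exact Submodule.subset_span ⟨_, rfl⟩

/-- Extension to a derivation needs `d(a x) = a d x + da ∧ x`. Both sides have augmentation zero,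
and their contractions agree by `contr_dualVec`, so `FormModel.eq_of_contr` applies. -/
theorem exists_dualDer : ∃ δ : ExteriorAlgebra A L →+ ExteriorAlgebra A L, IsGradedDer 1 δ ∧
    (∀ a, δ (algebraMap A _ a) = ExteriorAlgebra.ι A (diffVec e a)) ∧
    ∀ x, δ (ExteriorAlgebra.ι A x) = dualVec R e b x := by
  refine exists_isGradedDer 1
    (AddMonoidHom.mk' (fun a => ExteriorAlgebra.ι A (diffVec e a)) fun a b => by
      rw [diffVec_add, map_add]) (dualVec R e b) (fun a => hasParity_ι _)
    (hasParity_dualVec R e b) (fun a b => ?_) (fun a x => ?_)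
  · simp only [AddMonoidHom.mk'_apply, diffVec_mul, map_add, map_smul]
  · refine (perfectModel e).eq_of_contr b ?_ fun ξ => ?_
    · rw [augm_dualVec, map_add, (augm A L).map_smul, augm_dualVec, AddMonoidHom.mk'_apply,
        augm_ι_mul, smul_zero, add_zero]
    · simp only [map_add, contr_smul, contr_dualVec, AddMonoidHom.mk'_apply, contr_ι_mul, contr_ι,
        (coadjoint e ξ).op_smul, coadjoint_base, LinearMap.flip_apply, e_diffVec, map_smul,
        LinearMap.smul_apply, smul_eq_mul, diffVec_mul, smul_sub]
      rw [← Algebra.commutes, ← Algebra.smul_def]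
      abel

/-- The dual differential on `Λ_A L`. -/
def dualDer : ExteriorAlgebra A L →+ ExteriorAlgebra A L := (exists_dualDer R e b).choose

theorem isGradedDer_dualDer : IsGradedDer 1 (dualDer R e b) :=
  (exists_dualDer R e b).choose_spec.1

theorem dualDer_algebraMap (a : A) :
    dualDer R e b (algebraMap A _ a) = ExteriorAlgebra.ι A (diffVec e a) :=
  (exists_dualDer R e b).choose_spec.2.1 a

theorem dualDer_ι (x : L) : dualDer R e b (ExteriorAlgebra.ι A x) = dualVec R e b x :=
  (exists_dualDer R e b).choose_spec.2.2 x

/-- The graded commutator of two odd derivations is an even one, and so is the Lie derivative; on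
vectors the comparison is `contr_dualVec`. -/
theorem contr_dualDer (ξ : D) (u : ExteriorAlgebra A L) : contr (e.flip ξ) (dualDer R e b u) =
    (coadjoint e ξ).ext u - dualDer R e b (contr (e.flip ξ) u) := by
  have h := ((isGradedDer_contr (e.flip ξ)).commutator (isGradedDer_dualDer R e b)).ext_apply
    (coadjoint e ξ).isGradedDer_ext.add_two
    (fun a => by
      simp [dualDer_algebraMap, contr_algebraMap, contr_ι, ModuleDer.ext_algebraMap, e_diffVec,
        coadjoint_base])
    (fun x => by
      simp [dualDer_algebraMap, dualDer_ι, contr_dualVec, contr_ι, ModuleDer.ext_ι]) u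
  simp only [AddMonoidHom.add_apply, AddMonoidHom.comp_apply, mul_one, pow_one, neg_one_smul, sub_neg_eq_add] at h
  rw [← h, add_sub_cancel_right]

theorem augm_dualDer (u : ExteriorAlgebra A L) : augm A L (dualDer R e b u) = 0 := by
  induction u using ExteriorAlgebra.induction with
  | algebraMap a => rw [dualDer_algebraMap, augm_ι]
  | ι x => rw [dualDer_ι, augm_dualVec]
  | mul u v hu hv =>
    rw [(isGradedDer_dualDer R e b).map_mul, map_add, augm_mul, augm_mul, hu, hv, zero_mul,
      mul_zero, add_zero]
  | add u v hu hv => rw [map_add, map_add, hu, hv, add_zero]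

theorem dualDer_smul (r : R) (u : ExteriorAlgebra A L) :
    dualDer R e b (r • u) = r • dualDer R e b u := by
  rw [← algebraMap_smul A r u, Algebra.smul_def, (isGradedDer_dualDer R e b).map_mul,
    dualDer_algebraMap, diffVec_algebraMap, map_zero, zero_mul, zero_add, AlgHom.commutes,
    ← Algebra.smul_def, algebraMap_smul]

/-- The dual differential, as an `R`-linear map. -/
def dualDiff : ExteriorAlgebra A L →ₗ[R] ExteriorAlgebra A L where
  toFun := dualDer R e b
  map_add' := map_add _
  map_smul' := dualDer_smul R e b

theorem isDualDifferential_dualDiff : IsDualDifferential R A L D e (dualDiff R e b) := by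
  refine fun u => ⟨?_, fun p => ?_⟩
  · rw [toForm_eq_formOf]
    ext v
    rw [formOf_zero]
    exact augm_dualDer R e b u
  · rw [toForm_eq_formOf, toForm_eq_formOf]
    exact formOf_ceDiff e (augm A L) (Connection.base R A D) (coadjoint_base e)
      (coadjoint_op e) (augm_coadjoint e) (augm_dualDer R e b)
      (contr_dualDer R e b) p u

variable {R}

include b in
theorem IsDualDifferential.unique {δ δ' : ExteriorAlgebra A L →ₗ[R] ExteriorAlgebra A L}
    (h : IsDualDifferential R A L D e δ) (h' : IsDualDifferential R A L D e δ') : δ = δ' := by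
  ext u
  refine (perfectModel e).ext b fun p => ?_
  rw [← toForm_eq_formOf]
  cases p with
  | zero => rw [(h u).1, (h' u).1]
  | succ p => rw [(h u).2, (h' u).2]

theorem coadjoint_lie_op (ξ η : D) (x : L) : (coadjoint e ⁅ξ, η⁆).op x =
    (coadjoint e ξ).op ((coadjoint e η).op x) - (coadjoint e η).op ((coadjoint e ξ).op x) := by
  refine perfPair_ext e fun ζ => ?_
  simp only [map_sub, LinearMap.sub_apply, coadjoint_op, lie_sub, lie_lie]
  abel

theorem coadjoint_diffVec (ξ : D) (a : A) :
    (coadjoint e ξ).op (diffVec e a) = diffVec e ⁅ξ, a⁆ := by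
  refine perfPair_ext e fun ζ => ?_
  simp only [coadjoint_op, e_diffVec, lie_lie]
  abel

variable (R)

/-- The commutator of the two operators is an odd derivation, to be tested on generators. For
functions this is `coadjoint_diffVec`. For vectors both sides are compared after contraction, where
the representation property `coadjoint_lie_op` enters. -/
theorem dualDer_coadjoint (ξ : D) (u : ExteriorAlgebra A L) :
    dualDer R e b ((coadjoint e ξ).ext u) = (coadjoint e ξ).ext (dualDer R e b u) := by
  have h := ((isGradedDer_dualDer R e b).commutator (coadjoint e ξ).isGradedDer_ext).eq_zero
    (fun a => ?_) (fun x => ?_) u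
  · simpa [sub_eq_zero] using h
  · simp [dualDer_algebraMap, ModuleDer.ext_algebraMap, ModuleDer.ext_ι, coadjoint_base,
      coadjoint_diffVec]
  · simp only [AddMonoidHom.sub_apply, AddMonoidHom.comp_apply, mul_zero, pow_zero, one_smul, ModuleDer.ext_ι, sub_eq_zero]
    refine (perfectModel e).eq_of_contr b ?_ fun η => ?_
    · rw [augm_dualDer, augm_coadjoint, augm_dualDer, lie_zero]
    · rw [(coadjoint e ξ).contr_ext (d := e.flip η) (d' := e.flip ⁅ξ, η⁆)
        (fun x => by rw [coadjoint_base]; exact coadjoint_op e ξ x η)]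
      simp only [dualDer_ι, contr_dualVec, map_sub, ModuleDer.ext_ι, coadjoint_lie_op,
        coadjoint_diffVec, coadjoint_op]
      rw [show diffVec e (⁅ξ, e x η⁆ - e x ⁅ξ, η⁆) = diffVec e ⁅ξ, e x η⁆ - diffVec e (e x ⁅ξ, η⁆)
        from map_sub (AddMonoidHom.mk' (diffVec e) (diffVec_add e)) _ _]
      simp only [map_sub]
      abel

/-- By Cartan's formula and `dualDer_coadjoint` the square commutes with contractions, so it
vanishes on functions and then on vectors. As the square of an odd derivation it is itself a
derivation, hence zero. -/
theorem dualDer_dualDer (u : ExteriorAlgebra A L) : dualDer R e b (dualDer R e b u) = 0 := by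
  have key : ∀ (ξ : D) (u : ExteriorAlgebra A L), contr (e.flip ξ) (dualDer R e b
      (dualDer R e b u)) = dualDer R e b (dualDer R e b (contr (e.flip ξ) u)) := fun ξ u => by
    rw [contr_dualDer, contr_dualDer, map_sub, dualDer_coadjoint]
    abel
  have hd := (isGradedDer_dualDer R e b)
  have h0 : ∀ a, dualDer R e b (dualDer R e b (algebraMap A _ a)) = 0 := fun a =>
    (perfectModel e).eq_of_contr b (by rw [augm_dualDer, map_zero]) fun ξ => by
      rw [key, contr_algebraMap, map_zero, map_zero, map_zero]
  have h1 : ∀ x, dualDer R e b (dualDer R e b (ExteriorAlgebra.ι A x)) = 0 := fun x =>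
    (perfectModel e).eq_of_contr b (by rw [augm_dualDer, map_zero]) fun ξ => by
      rw [key, contr_ι, h0, map_zero]
  induction u using ExteriorAlgebra.induction with
  | algebraMap a => exact h0 a
  | ι x => exact h1 x
  | mul u v hu hv =>
    rw [hd.map_mul, map_add, hd.map_mul, hd.map_mul, hu, hv, hd.map_twist, twist_one_one]
    simp
  | add u v hu hv => rw [map_add, map_add, hu, hv, add_zero]

end DualDifferential

/-! ### When an odd derivation of `Λ_A L` is a derivation of the bracket. -/

section BracketDerivation

variable {A L : Type*} [CommRing A] [LieRing L] [Module A L] [LieRingModule L A]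
  [LieRinehartRing A L] {δ : ExteriorAlgebra A L →+ ExteriorAlgebra A L}

/-- `δ[u, v] - [δu, v] + (-1)^m [u, δv]`. -/
def defect (δ : ExteriorAlgebra A L →+ ExteriorAlgebra A L) (m : ℕ) (u v : ExteriorAlgebra A L) :
    ExteriorAlgebra A L :=
  δ (gerstHom A L u v) - gerstHom A L (δ u) v + (-1 : ℤ) ^ m • gerstHom A L u (δ v)

/-- Each of the three brackets is exchanged separately; `hδ` supplies the degrees, hence the signs,
for the two that contain `δ`. -/
theorem defect_skew (hδ : ∀ n u, u ∈ ⋀[A]^n L → δ u ∈ ⋀[A]^(n + 1) L) {m n : ℕ}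
    {u v : ExteriorAlgebra A L} (hu : u ∈ ⋀[A]^m L) (hv : v ∈ ⋀[A]^n L) :
    defect δ m u v = -((-1 : ℤ) ^ ((m + 1) * (n + 1)) • defect δ n v u) := by
  rw [defect, defect, gerstHom_skew hu hv, gerstHom_skew (hδ m u hu) hv,
    gerstHom_skew hu (hδ n v hv), map_neg, map_zsmul]
  simp only [smul_add, smul_sub, smul_neg, smul_smul]
  rcases neg_one_pow_eq_or ℤ m with h | h <;> rcases neg_one_pow_eq_or ℤ n with h' | h' <;>
    simp [pow_add, pow_mul, mul_add, add_mul, h, h'] <;> abel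

/-- As a function of `v` the defect is the graded commutator of `δ` and `[u, ·]` minus `[δ u, ·]`, a
graded derivation. -/
theorem defect_eq_zero_of_generators (h1 : IsGradedDer 1 δ)
    (hδ : ∀ n u, u ∈ ⋀[A]^n L → δ u ∈ ⋀[A]^(n + 1) L) {m : ℕ} {u : ExteriorAlgebra A L}
    (hu : u ∈ ⋀[A]^m L) (h : ∀ a, defect δ m u (algebraMap A _ a) = 0)
    (h' : ∀ y, defect δ m u (ExteriorAlgebra.ι A y) = 0) (v : ExteriorAlgebra A L) :
    defect δ m u v = 0 := by
  have hu' := isGradedDer_gerstHom hu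
  have hd := (h1.commutator hu').sub
    ((isGradedDer_gerstHom (hδ m u hu)).congr (j := 1 + (m + 1)) (by congr 1; omega))
  have e : ∀ w, (δ.comp (gerstHom A L u) - (-1 : ℤ) ^ (1 * (m + 1)) •
      (gerstHom A L u).comp δ - gerstHom A L (δ u)) w = defect δ m u w := fun w => by
    simp only [AddMonoidHom.sub_apply, AddMonoidHom.comp_apply, AddMonoidHom.smul_apply, defect]
    rw [one_mul, pow_succ, mul_neg, mul_one, neg_smul]
    abel
  rw [← e]
  exact hd.eq_zero (fun a => by rw [e, h]) (fun y => by rw [e, h']) v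

/-- An odd derivation of `Λ_A L` is a derivation of the Gerstenhaber bracket as soon as it is so on
generators. -/
theorem defect_eq_zero (h1 : IsGradedDer 1 δ)
    (hδ : ∀ n u, u ∈ ⋀[A]^n L → δ u ∈ ⋀[A]^(n + 1) L)
    (h00 : ∀ a b : A, defect δ 0 (algebraMap A (ExteriorAlgebra A L) a) (algebraMap A _ b) = 0)
    (h10 : ∀ (x : L) (a : A), defect δ 1 (ExteriorAlgebra.ι A x) (algebraMap A _ a) = 0)
    (h11 : ∀ x y : L, defect δ 1 (ExteriorAlgebra.ι A x) (ExteriorAlgebra.ι A y) = 0)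
    {m : ℕ} {u : ExteriorAlgebra A L} (hu : u ∈ ⋀[A]^m L) (v : ExteriorAlgebra A L) :
    defect δ m u v = 0 := by
  have ha := fun a : A => algebraMap_mem_exteriorPower (M := L) a
  have hx := fun x : L => ι_mem_exteriorPower (A := A) x
  refine defect_eq_zero_of_generators h1 hδ hu (fun a => ?_) (fun x => ?_) v
  -- A generator in the second slot is exchanged into the first, and then the other slot is reduced
  -- to generators as well.
  · rw [defect_skew hδ hu (ha a), defect_eq_zero_of_generators h1 hδ (ha a) (h00 a) (fun x => ?_),
      smul_zero, neg_zero]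
    rw [defect_skew hδ (ha a) (hx x), h10, smul_zero, neg_zero]
  · rw [defect_skew hδ hu (hx x), defect_eq_zero_of_generators h1 hδ (hx x) (h10 x) (h11 x),
      smul_zero, neg_zero]

end BracketDerivation

/-! ### The defect of `d_*` on generators, in terms of the pairing. -/

section DualDifferential

variable {R A L D : Type*} [CommRing R] [CommRing A] [Algebra R A]
  [LieRing L] [Module A L] [LieRingModule L A] [LieRinehartRing A L] [LieAlgebra R L]
  [LieRinehartAlgebra R A L]
  [LieRing D] [Module A D] [LieRingModule D A] [LieRinehartRing A D] [LieAlgebra R D]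
  [LieRinehartAlgebra R A D] (e : L →ₗ[A] D →ₗ[A] A) [e.IsPerfPair]
variable (R) {n : ℕ} (b : DualBasis A D n)

theorem dualVec_mem (x : L) : dualVec R e b x ∈ ⋀[A]^2 L := by
  rw [dualVec_apply, FormModel.ofForm_apply]
  refine sum_mem fun s _ => ?_
  refine mul_mem_exteriorPower (m := 2) (n := 0) ?_ (algebraMap_mem_exteriorPower _)
  rw [← ExteriorAlgebra.ιMulti_span_fixedDegree]
  exact Submodule.subset_span ⟨_, rfl⟩

theorem dualDer_mem {m : ℕ} {u : ExteriorAlgebra A L} (hu : u ∈ ⋀[A]^m L) :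
    dualDer R e b u ∈ ⋀[A]^(m + 1) L := by
  induction hu using exteriorPower_induction with
  | algebraMap a => rw [dualDer_algebraMap]; exact ι_mem_exteriorPower _
  | add n u v _ _ hu hv => rw [map_add]; exact add_mem hu hv
  | ι_mul n x u hm hu =>
    rw [(isGradedDer_dualDer R e b).map_mul, dualDer_ι, (hasParity_ι x).twist, smul_mul_assoc]
    refine add_mem ?_ (zsmul_mem (ι_mul_mem_exteriorPower _ hu) _)
    have h := mul_mem_exteriorPower (dualVec_mem R e b x) hm
    rwa [show 2 + n = n + 1 + 1 by omega] at h

theorem defect_dualDer_algebraMap (a a' : A) :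
    defect (dualDer R e b) 0 (algebraMap A (ExteriorAlgebra A L) a) (algebraMap A _ a') =
      -algebraMap A _ (⁅(diffVec e a : L), a'⁆ + ⁅(diffVec e a' : L), a⁆) := by
  rw [defect, dualDer_algebraMap, dualDer_algebraMap, ι_gerstHom, algebraMap_gerstHom,
    algebraMap_gerstHom, contr_algebraMap, contr_ι, ModuleDer.ext_algebraMap, adjoint_base,
    diff_apply, map_add]
  simp
  abel

/-- This defect has degree one, so a single contraction with an arbitrary `ζ` detects it; the
right-hand side is that contraction. -/
theorem defect_dualDer_ι_algebraMap (x : L) (a : A) :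
    defect (dualDer R e b) 1 (ExteriorAlgebra.ι A x) (algebraMap A _ a) = 0 ↔
      ∀ ζ : D, ⁅ζ, ⁅x, a⁆⁆ - e ⁅x, diffVec e a⁆ ζ =
        ⁅(coadjoint e ζ).op x, a⁆ - ⁅(diffVec e (e x ζ) : L), a⁆ := by
  have key : ∀ ζ, contr (e.flip ζ) (defect (dualDer R e b) 1 (ExteriorAlgebra.ι A x)
      (algebraMap A _ a)) = algebraMap A _ (⁅ζ, ⁅x, a⁆⁆ - e ⁅x, diffVec e a⁆ ζ -
        (⁅(coadjoint e ζ).op x, a⁆ - ⁅(diffVec e (e x ζ) : L), a⁆)) := fun ζ => by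
    rw [defect, ι_gerstHom, ι_gerstHom, dualDer_ι, dualDer_algebraMap,
      gerstHom_algebraMap (dualVec_mem R e b x), ModuleDer.ext_algebraMap, dualDer_algebraMap,
      ModuleDer.ext_ι, map_add, map_sub, map_zsmul, map_zsmul, contr_contr, contr_dualVec,
      map_sub, contr_ι, contr_ι, contr_ι, contr_ι, diff_apply, diff_apply, adjoint_base,
      adjoint_op, LinearMap.flip_apply, LinearMap.flip_apply, e_diffVec]
    simp
    abel
  constructor
  · intro h ζ
    have hζ := key ζ
    rw [h, map_zero] at hζ
    have h0 := congrArg (augm A L) hζ.symm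
    rwa [augm_algebraMap, map_zero, sub_eq_zero] at h0
  · intro h
    refine (perfectModel e).eq_of_contr b ?_ fun ζ => ?_
    · rw [map_zero, defect, ι_gerstHom, ι_gerstHom, dualDer_ι, dualDer_algebraMap,
        gerstHom_algebraMap (dualVec_mem R e b x), ModuleDer.ext_algebraMap, dualDer_algebraMap,
        ModuleDer.ext_ι]
      -- The contracted element has degree one, and the augmentation vanishes in positive degree.
      have h2 : augm A L (contr (diff L a) (dualVec R e b x)) = 0 := by
        have := (contr_mem (diff L a) (dualVec_mem R e b x)).2 1 rfl
        have h3 : ∀ {n : ℕ} {w : ExteriorAlgebra A L}, w ∈ ⋀[A]^n L → n ≠ 0 → augm A L w = 0 := by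
          intro n w hw
          induction hw using exteriorPower_induction with
          | algebraMap a => intro h; exact absurd rfl h
          | add n u v _ _ hu hv => intro h; rw [map_add, hu h, hv h, add_zero]
          | ι_mul n x u hm hu => intro _; exact augm_ι_mul x u
        exact h3 this one_ne_zero
      rw [map_add, map_sub, map_zsmul, map_zsmul, h2, augm_ι, augm_ι]
      simp
    · rw [key, h, sub_self, map_zero, map_zero]

/-- The value of the dual differential of a vector on a pair of vectors. -/
def diffPairing (x : L) (ζ ω : D) : A := ⁅ζ, e x ω⁆ - ⁅ω, e x ζ⁆ - e x ⁅ζ, ω⁆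

theorem contr_contr_dualVec (x : L) (ζ ω : D) :
    contr (e.flip ω) (contr (e.flip ζ) (dualVec R e b x)) =
      algebraMap A _ (diffPairing e x ζ ω) := by
  rw [contr_dualVec, map_sub, contr_ι, contr_ι, LinearMap.flip_apply, LinearMap.flip_apply,
    coadjoint_op, e_diffVec, diffPairing, ← map_sub]
  congr 1
  abel

/-- The adjoint action on `L` is transposed to the coadjoint action of `L` on `D`. Here the roles of
`L` and `D` are exchanged, which is why the flipped pairing appears. -/
theorem contr_adjoint (y : L) (ζ : D) (u : ExteriorAlgebra A L) :
    contr (e.flip ζ) ((adjoint A y).ext u) = (adjoint A y).ext (contr (e.flip ζ) u) -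
      contr (e.flip ((coadjoint e.flip y).op ζ)) u := by
  refine (adjoint A y).contr_ext (fun m => ?_) u
  have h := coadjoint_op e.flip y ζ m
  simp only [LinearMap.flip_apply] at h ⊢
  rw [h, adjoint_base, adjoint_op]
  abel

theorem contr_contr_adjoint_dualVec (x y : L) (ζ ω : D) :
    contr (e.flip ω) (contr (e.flip ζ) ((adjoint A y).ext (dualVec R e b x))) =
      algebraMap A _ (⁅y, diffPairing e x ζ ω⁆ - diffPairing e x ζ ((coadjoint e.flip y).op ω) -
        diffPairing e x ((coadjoint e.flip y).op ζ) ω) := by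
  rw [contr_adjoint, map_sub, contr_adjoint, contr_contr_dualVec, contr_contr_dualVec,
    contr_contr_dualVec, ModuleDer.ext_algebraMap, adjoint_base, map_sub, map_sub]

theorem augm_adjoint (y : L) (u : ExteriorAlgebra A L) :
    augm A L ((adjoint A y).ext u) = ⁅y, augm A L u⁆ := by
  induction u using ExteriorAlgebra.induction with
  | algebraMap a => rw [ModuleDer.ext_algebraMap, augm_algebraMap, augm_algebraMap]; rfl
  | ι x => rw [ModuleDer.ext_ι, augm_ι, augm_ι, lie_zero]
  | mul u v hu hv =>
    rw [ModuleDer.ext_mul, map_add, augm_mul, augm_mul, augm_mul, hu, hv,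
      LieRinehartRing.leibniz_mul_right, smul_eq_mul, add_comm]
  | add u v hu hv => rw [map_add, map_add, map_add, lie_add, hu, hv]

/-- The defect is `d[x, y] + ad_y (d x) - ad_x (d y)`, so its vanishing is the cocycle condition for
`d`. It has degree two and is detected by two successive contractions. -/
theorem defect_dualDer_ι (x y : L) :
    defect (dualDer R e b) 1 (ExteriorAlgebra.ι A x) (ExteriorAlgebra.ι A y) = 0 ↔
      ∀ ζ ω : D, diffPairing e ⁅x, y⁆ ζ ω +
        (⁅y, diffPairing e x ζ ω⁆ - diffPairing e x ζ ((coadjoint e.flip y).op ω) -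
          diffPairing e x ((coadjoint e.flip y).op ζ) ω) -
        (⁅x, diffPairing e y ζ ω⁆ - diffPairing e y ζ ((coadjoint e.flip x).op ω) -
          diffPairing e y ((coadjoint e.flip x).op ζ) ω) = 0 := by
  have h0 : defect (dualDer R e b) 1 (ExteriorAlgebra.ι A x) (ExteriorAlgebra.ι A y) =
      dualVec R e b ⁅x, y⁆ + (adjoint A y).ext (dualVec R e b x) -
        (adjoint A x).ext (dualVec R e b y) := by
    rw [defect, ι_gerstHom, ι_gerstHom, dualDer_ι, dualDer_ι, gerstHom_ι, ModuleDer.ext_ι,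
      dualDer_ι, adjoint_op]
    simp
    abel
  have key : ∀ ζ ω, contr (e.flip ω) (contr (e.flip ζ) (defect (dualDer R e b) 1
      (ExteriorAlgebra.ι A x) (ExteriorAlgebra.ι A y))) = algebraMap A _ (diffPairing e ⁅x, y⁆ ζ ω +
        (⁅y, diffPairing e x ζ ω⁆ - diffPairing e x ζ ((coadjoint e.flip y).op ω) -
          diffPairing e x ((coadjoint e.flip y).op ζ) ω) -
        (⁅x, diffPairing e y ζ ω⁆ - diffPairing e y ζ ((coadjoint e.flip x).op ω) -
          diffPairing e y ((coadjoint e.flip x).op ζ) ω)) := fun ζ ω => by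
    rw [h0, map_sub, map_sub, map_add, map_add, contr_contr_adjoint_dualVec,
      contr_contr_adjoint_dualVec, contr_contr_dualVec, ← map_add, ← map_sub]
  constructor
  · intro h ζ ω
    have hζ := key ζ ω
    rw [h, map_zero, map_zero] at hζ
    have h1 := congrArg (augm A L) hζ.symm
    rwa [augm_algebraMap, map_zero] at h1
  · intro h
    refine (perfectModel e).eq_of_contr b ?_ fun ζ => (perfectModel e).eq_of_contr b ?_ fun ω => ?_
    · rw [h0, map_sub, map_add, augm_adjoint, augm_adjoint, augm_dualVec, augm_dualVec,
        augm_dualVec]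
      simp
    · rw [h0, map_sub, map_add, contr_adjoint, contr_adjoint]
      simp only [map_sub, map_add, augm_adjoint, contr_dualVec, augm_ι, map_zero]
      simp
    · rw [key, h]
      simp

end DualDifferential

/-! ### The intermediate condition: compatibility of brackets and mutual actions. -/

section MatchedPair

variable (A L' L'' : Type*) [CommRing A]
  [LieRing L'] [Module A L'] [LieRingModule L' A]
  [LieRing L''] [Module A L''] [LieRingModule L'' A]
  [LieRingModule L' L''] [LieRingModule L'' L']

/-- The compatibility conditions between the brackets and the mutual actions of an almost twilled
Lie-Rinehart algebra. -/
structure IsMatchedPair : Prop where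
  base (x : L') (ξ : L'') (a : A) : ⁅ξ, ⁅x, a⁆⁆ - ⁅x, ⁅ξ, a⁆⁆ = ⁅⁅ξ, x⁆, a⁆ - ⁅⁅x, ξ⁆, a⁆
  left (x y : L') (ξ : L'') :
    ⁅ξ, ⁅x, y⁆⁆ = ⁅x, ⁅ξ, y⁆⁆ - ⁅y, ⁅ξ, x⁆⁆ - ⁅⁅x, ξ⁆, y⁆ + ⁅⁅y, ξ⁆, x⁆
  right (ξ η : L'') (x : L') :
    ⁅x, ⁅ξ, η⁆⁆ = ⁅ξ, ⁅x, η⁆⁆ - ⁅η, ⁅x, ξ⁆⁆ - ⁅⁅ξ, x⁆, η⁆ + ⁅⁅η, x⁆, ξ⁆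

end MatchedPair

/-! ### Components of the semidirect product. -/

section Semidirect

variable {A L M : Type*} [CommRing A] [LieRing L] [Module A L] [AddCommGroup M] [Module A M]

namespace Semidirect

/-- The projection of `L ⋉ M^*` to `L`. -/
def fst : Semidirect A L M →ₗ[A] L := LinearMap.fst A L (Module.Dual A M)

/-- The projection of `L ⋉ M^*` to `M^*`. -/
def snd : Semidirect A L M →ₗ[A] Module.Dual A M := LinearMap.snd A L (Module.Dual A M)

/-- The inclusion of `L` into `L ⋉ M^*`. -/
def inl : L →ₗ[A] Semidirect A L M := LinearMap.inl A L (Module.Dual A M)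

/-- The inclusion of `M^*` into `L ⋉ M^*`. -/
def inr : Module.Dual A M →ₗ[A] Semidirect A L M := LinearMap.inr A L (Module.Dual A M)

@[simp] theorem fst_inl (x : L) : fst (inl x : Semidirect A L M) = x := rfl
@[simp] theorem snd_inl (x : L) : snd (inl x : Semidirect A L M) = 0 := rfl
@[simp] theorem fst_inr (φ : Module.Dual A M) : fst (inr φ : Semidirect A L M) = 0 := rfl
@[simp] theorem snd_inr (φ : Module.Dual A M) : snd (inr φ : Semidirect A L M) = φ := rfl

theorem ext {u v : Semidirect A L M} (h : fst u = fst v) (h' : snd u = snd v) : u = v :=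
  Prod.ext h h'

theorem inl_add_inr (u : Semidirect A L M) : inl (fst u) + inr (snd u) = u :=
  ext (by simp) (by simp)

end Semidirect

theorem finite_semidirect [Module.Finite A L] [Module.Finite A M] [Module.Projective A M] :
    Module.Finite A (Semidirect A L M) :=
  inferInstanceAs (Module.Finite A (L × Module.Dual A M))

theorem projective_semidirect [Module.Projective A L] [Module.Finite A M]
    [Module.Projective A M] : Module.Projective A (Semidirect A L M) :=
  inferInstanceAs (Module.Projective A (L × Module.Dual A M))

end Semidirect

/-! ### The bialgebra condition for `L' ⋉ L''^*` and `L'' ⋉ L'^*` is the matched pair condition. -/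

section Criterion

open Semidirect

variable {R A L' L'' : Type*} [CommRing R] [CommRing A] [Algebra R A]
  [LieRing L'] [Module A L'] [LieRingModule L' A] [LieRinehartRing A L'] [LieAlgebra R L']
  [LieRinehartAlgebra R A L']
  [LieRing L''] [Module A L''] [LieRingModule L'' A] [LieRinehartRing A L''] [LieAlgebra R L'']
  [LieRinehartAlgebra R A L'']
  [LieRingModule L' L''] [LieRinehartModule A L' L'']
  [LieRingModule L'' L'] [LieRinehartModule A L'' L']

theorem semidirectPairing_apply (u : Semidirect A L' L'') (w : Semidirect A L'' L') :
    semidirectPairing A L' L'' u w = snd u (fst w) + snd w (fst u) := rfl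

theorem semidirect_lie_fst (u v : Semidirect A L' L'') : fst ⁅u, v⁆ = ⁅fst u, fst v⁆ := rfl

theorem semidirect_lie_snd (u v : Semidirect A L' L'') (ξ : L'') : snd ⁅u, v⁆ ξ =
    ⁅fst u, snd v ξ⁆ - snd v ⁅fst u, ξ⁆ - (⁅fst v, snd u ξ⁆ - snd u ⁅fst v, ξ⁆) := rfl

theorem semidirect_lie_base (u : Semidirect A L' L'') (a : A) : ⁅u, a⁆ = ⁅fst u, a⁆ := rfl

variable [Module.Finite A L'] [Module.Projective A L'] [Module.Finite A L'']
  [Module.Projective A L'']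

/-- The dual of `L'' ⊕ L'^*` is `L''^* ⊕ L'^**`, so the essential input is that the finitely
generated projective module `L'` is reflexive. -/
theorem semidirectPairing_bijective : Function.Bijective (semidirectPairing A L' L'') := by
  constructor
  · rw [injective_iff_map_eq_zero]
    intro u hu
    have h : ∀ w : Semidirect A L'' L', snd u (fst w) + snd w (fst u) = 0 := fun w =>
      DFunLike.congr_fun hu w
    refine Semidirect.ext ?_ (LinearMap.ext fun ξ => ?_)
    · rw [map_zero]
      refine (Module.forall_dual_apply_eq_zero_iff A (fst u)).mp fun ψ => ?_
      simpa using h (inr ψ)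
    · simpa using h (inl ξ)
  · intro f
    refine ⟨inl ((Module.evalEquiv A L').symm (f.comp inr)) + inr (f.comp inl),
      LinearMap.ext fun w => ?_⟩
    rw [semidirectPairing_apply, map_add, map_add, fst_inl, fst_inr, snd_inl, snd_inr, zero_add,
      add_zero, Module.apply_evalEquiv_symm_apply]
    conv_rhs => rw [← inl_add_inr w, map_add]
    rfl

theorem semidirectPairing_flip : (semidirectPairing A L' L'').flip = semidirectPairing A L'' L' :=
  LinearMap.ext fun _ => LinearMap.ext fun _ => add_comm _ _

instance : (semidirectPairing A L' L'').IsPerfPair where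
  bijective_left := semidirectPairing_bijective
  bijective_right := by rw [semidirectPairing_flip]; exact semidirectPairing_bijective

/-- The algebra `L'' ⋉ L'^*` acts on `A` through `L''`, so `d_* a` pairs to zero with `L'^*` and
hence lies in `L''^*`. -/
theorem diffVec_semidirect (a : A) :
    diffVec (semidirectPairing A L' L'') a = inr (diff L'' a) :=
  perfPair_ext (semidirectPairing A L' L'') fun w => by
    rw [e_diffVec, semidirectPairing_apply, fst_inr, snd_inr, map_zero, add_zero]
    rfl

/-- Elements of the projective module `L'` are separated by linear forms, and pairing with `inr ψ`
evaluates `ψ` on the `L'`-component. -/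
theorem coadjoint_semidirect_fst (w : Semidirect A L'' L') (u : Semidirect A L' L'') :
    fst ((coadjoint (semidirectPairing A L' L'') w).op u) = ⁅fst w, fst u⁆ := by
  rw [← sub_eq_zero]
  refine (Module.forall_dual_apply_eq_zero_iff A _).mp fun ψ => ?_
  have h := coadjoint_op (semidirectPairing A L' L'') w u (inr ψ)
  simp only [semidirectPairing_apply, semidirect_lie_fst, semidirect_lie_snd,
    semidirect_lie_base, map_zero, zero_add, lie_zero, zero_lie, sub_zero, fst_inr, snd_inr] at h
  rw [map_sub, h]
  abel

theorem coadjoint_flip_semidirect_fst (u : Semidirect A L' L'') (w : Semidirect A L'' L') :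
    fst ((coadjoint (semidirectPairing A L' L'').flip u).op w) = ⁅fst u, fst w⁆ := by
  rw [← sub_eq_zero]
  refine (Module.forall_dual_apply_eq_zero_iff A _).mp fun φ => ?_
  have h := coadjoint_op (semidirectPairing A L' L'').flip u w (inr φ)
  simp only [LinearMap.flip_apply, semidirectPairing_apply, semidirect_lie_fst, semidirect_lie_snd,
    semidirect_lie_base, map_zero, add_zero, lie_zero, zero_lie, sub_zero, fst_inr, snd_inr] at h
  rw [map_sub, h]
  abel

theorem coadjoint_flip_semidirect_snd (u : Semidirect A L' L'') (w : Semidirect A L'' L')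
    (z : L') : snd ((coadjoint (semidirectPairing A L' L'').flip u).op w) z =
      ⁅fst u, snd w z⁆ - snd w ⁅fst u, z⁆ + ⁅z, snd u (fst w)⁆ - snd u ⁅z, fst w⁆ := by
  have h := coadjoint_op (semidirectPairing A L' L'').flip u w (inl z)
  simp only [LinearMap.flip_apply, semidirectPairing_apply, semidirect_lie_fst, semidirect_lie_snd,
    semidirect_lie_base, LinearMap.zero_apply, lie_zero, sub_zero, zero_add, fst_inl,
    snd_inl] at h
  rw [h]
  abel

theorem diffPairing_semidirect (u : Semidirect A L' L'') (w z : Semidirect A L'' L') :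
    diffPairing (semidirectPairing A L' L'') u w z = ⁅fst w, snd u (fst z)⁆ -
      ⁅fst z, snd u (fst w)⁆ - snd u ⁅fst w, fst z⁆ + snd z ⁅fst w, fst u⁆ -
        snd w ⁅fst z, fst u⁆ := by
  rw [diffPairing]
  simp only [semidirectPairing_apply, semidirect_lie_fst, semidirect_lie_snd,
    semidirect_lie_base, lie_add]
  abel

variable (R) {n : ℕ} (b : DualBasis A (Semidirect A L'' L') n)

/-- The differentials `d_* a` lie in `L''^*`, which acts as zero on `A`; pairs of functions impose
no condition. -/
theorem defect_semidirect_algebraMap (a a' : A) :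
    defect (dualDer R (semidirectPairing A L' L'') b) 0
      (algebraMap A (ExteriorAlgebra A (Semidirect A L' L'')) a) (algebraMap A _ a') = 0 := by
  rw [defect_dualDer_algebraMap, diffVec_semidirect, diffVec_semidirect, semidirect_lie_base,
    semidirect_lie_base, fst_inr, fst_inr, zero_lie, zero_lie, add_zero, map_zero, neg_zero]

/-- All dual components drop out of the contracted defect, and what is left is `IsMatchedPair.base`
for the `L'`-component of `u`. -/
theorem defect_semidirect_ι_algebraMap (u : Semidirect A L' L'') (a : A) :
    defect (dualDer R (semidirectPairing A L' L'') b) 1 (ExteriorAlgebra.ι A u)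
        (algebraMap A _ a) = 0 ↔
      ∀ ξ : L'', ⁅ξ, ⁅fst u, a⁆⁆ - ⁅fst u, ⁅ξ, a⁆⁆ = ⁅⁅ξ, fst u⁆, a⁆ - ⁅⁅fst u, ξ⁆, a⁆ := by
  rw [defect_dualDer_ι_algebraMap]
  have key : ∀ w : Semidirect A L'' L',
      ⁅w, ⁅u, a⁆⁆ - semidirectPairing A L' L'' ⁅u, diffVec (semidirectPairing A L' L'') a⁆ w =
        ⁅(coadjoint (semidirectPairing A L' L'') w).op u, a⁆ - ⁅(diffVec (semidirectPairing A L' L'')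
          (semidirectPairing A L' L'' u w) : Semidirect A L' L''), a⁆ ↔
      ⁅fst w, ⁅fst u, a⁆⁆ - ⁅fst u, ⁅fst w, a⁆⁆ = ⁅⁅fst w, fst u⁆, a⁆ - ⁅⁅fst u, fst w⁆, a⁆ := by
    intro w
    rw [diffVec_semidirect, diffVec_semidirect]
    simp only [semidirectPairing_apply, semidirect_lie_fst, semidirect_lie_snd,
      semidirect_lie_base, coadjoint_semidirect_fst, zero_lie, lie_zero, map_zero, sub_zero,
      add_zero, diff_apply, fst_inr, snd_inr]
    constructor
    · intro h; linear_combination h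
    · intro h; linear_combination h
  exact ⟨fun h ξ => (key (inl ξ)).mp (h (inl ξ)), fun h w => (key w).mpr (h (fst w))⟩

theorem defect_semidirect_ι (u v : Semidirect A L' L'') (h : IsMatchedPair A L' L'') :
    defect (dualDer R (semidirectPairing A L' L'') b) 1 (ExteriorAlgebra.ι A u)
      (ExteriorAlgebra.ι A v) = 0 := by
  rw [defect_dualDer_ι]
  intro w z
  simp only [diffPairing_semidirect, semidirect_lie_fst, semidirect_lie_snd,
    semidirect_lie_base, coadjoint_flip_semidirect_fst, coadjoint_flip_semidirect_snd, lie_sub,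
    lie_add]
  generalize fst u = x, fst v = y, fst w = ξ, fst z = η, snd u = φ, snd v = χ, snd w = ψ, snd z = ω
  -- The identity is linear in the four functionals. The `L'^*`-components of the test elements are
  -- applied to `left`, the `L''^*`-components of the bracketed vectors to `right`; second
  -- derivatives of the values of `φ` and `χ` are exchanged by `base`.
  have t1 := congrArg ω (h.left x y ξ)
  have t2 := congrArg ψ (h.left x y η)
  have t3 := congrArg φ (h.right ξ η y)
  have t4 := congrArg χ (h.right ξ η x)
  simp only [map_add, map_sub] at t1 t2 t3 t4
  have s1 : χ ⁅⁅x, ξ⁆, η⁆ = -χ ⁅η, ⁅x, ξ⁆⁆ := by rw [← lie_skew, map_neg]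
  have s2 : φ ⁅⁅y, ξ⁆, η⁆ = -φ ⁅η, ⁅y, ξ⁆⁆ := by rw [← lie_skew, map_neg]
  linear_combination t1 - t2 + t4 - t3 - s1 + s2 + h.base x ξ (χ η) - h.base x η (χ ξ) -
    h.base y ξ (φ η) + h.base y η (φ ξ)

/-- Only special arguments are needed: functionals are separating on `L'` and `L''`, so each vector
equation can be read off from the pairing with a single functional. -/
theorem isMatchedPair_of_defect
    (h10 : ∀ (u : Semidirect A L' L'') (a : A), defect (dualDer R (semidirectPairing A L' L'') b) 1
      (ExteriorAlgebra.ι A u) (algebraMap A _ a) = 0)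
    (h11 : ∀ u v : Semidirect A L' L'', defect (dualDer R (semidirectPairing A L' L'') b) 1
      (ExteriorAlgebra.ι A u) (ExteriorAlgebra.ι A v) = 0) : IsMatchedPair A L' L'' := by
  have base : ∀ (x : L') (ξ : L'') (a : A),
      ⁅ξ, ⁅x, a⁆⁆ - ⁅x, ⁅ξ, a⁆⁆ = ⁅⁅ξ, x⁆, a⁆ - ⁅⁅x, ξ⁆, a⁆ := fun x ξ a =>
    (defect_semidirect_ι_algebraMap R b (inl x) a).mp (h10 _ a) ξ
  refine ⟨base, fun x y ξ => ?_, fun ξ η x => ?_⟩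
  · rw [← sub_eq_zero]
    refine (Module.forall_dual_apply_eq_zero_iff A _).mp fun ω => ?_
    -- Two elements of `L'`, tested on `ξ` and on a functional `ω` on `L'`, isolate `left` evaluated
    -- by `ω`.
    have h := (defect_dualDer_ι R (semidirectPairing A L' L'') b (inl x) (inl y)).mp (h11 _ _)
      (inl ξ) (inr ω)
    simp only [diffPairing_semidirect, semidirect_lie_fst, semidirect_lie_snd,
      semidirect_lie_base, coadjoint_flip_semidirect_fst, coadjoint_flip_semidirect_snd, lie_sub,
      lie_add, fst_inl, fst_inr, snd_inl, snd_inr, lie_zero, zero_lie, LinearMap.zero_apply,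
      map_zero] at h
    simp only [map_sub, map_add]
    linear_combination h
  · rw [← sub_eq_zero]
    refine (Module.forall_dual_apply_eq_zero_iff A _).mp fun χ => ?_
    -- One element of `L'` and a functional `χ` on `L''`, tested on two elements of `L''`, isolate
    -- `right` evaluated by `χ`, up to derivatives of `χ ξ` and `χ η` that are corrected by `base`.
    have h := (defect_dualDer_ι R (semidirectPairing A L' L'') b (inl x) (inr χ)).mp (h11 _ _)
      (inl ξ) (inl η)
    simp only [diffPairing_semidirect, semidirect_lie_fst, semidirect_lie_snd,
      semidirect_lie_base, coadjoint_flip_semidirect_fst, coadjoint_flip_semidirect_snd, lie_sub,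
      lie_add, fst_inl, fst_inr, snd_inl, snd_inr, lie_zero, zero_lie, LinearMap.zero_apply,
      map_zero] at h
    have s1 : χ ⁅⁅x, ξ⁆, η⁆ = -χ ⁅η, ⁅x, ξ⁆⁆ := by rw [← lie_skew, map_neg]
    simp only [map_sub, map_add]
    linear_combination h + s1 - base x ξ (χ η) + base x η (χ ξ)

theorem defect_semidirect_eq_zero (h : IsMatchedPair A L' L'') {m : ℕ}
    {u : ExteriorAlgebra A (Semidirect A L' L'')} (hu : u ∈ ⋀[A]^m (Semidirect A L' L''))
    (v : ExteriorAlgebra A (Semidirect A L' L'')) :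
    defect (dualDer R (semidirectPairing A L' L'') b) m u v = 0 :=
  defect_eq_zero (isGradedDer_dualDer R _ b) (fun _ _ hu => dualDer_mem R _ b hu)
    (defect_semidirect_algebraMap R b)
    (fun u a => (defect_semidirect_ι_algebraMap R b u a).mpr fun _ => h.base _ _ _)
    (fun u v => defect_semidirect_ι R b u v h) hu v

theorem exists_dualBasis_semidirect : ∃ n, Nonempty (DualBasis A (Semidirect A L'' L') n) :=
  have := finite_semidirect (A := A) (L := L'') (M := L')
  have := projective_semidirect (A := A) (L := L'') (M := L')
  exists_dualBasis

theorem isLieRinehartBialgebra_iff :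
    IsLieRinehartBialgebra R A (Semidirect A L' L'') (Semidirect A L'' L')
      (semidirectPairing A L' L'') ↔ IsMatchedPair A L' L'' := by
  obtain ⟨n, ⟨b⟩⟩ := exists_dualBasis_semidirect (A := A) (L' := L') (L'' := L'')
  constructor
  · intro h
    obtain ⟨br, δ, hbr, hδ, hd⟩ := h.derivation
    -- By uniqueness the bracket and the differential in the hypothesis are the constructed ones.
    obtain rfl := hbr.eq_gerst
    obtain rfl := hδ.unique _ b (isDualDifferential_dualDiff R _ b)
    have h0 : ∀ (u : Semidirect A L' L'') (v),
        defect (dualDer R (semidirectPairing A L' L'') b) 1 (ExteriorAlgebra.ι A u) v = 0 := by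
      intro u v
      have := hd 1 _ v (ι_mem_exteriorPower u)
      rw [defect, ← sub_eq_zero.mpr this]
      simp only [gerst_apply]
      change dualDiff R _ b _ - gerstHom A _ (dualDiff R _ b _) _ +
        (-1 : ℤ) ^ 1 • gerstHom A _ _ (dualDiff R _ b _) = _
      abel
    exact isMatchedPair_of_defect R b (fun u a => h0 u _) fun u v => h0 u _
  · intro h
    refine ⟨finite_semidirect, projective_semidirect, finite_semidirect, projective_semidirect,
      inferInstance, gerst R A _, dualDiff R _ b, isGerstenhaberBracket_gerst,
      isDualDifferential_dualDiff R _ b, fun m u v hu => ?_⟩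
    have h0 := defect_semidirect_eq_zero R b h hu v
    rw [← sub_eq_zero, ← h0, defect]
    simp only [gerst_apply]
    change _ = dualDiff R _ b _ - gerstHom A _ (dualDiff R _ b _) _ +
        (-1 : ℤ) ^ m • gerstHom A _ _ (dualDiff R _ b _)
    abel

end Criterion

/-! ### The twilled condition is the matched pair condition. -/

section Twilled

theorem LieRinehartModule.lie_algebra_smul {R A L M : Type*} [CommRing R] [CommRing A] [Algebra R A]
    [LieRing L] [Module A L] [LieRingModule L A] [LieRinehartRing A L] [LieAlgebra R L]
    [LieRinehartAlgebra R A L] [AddCommGroup M] [Module A M] [LieRingModule L M]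
    [LieRinehartModule A L M] [Module R M] [IsScalarTower R A M] (x : L) (r : R) (m : M) :
    ⁅x, r • m⁆ = r • ⁅x, m⁆ := by
  rw [← algebraMap_smul A r m, lie_smul_act, lie_algebraMap, zero_smul, zero_add, algebraMap_smul]

theorem LieRinehartModule.algebra_smul_lie (A : Type*) {R L M : Type*} [CommRing R] [CommRing A]
    [Algebra R A] [LieRing L] [Module A L] [LieRingModule L A]
    [Module R L] [IsScalarTower R A L] [AddCommGroup M] [Module A M] [LieRingModule L M]
    [LieRinehartModule A L M] [Module R M] [IsScalarTower R A M] (r : R) (x : L) (m : M) :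
    ⁅r • x, m⁆ = r • ⁅x, m⁆ := by
  rw [← algebraMap_smul A r x, smul_lie_act, algebraMap_smul]

variable {R A L' L'' : Type*} [CommRing R] [CommRing A] [Algebra R A]
  [LieRing L'] [Module A L'] [LieRingModule L' A] [LieRinehartRing A L'] [LieAlgebra R L']
  [LieRinehartAlgebra R A L']
  [LieRing L''] [Module A L''] [LieRingModule L'' A] [LieRinehartRing A L''] [LieAlgebra R L'']
  [LieRinehartAlgebra R A L'']
  [LieRingModule L' L''] [LieRinehartModule A L' L'']
  [LieRingModule L'' L'] [LieRinehartModule A L'' L']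

/-- This is the `L'`-component of the Jacobi identity for `(x, ξ)`, `(y, η)`, `(z, ζ)`. Terms
without an element of `L''` are the Jacobi identity of `L'`, terms with one are instances of `left`,
and terms with two express that `L''` acts on `L'`. The other component follows from
`IsMatchedPair.symm`. -/
theorem IsMatchedPair.jacobi_left (h : IsMatchedPair A L' L'') (x y z : L') (ξ η ζ : L'') :
    ⁅x, ⁅y, z⁆ + ⁅η, z⁆ - ⁅ζ, y⁆⁆ + ⁅ξ, ⁅y, z⁆ + ⁅η, z⁆ - ⁅ζ, y⁆⁆ -
        ⁅⁅η, ζ⁆ + ⁅y, ζ⁆ - ⁅z, η⁆, x⁆ =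
      ⁅⁅x, y⁆ + ⁅ξ, y⁆ - ⁅η, x⁆, z⁆ + ⁅⁅ξ, η⁆ + ⁅x, η⁆ - ⁅y, ξ⁆, z⁆ - ⁅ζ, ⁅x, y⁆ + ⁅ξ, y⁆ - ⁅η, x⁆⁆ +
        (⁅y, ⁅x, z⁆ + ⁅ξ, z⁆ - ⁅ζ, x⁆⁆ + ⁅η, ⁅x, z⁆ + ⁅ξ, z⁆ - ⁅ζ, x⁆⁆ -
          ⁅⁅ξ, ζ⁆ + ⁅x, ζ⁆ - ⁅z, ξ⁆, y⁆) := by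
  simp only [lie_add, lie_sub, add_lie, sub_lie, lie_lie]
  linear_combination (norm := abel) h.left y z ξ - h.left x z η + h.left x y ζ +
    lie_skew z ⁅ξ, y⁆ - lie_skew z ⁅η, x⁆

theorem IsMatchedPair.symm (h : IsMatchedPair A L' L'') : IsMatchedPair A L'' L' where
  base x ξ a := by linear_combination -h.base ξ x a
  left := h.right
  right := h.left

theorem isTwilled_iff : IsTwilled R A L' L'' ↔ IsMatchedPair A L' L'' := by
  constructor
  · intro h
    -- Mixed arguments suffice: the action of a mixed bracket yields `base`, the `L'`-component of
    -- the second family of Jacobi identities yields `left`, and the `L''`-component of the third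
    -- yields `right`.
    have e1 := fun (x : L') (ξ : L'') (a : A) => h.bracket_act (x, 0) (0, ξ) a
    have e2 := fun (x y : L') (ξ : L'') => h.jacobi (0, ξ) (x, 0) (y, 0)
    have e3 := fun (ξ η : L'') (x : L') => h.jacobi (x, 0) (0, ξ) (0, η)
    simp only [twilledBracket, twilledAct, lie_zero, zero_lie, add_zero, zero_add, sub_zero,
      zero_sub, lie_neg, neg_lie, Prod.mk_add_mk, Prod.mk.injEq] at e1 e2 e3
    refine ⟨fun x ξ a => ?_, fun x y ξ => ?_, fun ξ η x => ?_⟩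
    · linear_combination e1 x ξ a
    · rw [(e2 x y ξ).1, ← lie_skew y ⁅ξ, x⁆]
      abel
    · rw [(e3 ξ η x).2, ← lie_skew η ⁅x, ξ⁆]
      abel
  · intro h
    refine ⟨fun u v w => ?_, fun u v w => ?_, fun r u v => ?_, fun r u v => ?_, fun u => ?_,
      fun u v w => ?_, fun u v a => ?_, fun a u b => ?_, fun u a b => ?_, fun r u a => ?_,
      fun u a b => ?_, fun u v a => ?_, fun u v a => ?_⟩
    · simp only [twilledBracket, Prod.fst_add, Prod.snd_add, lie_add, add_lie, Prod.mk_add_mk,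
        Prod.mk.injEq]
      constructor <;> abel
    · simp only [twilledBracket, Prod.fst_add, Prod.snd_add, lie_add, add_lie, Prod.mk_add_mk,
        Prod.mk.injEq]
      constructor <;> abel
    · simp only [twilledBracket, Prod.smul_fst, Prod.smul_snd, smul_lie,
        LieRinehartModule.algebra_smul_lie A, LieRinehartModule.lie_algebra_smul (A := A),
        Prod.smul_mk, smul_add, smul_sub]
    · simp only [twilledBracket, Prod.smul_fst, Prod.smul_snd, lie_smul,
        LieRinehartModule.algebra_smul_lie A, LieRinehartModule.lie_algebra_smul (A := A),
        Prod.smul_mk, smul_add, smul_sub]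
    · simp [twilledBracket]
    · exact Prod.ext (h.jacobi_left _ _ _ _ _ _) (h.symm.jacobi_left _ _ _ _ _ _)
    · simp only [twilledAct, Prod.fst_add, Prod.snd_add, add_lie]
      abel
    · simp only [twilledAct, Prod.smul_fst, Prod.smul_snd, LieRinehartRing.lie_smul_eq_mul, mul_add]
    · simp only [twilledAct, lie_add]
      abel
    · exact (congrArg₂ (· + ·) (LieModule.lie_smul r u.1 a) (LieModule.lie_smul r u.2 a)).trans
        (smul_add r _ _).symm
    · simp only [twilledAct, LieRinehartRing.leibniz_mul_right, smul_eq_mul]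
      ring
    · simp only [twilledAct, twilledBracket, lie_add, add_lie, sub_lie, lie_lie]
      linear_combination h.base u.1 v.2 a - h.base v.1 u.2 a
    · simp only [twilledAct, twilledBracket, Prod.smul_fst, Prod.smul_snd,
        LieRinehartRing.leibniz_smul_right, LieRinehartModule.lie_smul_act,
        LieRinehartModule.smul_lie_act]
      refine Prod.ext ?_ ?_
      · simp only [Prod.fst_add, Prod.smul_fst, smul_add, smul_sub, add_smul]
        abel
      · simp only [Prod.snd_add, Prod.smul_snd, smul_add, smul_sub, add_smul]
        abel

end Twilled

/-! ### The exterior algebra of `L ⊕ M^*`, its bigrading, and its forms on `M`. -/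

section SemidirectModel

open Semidirect

variable {A L M : Type*} [CommRing A] [LieRing L] [Module A L] [AddCommGroup M] [Module A M]

/-- The inclusion of `Λ_A L` into the exterior algebra of `L ⊕ M^*`. -/
abbrev extIncl : ExteriorAlgebra A L →ₐ[A] ExteriorAlgebra A (Semidirect A L M) :=
  ExteriorAlgebra.map inl

/-- The projection of the exterior algebra of `L ⊕ M^*` onto `Λ_A L`. -/
abbrev extProj : ExteriorAlgebra A (Semidirect A L M) →ₐ[A] ExteriorAlgebra A L :=
  ExteriorAlgebra.map fst

theorem extProj_extIncl (u : ExteriorAlgebra A L) : extProj (M := M) (extIncl u) = u := by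
  induction u using ExteriorAlgebra.induction with
  | algebraMap a => rw [AlgHom.commutes, AlgHom.commutes]
  | ι x => rw [ExteriorAlgebra.map_apply_ι, ExteriorAlgebra.map_apply_ι, fst_inl]
  | mul u v hu hv => rw [map_mul, map_mul, hu, hv]
  | add u v hu hv => rw [map_add, map_add, hu, hv]

theorem contr_extIncl (ξ : M) (u : ExteriorAlgebra A L) :
    contr ((snd : Semidirect A L M →ₗ[A] _).flip ξ) (extIncl u) = 0 := by
  induction u using ExteriorAlgebra.induction with
  | algebraMap a => rw [AlgHom.commutes, contr_algebraMap]
  | ι x =>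
    rw [ExteriorAlgebra.map_apply_ι, contr_ι, LinearMap.flip_apply, snd_inl,
      LinearMap.zero_apply, map_zero]
  | mul u v hu hv => rw [map_mul, (isGradedDer_contr _).map_mul, hu, hv, zero_mul, mul_zero, add_zero]
  | add u v hu hv => rw [map_add, map_add, hu, hv, add_zero]

variable (A L M) in
/-- The elements of `L` and of `M^*`, as a subset of `L ⊕ M^*`. -/
def homogeneous : Set (Semidirect A L M) := Set.range inl ∪ Set.range inr

theorem closure_homogeneous : AddSubgroup.closure (homogeneous A L M) = ⊤ := by
  refine (AddSubgroup.eq_top_iff' _).mpr fun u => ?_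
  rw [← inl_add_inr u]
  exact add_mem (AddSubgroup.subset_closure (Or.inl ⟨_, rfl⟩))
    (AddSubgroup.subset_closure (Or.inr ⟨_, rfl⟩))

/-- The products of elements of `A`, of `p` elements of `M^*` and of `q` elements of `L`. -/
inductive IsBimonomial : ℕ → ℕ → ExteriorAlgebra A (Semidirect A L M) → Prop
  | base (a : A) : IsBimonomial 0 0 (algebraMap A _ a)
  | left {p q : ℕ} {u : ExteriorAlgebra A (Semidirect A L M)} (x : L) (hu : IsBimonomial p q u) :
      IsBimonomial p (q + 1) (ExteriorAlgebra.ι A (inl x) * u)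
  | right {p q : ℕ} {u : ExteriorAlgebra A (Semidirect A L M)} (φ : Module.Dual A M)
      (hu : IsBimonomial p q u) : IsBimonomial (p + 1) q (ExteriorAlgebra.ι A (inr φ) * u)

theorem IsBimonomial.isMonomial {p q : ℕ} {u : ExteriorAlgebra A (Semidirect A L M)}
    (h : IsBimonomial p q u) : IsMonomial (homogeneous A L M) (p + q) u := by
  induction h with
  | base a => exact .base a
  | left x _ ih => exact .cons (Or.inl ⟨x, rfl⟩) ih
  | @right p q u φ _ ih =>
    rw [show p + 1 + q = p + q + 1 by omega]
    exact .cons (Or.inr ⟨φ, rfl⟩) ih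

theorem IsMonomial.isBimonomial {n : ℕ} {u : ExteriorAlgebra A (Semidirect A L M)}
    (h : IsMonomial (homogeneous A L M) n u) : ∃ p q, p + q = n ∧ IsBimonomial p q u := by
  induction h with
  | base a => exact ⟨0, 0, rfl, .base a⟩
  | cons hx _ ih =>
    obtain ⟨p, q, rfl, h⟩ := ih
    rcases hx with ⟨x, rfl⟩ | ⟨φ, rfl⟩
    · exact ⟨p, q + 1, by omega, .left x h⟩
    · exact ⟨p + 1, q, by omega, .right φ h⟩

theorem IsBimonomial.smul {p q : ℕ} {u : ExteriorAlgebra A (Semidirect A L M)}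
    (h : IsBimonomial p q u) (a : A) : IsBimonomial p q (a • u) := by
  induction h with
  | base b => rw [Algebra.smul_def, ← map_mul]; exact .base _
  | left x _ ih => rw [← mul_smul_comm]; exact .left x ih
  | right φ _ ih => rw [← mul_smul_comm]; exact .right φ ih

/-- Graded commutativity moves all factors from `M^*` to the left, and the resulting sign is
absorbed in the factor from `Λ_A L`. -/
theorem IsBimonomial.eq_mul {p q : ℕ} {u : ExteriorAlgebra A (Semidirect A L M)}
    (h : IsBimonomial p q u) : ∃ (φ : Fin p → Module.Dual A M) (n : ExteriorAlgebra A L),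
      n ∈ ⋀[A]^q L ∧ u = ExteriorAlgebra.ιMulti A p (fun i => inr (φ i)) * extIncl n := by
  induction h with
  | base a =>
    exact ⟨fun i => i.elim0, algebraMap A _ a, algebraMap_mem_exteriorPower a, by simp⟩
  | @left p q u x _ ih =>
    obtain ⟨φ, n, hn, rfl⟩ := ih
    refine ⟨φ, (-1 : ℤ) ^ p • (ExteriorAlgebra.ι A x * n),
      zsmul_mem (ι_mul_mem_exteriorPower x hn) _, ?_⟩
    have hp : HasParity p (ExteriorAlgebra.ιMulti A p fun i => (Semidirect.inr (φ i) :
        Semidirect A L M)) := hasParity_of_mem (by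
      rw [← ExteriorAlgebra.ιMulti_span_fixedDegree]
      exact Submodule.subset_span ⟨_, rfl⟩)
    rw [← mul_assoc, (hasParity_ι _).mul_comm_smul hp, one_mul, map_zsmul, map_mul,
      ExteriorAlgebra.map_apply_ι, mul_smul_comm, smul_mul_assoc, mul_assoc]
  | right φ _ ih =>
    obtain ⟨ψ, n, hn, rfl⟩ := ih
    refine ⟨Fin.cons φ ψ, n, hn, ?_⟩
    rw [ExteriorAlgebra.ιMulti_succ_apply, mul_assoc]
    rfl

variable (A L M) in
/-- The homogeneous component of bidegree `(p, q)` of the exterior algebra of `L ⊕ M^*`. -/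
def bihom (p q : ℕ) : AddSubgroup (ExteriorAlgebra A (Semidirect A L M)) :=
  AddSubgroup.closure {u | IsBimonomial p q u}

theorem IsBimonomial.mem_bihom {p q : ℕ} {u : ExteriorAlgebra A (Semidirect A L M)}
    (h : IsBimonomial p q u) : u ∈ bihom A L M p q := AddSubgroup.subset_closure h

@[elab_as_elim]
theorem bihom_induction {p q : ℕ}
    {C : (u : ExteriorAlgebra A (Semidirect A L M)) → u ∈ bihom A L M p q → Prop}
    (mem : ∀ u hu, C u (IsBimonomial.mem_bihom hu)) (zero : C 0 (zero_mem _))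
    (add : ∀ u v hu hv, C u hu → C v hv → C (u + v) (add_mem hu hv))
    (neg : ∀ u hu, C u hu → C (-u) (neg_mem hu))
    {u : ExteriorAlgebra A (Semidirect A L M)} (hu : u ∈ bihom A L M p q) : C u hu :=
  AddSubgroup.closure_induction mem zero add neg hu

theorem bihom_le {p q : ℕ} {u : ExteriorAlgebra A (Semidirect A L M)} (hu : u ∈ bihom A L M p q) :
    u ∈ ⋀[A]^(p + q) (Semidirect A L M) := by
  induction hu using bihom_induction with
  | mem u hu => exact hu.isMonomial.mem
  | zero => exact zero_mem _
  | add u v _ _ hu hv => exact add_mem hu hv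
  | neg u _ hu => exact neg_mem hu

theorem inl_mul_mem_bihom {p q : ℕ} {u : ExteriorAlgebra A (Semidirect A L M)} (x : L)
    (hu : u ∈ bihom A L M p q) : ExteriorAlgebra.ι A (inl x) * u ∈ bihom A L M p (q + 1) := by
  induction hu using bihom_induction with
  | mem u hu => exact (hu.left x).mem_bihom
  | zero => rw [mul_zero]; exact zero_mem _
  | add u v _ _ hu hv => rw [mul_add]; exact add_mem hu hv
  | neg u _ hu => rw [mul_neg]; exact neg_mem hu

theorem inr_mul_mem_bihom {p q : ℕ} {u : ExteriorAlgebra A (Semidirect A L M)}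
    (φ : Module.Dual A M) (hu : u ∈ bihom A L M p q) :
    ExteriorAlgebra.ι A (inr φ) * u ∈ bihom A L M (p + 1) q := by
  induction hu using bihom_induction with
  | mem u hu => exact (hu.right φ).mem_bihom
  | zero => rw [mul_zero]; exact zero_mem _
  | add u v _ _ hu hv => rw [mul_add]; exact add_mem hu hv
  | neg u _ hu => rw [mul_neg]; exact neg_mem hu

theorem smul_mem_bihom {p q : ℕ} {u : ExteriorAlgebra A (Semidirect A L M)} (a : A)
    (hu : u ∈ bihom A L M p q) : a • u ∈ bihom A L M p q := by
  induction hu using bihom_induction with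
  | mem u hu => exact (hu.smul a).mem_bihom
  | zero => rw [smul_zero]; exact zero_mem _
  | add u v _ _ hu hv => rw [smul_add]; exact add_mem hu hv
  | neg u _ hu => rw [smul_neg]; exact neg_mem hu

theorem algebraMap_mem_bihom (a : A) : algebraMap A _ a ∈ bihom A L M 0 0 :=
  (IsBimonomial.base a).mem_bihom

theorem inl_mem_bihom (x : L) : ExteriorAlgebra.ι A (inl x) ∈ bihom A L M 0 1 := by
  have h := inl_mul_mem_bihom (M := M) x (algebraMap_mem_bihom (1 : A))
  rwa [map_one, mul_one] at h

theorem inr_mem_bihom (φ : Module.Dual A M) : ExteriorAlgebra.ι A (inr φ) ∈ bihom A L M 1 0 := by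
  have h := inr_mul_mem_bihom (L := L) φ (algebraMap_mem_bihom (1 : A))
  rwa [map_one, mul_one] at h

theorem mul_mem_bihom {p q p' q' : ℕ} {u v : ExteriorAlgebra A (Semidirect A L M)}
    (hu : u ∈ bihom A L M p q) (hv : v ∈ bihom A L M p' q') :
    u * v ∈ bihom A L M (p + p') (q + q') := by
  induction hu using bihom_induction with
  | mem u hu =>
    induction hu with
    | base a =>
      rw [← Algebra.smul_def, zero_add, zero_add]
      exact smul_mem_bihom a hv
    | @left p q u x _ ih =>
      rw [mul_assoc, show q + 1 + q' = q + q' + 1 by omega]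
      exact inl_mul_mem_bihom x ih
    | @right p q u φ _ ih =>
      rw [mul_assoc, show p + 1 + p' = p + p' + 1 by omega]
      exact inr_mul_mem_bihom φ ih
  | zero => rw [zero_mul]; exact zero_mem _
  | add u v _ _ hu hv => rw [add_mul]; exact add_mem hu hv
  | neg u _ hu => rw [neg_mul]; exact neg_mem hu

theorem ιMulti_mul_mem_bihom {p q : ℕ} (φ : Fin p → Module.Dual A M) {n : ExteriorAlgebra A L}
    (hn : n ∈ ⋀[A]^q L) :
    ExteriorAlgebra.ιMulti A p (fun i => inr (φ i)) * extIncl n ∈ bihom A L M p q := by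
  induction p with
  | zero =>
    rw [ExteriorAlgebra.ιMulti_zero_apply, one_mul]
    induction hn using exteriorPower_induction with
    | algebraMap a => rw [AlgHom.commutes]; exact algebraMap_mem_bihom a
    | add n u v _ _ hu hv => rw [map_add]; exact add_mem hu hv
    | ι_mul n x u _ hu =>
      rw [map_mul, ExteriorAlgebra.map_apply_ι]
      exact inl_mul_mem_bihom x hu
  | succ p ih =>
    rw [ExteriorAlgebra.ιMulti_succ_apply, mul_assoc]
    exact inr_mul_mem_bihom (φ 0) (ih fun i => φ i.succ)

variable (A L M) in
/-- The identification of the exterior algebra of `L ⊕ M^*` with `Alt_A(M, Λ_A L)`. -/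
def semidirectModel : FormModel (snd : Semidirect A L M →ₗ[A] Module.Dual A M)
    (extProj (M := M)).toLinearMap where
  lift := inr
  incl := (extIncl (M := M)).toLinearMap
  e_lift φ := snd_inr φ
  ε_incl n := extProj_extIncl n
  ε_lift_mul φ w := by
    change extProj (ExteriorAlgebra.ι A (inr φ) * w) = 0
    rw [map_mul, ExteriorAlgebra.map_apply_ι, fst_inr, map_zero, zero_mul]
  contr_incl ξ n := contr_extIncl ξ n
  span u := by
    induction mem_closure_isMonomial closure_homogeneous u using AddSubgroup.closure_induction with
    | zero => exact zero_mem _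
    | add u v _ _ hu hv => exact add_mem hu hv
    | neg u _ hu => exact neg_mem hu
    | mem u hu =>
      obtain ⟨k, hu⟩ := hu
      obtain ⟨p, q, -, hu⟩ := hu.isBimonomial
      obtain ⟨φ, n, -, rfl⟩ := hu.eq_mul
      exact AddSubgroup.subset_closure ⟨p, φ, n, rfl⟩

end SemidirectModel

/-! ### The identification of `Alt_A(M, Λ_A L)` with the exterior algebra of `L ⊕ M^*`. -/

section FormsEquiv

open Semidirect

variable {R A L M : Type*} [CommRing R] [CommRing A] [Algebra R A]
  [LieRing L] [Module A L] [LieRingModule L A] [LieRinehartRing A L] [LieAlgebra R L]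
  [LieRinehartAlgebra R A L]
  [AddCommGroup M] [Module A M]

variable (R L) in
/-- The identification of `Alt_A(M, Λ_A L)` with the exterior algebra of `L ⊕ M^*`. -/
def formsEquiv {n : ℕ} (b : DualBasis A M n) :
    Forms A L M ≃ₗ[R] ExteriorAlgebra A (Semidirect A L M) :=
  LinearEquiv.ofBijective ((semidirectModel A L M).total b R)
    ((semidirectModel A L M).total_bijective b R)

/-- The components of the form that corresponds to an element of the exterior algebra of
`L ⊕ M^*`. -/
abbrev component (p : ℕ) :
    ExteriorAlgebra A (Semidirect A L M) →ₗ[A] M [⋀^Fin p]→ₗ[A] ExteriorAlgebra A L :=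
  formOf (snd : Semidirect A L M →ₗ[A] Module.Dual A M) (extProj (M := M)).toLinearMap p

variable {n : ℕ} (b : DualBasis A M n)

theorem formsEquiv_of (p : ℕ) (f : M [⋀^Fin p]→ₗ[A] ExteriorAlgebra A L) :
    formsEquiv R L b (DirectSum.of (fun p => M [⋀^Fin p]→ₗ[A] ExteriorAlgebra A L) p f) =
      (semidirectModel A L M).ofForm b p f :=
  (semidirectModel A L M).total_of b R p f

theorem component_formsEquiv (F : Forms A L M) (p : ℕ) : component p (formsEquiv R L b F) = F p :=
  (semidirectModel A L M).formOf_total b R F p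

theorem formsEquiv_eq_iff (F : Forms A L M) (u : ExteriorAlgebra A (Semidirect A L M)) :
    formsEquiv R L b F = u ↔ ∀ p, component p u = F p :=
  (semidirectModel A L M).total_eq_iff b R F u

theorem component_gen_apply {p : ℕ} (φ : Fin p → Module.Dual A M) (u : ExteriorAlgebra A L)
    (v : Fin p → M) : component p (ExteriorAlgebra.ιMulti A p (fun i => inr (φ i)) * extIncl u) v =
      (Matrix.of fun j i => φ i (v j)).det • u :=
  (semidirectModel A L M).formOf_gen_self φ u v

theorem formsEquiv_gen {p : ℕ} (φ : Fin p → Module.Dual A M) (u : ExteriorAlgebra A L) :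
    formsEquiv R L b (DirectSum.of (fun p => M [⋀^Fin p]→ₗ[A] ExteriorAlgebra A L) p
      (component p (ExteriorAlgebra.ιMulti A p (fun i => inr (φ i)) * extIncl u))) =
        ExteriorAlgebra.ιMulti A p (fun i => inr (φ i)) * extIncl u := by
  rw [formsEquiv_of]
  exact (semidirectModel A L M).ofForm_formOf_gen b φ u

-- The generators are the forms `v ↦ det(φ_i(v_j)) u`, for which products become determinants.
-- Negation enters as multiplication by `-1` in `R`, so that `R`-linear maps respect it through
-- `map_smul`.
variable (R) in
include R b in
theorem forms_induction {C : Forms A L M → Prop}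
    (gen : ∀ (p : ℕ) (φ : Fin p → Module.Dual A M) (u : ExteriorAlgebra A L),
      C (DirectSum.of (fun p => M [⋀^Fin p]→ₗ[A] ExteriorAlgebra A L) p
        (component p (ExteriorAlgebra.ιMulti A p (fun i => inr (φ i)) * extIncl u))))
    (zero : C 0) (add : ∀ F G, C F → C G → C (F + G)) (neg : ∀ F, C F → C ((-1 : R) • F))
    (F : Forms A L M) : C F := by
  have key : ∀ u, C ((formsEquiv R L b).symm u) := fun u => by
    induction (semidirectModel A L M).span u using AddSubgroup.closure_induction with
    | zero => rwa [map_zero]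
    | add u v _ _ hu hv => rw [map_add]; exact add _ _ hu hv
    | neg u _ hu => rw [← neg_one_smul R u, map_smul]; exact neg _ hu
    | mem u hu =>
      obtain ⟨p, φ, n, rfl⟩ := hu
      have h := gen p φ n
      rwa [← (formsEquiv R L b).symm_apply_apply (DirectSum.of _ p _), formsEquiv_gen] at h
  have h := key (formsEquiv R L b F)
  rwa [LinearEquiv.symm_apply_apply] at h

theorem formsEquiv_const (u : ExteriorAlgebra A L) :
    formsEquiv R L b (Forms.const u) = extIncl u := by
  have h := formsEquiv_gen (R := R) b (fun i : Fin 0 => i.elim0) u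
  have e : component 0 (ExteriorAlgebra.ιMulti A 0 (fun i : Fin 0 =>
      (inr (i.elim0 : Module.Dual A M) : Semidirect A L M)) * extIncl u) =
      AlternatingMap.constOfIsEmpty A M (Fin 0) u := by
    ext v
    rw [component_gen_apply]
    simp
  rw [e, ExteriorAlgebra.ιMulti_zero_apply, one_mul] at h
  exact h

theorem formsEquiv_ofForm {p : ℕ} (φ : Fin p → Module.Dual A M)
    (β : M [⋀^Fin p]→ₗ[A] A) (h : ∀ v, β v = (Matrix.of fun j i => φ i (v j)).det) :
    formsEquiv R L b (Forms.ofForm β) = ExteriorAlgebra.ιMulti A p (fun i => inr (φ i)) := by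
  have h' := formsEquiv_gen (R := R) b φ (1 : ExteriorAlgebra A L)
  have e : component p (ExteriorAlgebra.ιMulti A p (fun i => inr (φ i)) * extIncl 1) =
      (Algebra.linearMap A (ExteriorAlgebra A L)).compAlternatingMap β := by
    ext v
    rw [component_gen_apply, LinearMap.compAlternatingMap_apply, h, Algebra.linearMap_apply,
      Algebra.algebraMap_eq_smul_one]
  rwa [e, map_one, mul_one] at h'

theorem formsEquiv_ofForm_zero (a : A) :
    formsEquiv R L b (Forms.ofForm (AlternatingMap.constOfIsEmpty A M (Fin 0) a)) =
      algebraMap A _ a := by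
  have h : (Forms.ofForm (AlternatingMap.constOfIsEmpty A M (Fin 0) a) : Forms A L M) =
      Forms.const (algebraMap A _ a) := rfl
  rw [h, formsEquiv_const, AlgHom.commutes]

theorem formsEquiv_ofForm_one (φ : Module.Dual A M) :
    formsEquiv R L b (Forms.ofForm (AlternatingMap.ofSubsingleton A M A (0 : Fin 1) φ)) =
      ExteriorAlgebra.ι A (inr φ) := by
  rw [formsEquiv_ofForm b (fun _ => φ) _ fun v => by simp, ExteriorAlgebra.ιMulti_succ_apply,
    ExteriorAlgebra.ιMulti_zero_apply, mul_one]

/-! ### The shuffle product corresponds to the exterior product. -/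

section Multiplication

/-- For alternatizations the sum over shuffles unfolds into a sum over all permutations, which can
be compared with the Leibniz formula for a determinant. -/
theorem domCoprod_apply_alternatization {N : Type*} [Ring N] [Algebra A N] {k r : ℕ}
    (a : MultilinearMap A (fun _ : Fin k => M) N) (c : MultilinearMap A (fun _ : Fin r => M) N)
    (v : Fin k ⊕ Fin r → M) :
    LinearMap.mul' A N ((AlternatingMap.domCoprod (MultilinearMap.alternatization a)
      (MultilinearMap.alternatization c)) v) =
      ∑ σ : Equiv.Perm (Fin k ⊕ Fin r), Equiv.Perm.sign σ •
        (a (fun i => v (σ (Sum.inl i))) * c (fun i => v (σ (Sum.inr i)))) := by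
  rw [← MultilinearMap.domCoprod_alternization, MultilinearMap.alternatization_apply, map_sum]
  refine Finset.sum_congr rfl fun σ _ => ?_
  rw [LinearMap.map_smul_of_tower]
  rfl

theorem det_smul_eq_alternatization {N : Type*} [Ring N] [Algebra A N] {k : ℕ}
    (φ : Fin k → Module.Dual A M) (u : N) (f : M [⋀^Fin k]→ₗ[A] N)
    (h : ∀ v, f v = (Matrix.of fun j i => φ i (v j)).det • u) :
    f = MultilinearMap.alternatization (MultilinearMap.smulRight
      ((MultilinearMap.mkPiAlgebra A (Fin k) A).compLinearMap φ) u) := by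
  ext v
  rw [h, MultilinearMap.alternatization_apply, Matrix.det_apply, Finset.sum_smul]
  refine Finset.sum_congr rfl fun σ _ => ?_
  rw [smul_assoc]
  rfl

/-- Both forms are alternatizations of products of linear forms, so the shuffle product is the full
permutation sum of the product over the concatenated list of linear forms, that is, one larger
determinant. -/
theorem shuffle_of_det {k r : ℕ} (φ : Fin k → Module.Dual A M) (ψ : Fin r → Module.Dual A M)
    (u w : ExteriorAlgebra A L) (f : M [⋀^Fin k]→ₗ[A] ExteriorAlgebra A L)
    (g : M [⋀^Fin r]→ₗ[A] ExteriorAlgebra A L)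
    (hf : ∀ v, f v = (Matrix.of fun j i => φ i (v j)).det • u)
    (hg : ∀ v, g v = (Matrix.of fun j i => ψ i (v j)).det • w) (v : Fin (k + r) → M) :
    shuffle f g v = (Matrix.of fun j i => Fin.append φ ψ i (v j)).det • (u * w) := by
  rw [det_smul_eq_alternatization φ u f hf, det_smul_eq_alternatization ψ w g hg, shuffle]
  rw [AlternatingMap.domDomCongr_apply, LinearMap.compAlternatingMap_apply,
    domCoprod_apply_alternatization, ← Matrix.det_submatrix_equiv_self finSumFinEquiv,
    Matrix.det_apply, Finset.sum_smul]
  refine Finset.sum_congr rfl fun σ _ => ?_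
  rw [smul_assoc, Fintype.prod_sum_type, ← smul_mul_smul_comm]
  simp

theorem twist_extIncl (k : ℕ) (u : ExteriorAlgebra A L) :
    twist k (extIncl (M := M) u) = extIncl (twist k u) := by
  induction u using ExteriorAlgebra.induction with
  | algebraMap a => simp only [AlgHom.commutes]
  | ι x => rw [ExteriorAlgebra.map_apply_ι, twist_ι, twist_ι, map_zsmul, ExteriorAlgebra.map_apply_ι]
  | mul u v hu hv => rw [map_mul, map_mul, map_mul, map_mul, hu, hv]
  | add u v hu hv => rw [map_add, map_add, map_add, map_add, hu, hv]

/-- Carrying `u` across the `r` covectors of the second factor produces `twist r u`, which is the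
sign built into `formMul`. -/
theorem gen_mul_gen {k r : ℕ} (φ : Fin k → Module.Dual A M) (ψ : Fin r → Module.Dual A M)
    (u v : ExteriorAlgebra A L) :
    ExteriorAlgebra.ιMulti A k (fun i => (inr (φ i) : Semidirect A L M)) * extIncl u *
        (ExteriorAlgebra.ιMulti A r (fun i => inr (ψ i)) * extIncl v) =
      ExteriorAlgebra.ιMulti A (k + r) (fun i => inr (Fin.append φ ψ i)) *
        extIncl (twist r u * v) := by
  have hr : HasParity r (ExteriorAlgebra.ιMulti A r fun i => (inr (ψ i) : Semidirect A L M)) :=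
    hasParity_of_mem (by
      rw [← ExteriorAlgebra.ιMulti_span_fixedDegree]
      exact Submodule.subset_span ⟨_, rfl⟩)
  have happ : ExteriorAlgebra.ιMulti A (k + r) (fun i => (inr (Fin.append φ ψ i) :
      Semidirect A L M)) = ExteriorAlgebra.ιMulti A k (fun i => inr (φ i)) *
        ExteriorAlgebra.ιMulti A r (fun i => inr (ψ i)) := by
    rw [ExteriorAlgebra.ιMulti_apply, ExteriorAlgebra.ιMulti_apply, ExteriorAlgebra.ιMulti_apply,
      ← List.prod_append, ← List.ofFn_fin_append]
    congr 2
    ext i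
    refine Fin.addCases (fun i => ?_) (fun i => ?_) i <;> simp
  have hc := hr.mul_comm (extIncl (twist r u))
  rw [twist_extIncl, twist_twist] at hc
  have htt : twist (r + r) u = u := by
    clear hc happ hr ψ
    induction r with
    | zero => exact twist_zero u
    | succ r ih => rwa [show r + 1 + (r + 1) = r + r + 2 by omega, twist_add_two]
  rw [htt] at hc
  rw [happ, map_mul, mul_assoc, mul_assoc, ← mul_assoc (extIncl u), ← hc, mul_assoc]

theorem mul_of (p r : ℕ) (f : M [⋀^Fin p]→ₗ[A] ExteriorAlgebra A L)
    (g : M [⋀^Fin r]→ₗ[A] ExteriorAlgebra A L) :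
    Forms.mul R A L M (DirectSum.of (fun p => M [⋀^Fin p]→ₗ[A] ExteriorAlgebra A L) p f)
      (DirectSum.of (fun p => M [⋀^Fin p]→ₗ[A] ExteriorAlgebra A L) r g) =
      DirectSum.of (fun p => M [⋀^Fin p]→ₗ[A] ExteriorAlgebra A L) (p + r)
        (formMul R A L M p r f g) := by
  rw [Forms.mul, ← DirectSum.lof_eq_of R, ← DirectSum.lof_eq_of R, DirectSum.toModule_lof,
    LinearMap.flip_apply, DirectSum.toModule_lof, LinearMap.flip_apply, LinearMap.compr₂_apply,
    DirectSum.lof_eq_of]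

theorem involute_pow_apply (r : ℕ) (u : ExteriorAlgebra A L) :
    ((CliffordAlgebra.involute (Q := (0 : QuadraticForm A L))).toLinearMap ^ r) u = twist r u := by
  induction r with
  | zero => rw [twist_zero]; rfl
  | succ r ih =>
    rw [pow_succ', Module.End.mul_apply, ih, add_comm r 1, ← twist_twist, twist_one]
    rfl

/-- The identification of `Alt_A(M, Λ_A L)` with an exterior algebra is multiplicative. -/
theorem formsEquiv_mul (F G : Forms A L M) :
    formsEquiv R L b (Forms.mul R A L M F G) = formsEquiv R L b F * formsEquiv R L b G := by
  refine forms_induction R b (C := fun F => ∀ G, formsEquiv R L b (Forms.mul R A L M F G) =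
    formsEquiv R L b F * formsEquiv R L b G) (fun p φ u => ?_) (fun G => by simp)
    (fun F F' h h' G => by simp only [map_add, LinearMap.add_apply, h, h', add_mul])
    (fun F h G => by simp only [map_smul, LinearMap.smul_apply, h, smul_mul_assoc]) F G
  intro G
  refine forms_induction R b (C := fun G => formsEquiv R L b (Forms.mul R A L M _ G) =
    formsEquiv R L b _ * formsEquiv R L b G) (fun r ψ v => ?_) (by simp)
    (fun G G' h h' => by simp only [map_add, h, h', mul_add])
    (fun G h => by simp only [map_smul, h, mul_smul_comm]) G
  have e : formMul R A L M p r
      (component p (ExteriorAlgebra.ιMulti A p (fun i => inr (φ i)) * extIncl u))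
      (component r (ExteriorAlgebra.ιMulti A r (fun i => inr (ψ i)) * extIncl v)) =
      component (p + r) (ExteriorAlgebra.ιMulti A (p + r) (fun i => inr (Fin.append φ ψ i)) *
        extIncl (twist r u * v)) := by
    ext w
    rw [component_gen_apply]
    refine shuffle_of_det φ ψ _ _ _ _ (fun w => ?_) (component_gen_apply ψ v) w
    rw [LinearMap.compAlternatingMap_apply, component_gen_apply, map_smul, involute_pow_apply]
  rw [mul_of, e, formsEquiv_gen, formsEquiv_gen, formsEquiv_gen, gen_mul_gen]

end Multiplication

theorem mem_bideg_iff (p q : ℕ) (F : Forms A L M) : F ∈ Forms.bideg R A L M p q ↔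
    ∃ f : M [⋀^Fin p]→ₗ[A] ExteriorAlgebra A L, (∀ v, f v ∈ ⋀[A]^q L) ∧
      DirectSum.of (fun p => M [⋀^Fin p]→ₗ[A] ExteriorAlgebra A L) p f = F := Iff.rfl

theorem formsEquiv_mem_bihom {p q : ℕ} {F : Forms A L M} :
    formsEquiv R L b F ∈ bihom A L M p q ↔ F ∈ Forms.bideg R A L M p q := by
  constructor
  · intro h
    have key : ∀ u ∈ bihom A L M p q, (formsEquiv R L b).symm u ∈ Forms.bideg R A L M p q := by
      intro u hu
      induction hu using bihom_induction with
      | mem u hu =>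
        obtain ⟨φ, n, hn, rfl⟩ := hu.eq_mul
        refine (mem_bideg_iff p q _).mpr ⟨_, fun v => ?_,
          ((formsEquiv R L b).eq_symm_apply.mpr (formsEquiv_gen b φ n))⟩
        rw [component_gen_apply]
        exact Submodule.smul_mem _ _ hn
      | zero => rw [map_zero]; exact zero_mem _
      | add u v _ _ hu hv => rw [map_add]; exact add_mem hu hv
      | neg u _ hu => rw [← neg_one_smul R u, map_smul]; exact Submodule.smul_mem _ _ hu
    have h' := key _ h
    rwa [LinearEquiv.symm_apply_apply] at h'
  · intro h
    obtain ⟨f, hf, rfl⟩ := (mem_bideg_iff p q F).mp h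
    rw [formsEquiv_of, FormModel.ofForm_apply]
    exact sum_mem fun s _ => ιMulti_mul_mem_bihom _ (hf _)

end FormsEquiv

/-! ### The action of `L'` and the differential `d''`, seen in the exterior algebra of `L' ⊕ L''^*`.
-/

section CrossedProduct

open Semidirect

variable {R A L' L'' : Type*} [CommRing R] [CommRing A] [Algebra R A]
  [LieRing L'] [Module A L'] [LieRingModule L' A] [LieRinehartRing A L'] [LieAlgebra R L']
  [LieRinehartAlgebra R A L']
  [LieRing L''] [Module A L''] [LieRingModule L'' A] [LieRinehartRing A L''] [LieAlgebra R L'']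
  [LieRinehartAlgebra R A L'']
  [LieRingModule L' L''] [LieRinehartModule A L' L'']
  [LieRingModule L'' L'] [LieRinehartModule A L'' L']

section Action

theorem extProj_adjoint_inl (x : L') (u : ExteriorAlgebra A (Semidirect A L' L'')) :
    extProj ((adjoint A (inl x : Semidirect A L' L'')).ext u) = (adjoint A x).ext (extProj u) := by
  induction u using ExteriorAlgebra.induction with
  | algebraMap a =>
    rw [ModuleDer.ext_algebraMap, AlgHom.commutes, AlgHom.commutes, ModuleDer.ext_algebraMap]
    rfl
  | ι y =>
    rw [ModuleDer.ext_ι, ExteriorAlgebra.map_apply_ι, ExteriorAlgebra.map_apply_ι, ModuleDer.ext_ι]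
    rfl
  | mul u v hu hv => rw [ModuleDer.ext_mul, map_add, map_mul, map_mul, map_mul, hu, hv,
      ModuleDer.ext_mul]
  | add u v hu hv => rw [map_add, map_add, map_add, map_add, hu, hv]

theorem component_adjoint_inl (x : L') (p : ℕ) (u : ExteriorAlgebra A (Semidirect A L' L''))
    (v : Fin p → L'') : component p ((adjoint A (inl x : Semidirect A L' L'')).ext u) v =
      (adjoint A x).ext (component p u v) -
        ∑ k, component p u (Function.update v k ⁅x, v k⁆) := by
  refine formOf_lie _ _ (s := fun η => ⁅x, η⁆) (fun y η => ?_) (extProj_adjoint_inl x) p u v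
  rw [adjoint_op, adjoint_base, semidirect_lie_snd, semidirect_lie_base, fst_inl, snd_inl]
  simp

variable {n : ℕ} (b : DualBasis A L'' n)

theorem ofForm_apply_self {p : ℕ} (β : L'' [⋀^Fin p]→ₗ[A] A) (v : Fin p → L'') :
    (Forms.ofForm β : Forms A L' L'') p v = algebraMap A _ (β v) := by
  rw [Forms.ofForm, DirectSum.of_eq_same]
  rfl

theorem ofForm_apply_of_ne {p k : ℕ} (h : k ≠ p) (β : L'' [⋀^Fin p]→ₗ[A] A) :
    (Forms.ofForm β : Forms A L' L'') k = 0 :=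
  DirectSum.of_eq_of_ne _ _ _ h

/-- The adjoint action of `x` corresponds to the Lie derivative of forms (`component_adjoint_inl`);
on `A`-valued forms that is `formAct`. This verifies the axiom on `[x, b]` for the transported
bracket. -/
theorem adjoint_inl_ofForm (x : L') {p : ℕ} (β : L'' [⋀^Fin p]→ₗ[A] A) :
    (adjoint A (inl x : Semidirect A L' L'')).ext (formsEquiv R L' b (Forms.ofForm β)) =
      formsEquiv R L' b (Forms.ofForm (formAct x β)) := by
  symm
  refine (formsEquiv_eq_iff b _ _).mpr fun k => AlternatingMap.ext fun v => ?_
  rw [component_adjoint_inl, component_formsEquiv]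
  by_cases h : k = p
  · subst h
    simp only [ofForm_apply_self, ModuleDer.ext_algebraMap, adjoint_base, ← map_sum, ← map_sub]
    rfl
  · rw [ofForm_apply_of_ne h, ofForm_apply_of_ne h]
    simp

end Action

section Differential

variable [Module.Finite A L'] [Module.Projective A L'] [Module.Finite A L'']
  [Module.Projective A L'']

theorem extProj_coadjoint (ξ : L'') (u : ExteriorAlgebra A (Semidirect A L' L'')) :
    extProj ((coadjoint (semidirectPairing A L' L'') (inl ξ)).ext u) = extDer L' ξ (extProj u) := by
  induction u using ExteriorAlgebra.induction with
  | algebraMap a =>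
    rw [ModuleDer.ext_algebraMap, AlgHom.commutes, AlgHom.commutes, extDer_algebraMap]
    rfl
  | ι y =>
    rw [ModuleDer.ext_ι, ExteriorAlgebra.map_apply_ι, ExteriorAlgebra.map_apply_ι, extDer_ι,
      coadjoint_semidirect_fst, fst_inl]
  | mul u v hu hv =>
    rw [ModuleDer.ext_mul, map_add, map_mul, map_mul, map_mul, hu, hv, extDer_mul, add_comm]
  | add u v hu hv => rw [map_add, map_add, map_add, extDer_add, hu, hv]

theorem contr_map {S T : Type*} [AddCommGroup S] [Module A S] [AddCommGroup T] [Module A T]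
    (f : S →ₗ[A] T) (d : Module.Dual A T) (u : ExteriorAlgebra A S) :
    contr d (ExteriorAlgebra.map f u) = ExteriorAlgebra.map f (contr (d.comp f) u) := by
  induction u using CliffordAlgebra.left_induction with
  | algebraMap a =>
    change contr d (ExteriorAlgebra.map f (algebraMap A (ExteriorAlgebra A S) a)) =
      ExteriorAlgebra.map f (contr (d.comp f) (algebraMap A (ExteriorAlgebra A S) a))
    rw [AlgHom.commutes, contr_algebraMap, contr_algebraMap, map_zero]
  | add u v hu hv => rw [map_add, map_add, map_add, map_add, hu, hv]
  | ι_mul u m hu =>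
    change contr d (ExteriorAlgebra.map f (ExteriorAlgebra.ι A m * u)) =
      ExteriorAlgebra.map f (contr (d.comp f) (ExteriorAlgebra.ι A m * u))
    rw [map_mul, ExteriorAlgebra.map_apply_ι, contr_ι_mul, contr_ι_mul, hu, map_sub, map_smul,
      map_mul, ExteriorAlgebra.map_apply_ι]
    rfl

theorem augm_map {S T : Type*} [AddCommGroup S] [Module A S] [AddCommGroup T] [Module A T]
    (f : S →ₗ[A] T) (u : ExteriorAlgebra A S) :
    augm A T (ExteriorAlgebra.map f u) = augm A S u := by
  induction u using ExteriorAlgebra.induction with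
  | algebraMap a => rw [AlgHom.commutes, augm_algebraMap, augm_algebraMap]
  | ι m => rw [ExteriorAlgebra.map_apply_ι, augm_ι, augm_ι]
  | mul u v hu hv => rw [map_mul, augm_mul, augm_mul, hu, hv]
  | add u v hu hv => rw [map_add, map_add, map_add, hu, hv]

variable (R) {m : ℕ} (c : DualBasis A (Semidirect A L'' L') m)

/-- The projection to `Λ_A L'` is tested by contraction with `L'^*`. It vanishes because the
elements of `L'^*` commute with one another in `L'' ⋉ L'^*` and act as zero on `A`. -/
theorem extProj_dualVec (u : Semidirect A L' L'') :
    extProj (dualVec R (semidirectPairing A L' L'') c u) = 0 := by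
  obtain ⟨k, ⟨b⟩⟩ := exists_dualBasis (A := A) (M := L')
  refine (perfectModel (Module.Dual.eval A L')).eq_of_contr b.dual ?_ fun ψ => ?_
  · rw [augm_map, augm_dualVec, map_zero]
  · have h : ((Module.Dual.eval A L').flip ψ).comp fst =
        (semidirectPairing A L' L'').flip (inr ψ) := by
      ext u
      simp [semidirectPairing_apply]
    rw [map_zero, contr_map, h, contr_dualVec, map_sub, ExteriorAlgebra.map_apply_ι,
      ExteriorAlgebra.map_apply_ι, coadjoint_semidirect_fst, diffVec_semidirect, fst_inr, fst_inr,
      zero_lie, sub_self]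

theorem extProj_dualDer (u : ExteriorAlgebra A (Semidirect A L' L'')) :
    extProj (dualDer R (semidirectPairing A L' L'') c u) = 0 := by
  induction u using ExteriorAlgebra.induction with
  | algebraMap a =>
    rw [dualDer_algebraMap, ExteriorAlgebra.map_apply_ι, diffVec_semidirect, fst_inr, map_zero]
  | ι u => rw [dualDer_ι, extProj_dualVec]
  | mul u v hu hv =>
    rw [(isGradedDer_dualDer R _ c).map_mul, map_add, map_mul, map_mul, hu, hv, zero_mul, mul_zero,
      add_zero]
  | add u v hu hv => rw [map_add, map_add, hu, hv, add_zero]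

/-- Cartan's formula for `d_*` is restricted to contractions with `L''`. After projection the
coadjoint action of `ξ` becomes the action on `Λ_A L'`, and the image of `d_*` projects to zero, so
`formOf_ceDiff` applies with coefficients in `Λ_A L'`. -/
theorem component_dualDer (p : ℕ) (u : ExteriorAlgebra A (Semidirect A L' L'')) :
    component (p + 1) (dualDer R (semidirectPairing A L' L'') c u) =
      ceDiff (Connection.exterior R A L'' L') p (component p u) := by
  have hflip : ∀ ξ : L'', (snd : Semidirect A L' L'' →ₗ[A] _).flip ξ =
      (semidirectPairing A L' L'').flip (inl ξ) := fun ξ => by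
    ext u
    simp [semidirectPairing_apply]
  refine formOf_ceDiff _ _ _ (ℓ := fun ξ => coadjoint (semidirectPairing A L' L'') (inl ξ))
    (fun ξ a => rfl) (fun ξ x η => ?_) (fun ξ u => extProj_coadjoint ξ u)
    (extProj_dualDer R c) (fun ξ u => ?_) p u
  · have h := coadjoint_op (semidirectPairing A L' L'') (inl ξ) x (inl η)
    simp only [semidirectPairing_apply, semidirect_lie_fst, semidirect_lie_snd,
      semidirect_lie_base, fst_inl, snd_inl, LinearMap.zero_apply, add_zero, lie_zero,
      sub_zero] at h
    exact h
  · rw [hflip, contr_dualDer]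

variable {R} {n : ℕ} (b : DualBasis A L'' n)

theorem d_of (p : ℕ) (f : L'' [⋀^Fin p]→ₗ[A] ExteriorAlgebra A L') :
    Forms.d R A L' L'' (DirectSum.of (fun p => L'' [⋀^Fin p]→ₗ[A] ExteriorAlgebra A L') p f) =
      DirectSum.of (fun p => L'' [⋀^Fin p]→ₗ[A] ExteriorAlgebra A L') (p + 1)
        (ceDiff (Connection.exterior R A L'' L') p f) := by
  rw [Forms.d, ← DirectSum.lof_eq_of R, DirectSum.toModule_lof, LinearMap.comp_apply,
    DirectSum.lof_eq_of]

theorem d_apply_zero (F : Forms A L' L'') : Forms.d R A L' L'' F 0 = 0 := by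
  induction F using DirectSum.induction_on with
  | zero => rw [map_zero]; rfl
  | add F G hF hG => rw [map_add, DirectSum.add_apply, hF, hG, add_zero]
  | of p f => rw [d_of, DirectSum.of_eq_of_ne _ _ _ (Nat.succ_ne_zero p).symm]

theorem d_apply_succ (F : Forms A L' L'') (p : ℕ) :
    Forms.d R A L' L'' F (p + 1) = ceDiff (Connection.exterior R A L'' L') p (F p) := by
  induction F using DirectSum.induction_on with
  | zero => rw [map_zero]; exact (map_zero _).symm
  | add F G hF hG => rw [map_add, DirectSum.add_apply, hF, hG, DirectSum.add_apply, map_add]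
  | of k f =>
    rw [d_of]
    by_cases h : p = k
    · subst h; rw [DirectSum.of_eq_same, DirectSum.of_eq_same]
    · rw [DirectSum.of_eq_of_ne _ _ _ h, DirectSum.of_eq_of_ne _ _ _ (by omega), map_zero]

/-- The differential of `Alt_A(L'', Λ_A L')` corresponds to the dual differential. -/
theorem formsEquiv_d (F : Forms A L' L'') : formsEquiv R L' b (Forms.d R A L' L'' F) =
    dualDer R (semidirectPairing A L' L'') c (formsEquiv R L' b F) := by
  refine (formsEquiv_eq_iff b _ _).mpr fun p => ?_
  cases p with
  | zero =>
    ext v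
    rw [d_apply_zero, formOf_zero]
    exact extProj_dualDer R c _
  | succ p => rw [component_dualDer, component_formsEquiv, d_apply_succ]

theorem extDer_mem (ξ : L'') {q : ℕ} {u : ExteriorAlgebra A L'} (hu : u ∈ ⋀[A]^q L') :
    extDer L' ξ u ∈ ⋀[A]^q L' := by
  induction hu using exteriorPower_induction with
  | algebraMap a => rw [extDer_algebraMap]; exact algebraMap_mem_exteriorPower _
  | add n u v _ _ hu hv => rw [extDer_add]; exact add_mem hu hv
  | ι_mul n x u hm hu =>
    rw [extDer_mul, extDer_ι]
    exact add_mem (ι_mul_mem_exteriorPower _ hu) (ι_mul_mem_exteriorPower _ hm)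

theorem d_mem_bideg {p q : ℕ} {F : Forms A L' L''} (hF : F ∈ Forms.bideg R A L' L'' p q) :
    Forms.d R A L' L'' F ∈ Forms.bideg R A L' L'' (p + 1) q := by
  obtain ⟨f, hf, rfl⟩ := (mem_bideg_iff p q F).mp hF
  refine (mem_bideg_iff (p + 1) q _).mpr ⟨_, fun v => ?_, (d_of p f).symm⟩
  rw [ceDiff_apply, ceFun]
  refine add_mem (sum_mem fun i _ => zsmul_mem (extDer_mem _ (hf _)) _)
    (sum_mem fun i _ => sum_mem fun j _ => ?_)
  split_ifs
  · exact zsmul_mem (hf _) _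
  · exact zero_mem _

end Differential

end CrossedProduct

/-! ### The Gerstenhaber bracket of `Λ_A (L' ⋉ L''^*)` has bidegree `(0, -1)`. -/

section Bidegree

open Semidirect

variable {A L' L'' : Type*} [CommRing A]
  [LieRing L'] [Module A L'] [LieRingModule L' A] [LieRinehartRing A L']
  [LieRing L''] [Module A L'']

theorem ι_mem_bihom_of_fst {u : Semidirect A L' L''} (h : fst u = 0) :
    ExteriorAlgebra.ι A u ∈ bihom A L' L'' 1 0 := by
  rw [← inl_add_inr u, h, map_zero, zero_add]
  exact inr_mem_bihom _

theorem ι_mem_bihom_of_snd {u : Semidirect A L' L''} (h : snd u = 0) :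
    ExteriorAlgebra.ι A u ∈ bihom A L' L'' 0 1 := by
  rw [← inl_add_inr u, h, map_zero, add_zero]
  exact inl_mem_bihom _

/-- A derivation that kills `A` and `L''^*` trades one factor from `L'` for `k` factors from
`L''^*`. It is applied to the contraction with `da`, where `k = 0`, and to the adjoint action of an
element of `L''^*`, where `k = 1`. -/
theorem IsGradedDer.lower_bihom {j k : ℕ}
    {E : ExteriorAlgebra A (Semidirect A L' L'') →+ ExteriorAlgebra A (Semidirect A L' L'')}
    (hE : IsGradedDer j E) (h0 : ∀ a, E (algebraMap A _ a) = 0)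
    (hr : ∀ φ, E (ExteriorAlgebra.ι A (inr φ)) = 0)
    (hl : ∀ x, E (ExteriorAlgebra.ι A (inl x)) ∈ bihom A L' L'' k 0) {p q : ℕ}
    {u : ExteriorAlgebra A (Semidirect A L' L'')} (hu : u ∈ bihom A L' L'' p q) :
    (q = 0 → E u = 0) ∧ ∀ n, q = n + 1 → E u ∈ bihom A L' L'' (k + p) n := by
  induction hu using bihom_induction with
  | mem u hu =>
    induction hu with
    | base a => exact ⟨fun _ => h0 a, fun n h => absurd h (by omega)⟩
    | @left p q u x hu ih =>
      refine ⟨fun h => absurd h (by omega), fun n h => ?_⟩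
      obtain rfl : q = n := by omega
      rw [hE.map_mul, (hasParity_ι _).twist, smul_mul_assoc]
      have h1 := mul_mem_bihom (hl x) hu.mem_bihom
      rw [zero_add] at h1
      refine add_mem h1 (zsmul_mem ?_ _)
      cases q with
      | zero => rw [ih.1 rfl, mul_zero]; exact zero_mem _
      | succ m => exact inl_mul_mem_bihom x (ih.2 m rfl)
    | @right p q u φ hu ih =>
      rw [hE.map_mul, hr, zero_mul, zero_add, (hasParity_ι _).twist, smul_mul_assoc]
      exact ⟨fun h => by rw [ih.1 h, mul_zero, smul_zero],
        fun n h => zsmul_mem (inr_mul_mem_bihom φ (ih.2 n h)) _⟩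
  | zero => rw [map_zero]; exact ⟨fun _ => rfl, fun _ _ => zero_mem _⟩
  | add u v _ _ hu hv =>
    rw [map_add]
    exact ⟨fun h => by rw [hu.1 h, hv.1 h, add_zero], fun n h => add_mem (hu.2 n h) (hv.2 n h)⟩
  | neg u _ hu =>
    rw [map_neg]
    exact ⟨fun h => by rw [hu.1 h, neg_zero], fun n h => neg_mem (hu.2 n h)⟩

variable [LieRingModule L'' A] [LieRinehartRing A L'']
  [LieRingModule L' L''] [LieRinehartModule A L' L'']
  [LieRingModule L'' L'] [LieRinehartModule A L'' L']

theorem contr_diff_bihom (a : A) {p q : ℕ}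
    {u : ExteriorAlgebra A (Semidirect A L' L'')}
    (hu : u ∈ bihom A L' L'' p q) :
    (q = 0 → contr (diff (Semidirect A L' L'') a) u = 0) ∧
      ∀ n, q = n + 1 → contr (diff (Semidirect A L' L'') a) u ∈ bihom A L' L'' (0 + p) n := by
  refine (isGradedDer_contr _).lower_bihom (contr_algebraMap _) (fun φ => ?_) (fun x => ?_) hu
  · rw [contr_ι, diff_apply, semidirect_lie_base, fst_inr, zero_lie, map_zero]
  · rw [contr_ι]
    exact algebraMap_mem_bihom _

theorem adjoint_inl_mem_bihom (x : L') {p q : ℕ} {u : ExteriorAlgebra A (Semidirect A L' L'')}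
    (hu : u ∈ bihom A L' L'' p q) :
    (adjoint A (inl x : Semidirect A L' L'')).ext u ∈ bihom A L' L'' p q := by
  induction hu using bihom_induction with
  | mem u hu =>
    induction hu with
    | base a => rw [ModuleDer.ext_algebraMap]; exact algebraMap_mem_bihom _
    | @left p q u y hu ih =>
      rw [ModuleDer.ext_mul, ModuleDer.ext_ι]
      refine add_mem ?_ (inl_mul_mem_bihom y ih)
      have h := mul_mem_bihom (ι_mem_bihom_of_snd (u := ⁅(inl x : Semidirect A L' L''), inl y⁆)
        (LinearMap.ext fun ξ => by rw [semidirect_lie_snd]; simp)) hu.mem_bihom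
      rwa [zero_add, add_comm 1 q] at h
    | @right p q u φ hu ih =>
      rw [ModuleDer.ext_mul, ModuleDer.ext_ι]
      refine add_mem ?_ (inr_mul_mem_bihom φ ih)
      have h := mul_mem_bihom (ι_mem_bihom_of_fst (u := ⁅(inl x : Semidirect A L' L''), inr φ⁆)
        (by rw [semidirect_lie_fst, fst_inr, lie_zero])) hu.mem_bihom
      rwa [zero_add, add_comm 1 p] at h
  | zero => rw [map_zero]; exact zero_mem _
  | add u v _ _ hu hv => rw [map_add]; exact add_mem hu hv
  | neg u _ hu => rw [map_neg]; exact neg_mem hu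

theorem adjoint_inr_bihom (φ : Module.Dual A L'') {p q : ℕ}
    {u : ExteriorAlgebra A (Semidirect A L' L'')} (hu : u ∈ bihom A L' L'' p q) :
    (q = 0 → (adjoint A (inr φ : Semidirect A L' L'')).ext u = 0) ∧
      ∀ n, q = n + 1 → (adjoint A (inr φ : Semidirect A L' L'')).ext u ∈
        bihom A L' L'' (1 + p) n := by
  refine (adjoint A _).isGradedDer_ext.lower_bihom (fun a => ?_) (fun ψ => ?_) (fun x => ?_) hu
  · rw [ModuleDer.ext_algebraMap, adjoint_base, semidirect_lie_base, fst_inr, zero_lie, map_zero]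
  · have h : ⁅(inr φ : Semidirect A L' L''), inr ψ⁆ = 0 :=
      Semidirect.ext (by rw [semidirect_lie_fst, fst_inr, zero_lie, map_zero])
        (LinearMap.ext fun ξ => by rw [semidirect_lie_snd]; simp)
    rw [ModuleDer.ext_ι, adjoint_op, h, map_zero]
  · rw [ModuleDer.ext_ι]
    exact ι_mem_bihom_of_fst (by rw [adjoint_op, semidirect_lie_fst, fst_inr, zero_lie])

theorem gerstHom_ι_mul (x : Semidirect A L' L'') {p q : ℕ}
    {u : ExteriorAlgebra A (Semidirect A L' L'')} (hu : u ∈ bihom A L' L'' p q)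
    (v : ExteriorAlgebra A (Semidirect A L' L'')) :
    gerstHom A _ (ExteriorAlgebra.ι A x * u) v = ExteriorAlgebra.ι A x * gerstHom A _ u v +
      (-1 : ℤ) ^ (p + q) • (u * (adjoint A x).ext v) := by
  have h := gerstHom_mul_left (ι_mem_exteriorPower (A := A) x) (n := p + q) (v := u) (bihom_le hu) v
  rw [ι_gerstHom, one_mul] at h
  exact h

/-- The Gerstenhaber bracket of `Λ_A (L' ⋉ L''^*)` has bidegree `(0, -1)`. -/
theorem gerstHom_bihom {p q p' q' : ℕ} {u v : ExteriorAlgebra A (Semidirect A L' L'')}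
    (hu : u ∈ bihom A L' L'' p q) (hv : v ∈ bihom A L' L'' p' q') :
    (q + q' = 0 → gerstHom A _ u v = 0) ∧
      ∀ n, q + q' = n + 1 → gerstHom A _ u v ∈ bihom A L' L'' (p + p') n := by
  induction hu using bihom_induction with
  | mem u hu =>
    induction hu with
    | base a =>
      have h := contr_diff_bihom a hv
      rw [algebraMap_gerstHom]
      exact ⟨fun h0 => by rw [h.1 (by omega), neg_zero], fun n hn => neg_mem (h.2 n (by omega))⟩
    | @left p q u x hu ih =>
      refine ⟨fun h => absurd h (by omega), fun n h => ?_⟩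
      obtain rfl : n = q + q' := by omega
      rw [gerstHom_ι_mul _ hu.mem_bihom]
      refine add_mem ?_ (zsmul_mem (mul_mem_bihom hu.mem_bihom (adjoint_inl_mem_bihom x hv)) _)
      rcases h0 : q + q' with _ | m
      · rw [ih.1 h0, mul_zero]; exact zero_mem _
      · exact inl_mul_mem_bihom x (ih.2 m h0)
    | @right p q u φ hu ih =>
      have hφ := adjoint_inr_bihom φ hv
      rw [gerstHom_ι_mul _ hu.mem_bihom]
      refine ⟨fun h => by rw [ih.1 h, hφ.1 (by omega), mul_zero, mul_zero, smul_zero, add_zero],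
        fun n h => add_mem ?_ (zsmul_mem ?_ _)⟩
      · rw [show p + 1 + p' = p + p' + 1 by omega]
        exact inr_mul_mem_bihom φ (ih.2 n h)
      · cases q' with
        | zero => rw [hφ.1 rfl, mul_zero]; exact zero_mem _
        | succ m =>
          have := mul_mem_bihom hu.mem_bihom (hφ.2 m rfl)
          rwa [show p + (1 + p') = p + 1 + p' by omega, show q + m = n by omega] at this
  | zero => rw [map_zero]; exact ⟨fun _ => rfl, fun _ _ => zero_mem _⟩
  | add u v _ _ hu hv =>
    rw [map_add, AddMonoidHom.add_apply]
    exact ⟨fun h => by rw [hu.1 h, hv.1 h, add_zero], fun n h => add_mem (hu.2 n h) (hv.2 n h)⟩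
  | neg u _ hu =>
    rw [map_neg, AddMonoidHom.neg_apply]
    exact ⟨fun h => by rw [hu.1 h, neg_zero], fun n h => neg_mem (hu.2 n h)⟩

end Bidegree

/-! ### Additive compatibilities of the identification. -/

section FormsEquivGroup

variable {R A L M : Type*} [CommRing R] [CommRing A] [Algebra R A]
  [LieRing L] [Module A L] [LieRingModule L A] [LieRinehartRing A L] [LieAlgebra R L]
  [LieRinehartAlgebra R A L] [AddCommGroup M] [Module A M] {n : ℕ} (b : DualBasis A M n)

theorem formsEquiv_neg (F : Forms A L M) : formsEquiv R L b (-F) = -formsEquiv R L b F :=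
  map_neg (AddMonoidHom.mk' (fun F => formsEquiv R L b F) (map_add _)) F

theorem formsEquiv_sub (F G : Forms A L M) :
    formsEquiv R L b (F - G) = formsEquiv R L b F - formsEquiv R L b G :=
  map_sub (AddMonoidHom.mk' (fun F => formsEquiv R L b F) (map_add _)) F G

theorem formsEquiv_zsmul (k : ℤ) (F : Forms A L M) :
    formsEquiv R L b (k • F) = k • formsEquiv R L b F :=
  map_zsmul (AddMonoidHom.mk' (fun F => formsEquiv R L b F) (map_add _)) k F

end FormsEquivGroup

/-! ### Existence and uniqueness of the crossed product bracket. -/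

section CrossedBracket

open Semidirect

variable {R A L' L'' : Type*} [CommRing R] [CommRing A] [Algebra R A]
  [LieRing L'] [Module A L'] [LieRingModule L' A] [LieRinehartRing A L'] [LieAlgebra R L']
  [LieRinehartAlgebra R A L']
  [LieRing L''] [Module A L''] [LieRingModule L'' A] [LieRinehartRing A L''] [LieAlgebra R L'']
  [LieRinehartAlgebra R A L'']
  [LieRingModule L' L''] [LieRinehartModule A L' L'']
  [LieRingModule L'' L'] [LieRinehartModule A L'' L']
  {n : ℕ} (b : DualBasis A L'' n)

variable (R L') in
/-- The crossed product bracket, transported from the Gerstenhaber bracket of `Λ_A (L' ⋉ L''^*)`. -/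
def crossedBracket : Forms A L' L'' →ₗ[R] Forms A L' L'' →ₗ[R] Forms A L' L'' :=
  LinearMap.mk₂ R (fun F G => (formsEquiv R L' b).symm
      (gerst R A _ (formsEquiv R L' b F) (formsEquiv R L' b G)))
    (fun F G H => by simp only [map_add, LinearMap.add_apply])
    (fun r F G => by simp only [map_smul, LinearMap.smul_apply])
    (fun F G H => by simp only [map_add])
    (fun r F G => by simp only [map_smul])

theorem formsEquiv_crossedBracket (F G : Forms A L' L'') :
    formsEquiv R L' b (crossedBracket R L' b F G) =
      gerstHom A _ (formsEquiv R L' b F) (formsEquiv R L' b G) :=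
  (formsEquiv R L' b).apply_symm_apply _

theorem formsEquiv_const_ι (x : L') :
    formsEquiv R L' b (Forms.const (ExteriorAlgebra.ι A x)) = ExteriorAlgebra.ι A (inl x) := by
  rw [formsEquiv_const, ExteriorAlgebra.map_apply_ι]

theorem mem_of_mem_bideg {p q : ℕ} {F : Forms A L' L''} (hF : F ∈ Forms.bideg R A L' L'' p q) :
    formsEquiv R L' b F ∈ ⋀[A]^(p + q) (Semidirect A L' L'') :=
  bihom_le ((formsEquiv_mem_bihom b).mpr hF)

theorem isCrossedProductBracket_crossedBracket :
    IsCrossedProductBracket R A L' L'' (crossedBracket R L' b) where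
  mem hf hg h := by
    rw [← formsEquiv_mem_bihom b] at hf hg ⊢
    rw [formsEquiv_crossedBracket]
    exact (gerstHom_bihom hf hg).2 _ h
  eq_zero hf hg := by
    rw [← formsEquiv_mem_bihom b] at hf hg
    apply (formsEquiv R L' b).injective
    rw [formsEquiv_crossedBracket, map_zero]
    exact (gerstHom_bihom hf hg).1 rfl
  lie_lie x y := by
    apply (formsEquiv R L' b).injective
    rw [formsEquiv_crossedBracket, formsEquiv_const_ι, formsEquiv_const_ι, formsEquiv_const_ι,
      ι_gerstHom, ModuleDer.ext_ι, adjoint_op]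
    congr 1
    exact Semidirect.ext rfl (LinearMap.ext fun ξ => by rw [semidirect_lie_snd]; simp)
  lie_form x p β := by
    apply (formsEquiv R L' b).injective
    rw [formsEquiv_crossedBracket, formsEquiv_const_ι, ι_gerstHom, adjoint_inl_ofForm]
  leibniz {p q p' q' f g} h hf hg := by
    apply (formsEquiv R L' b).injective
    rw [map_add, formsEquiv_zsmul]
    have e := gerstHom_mul_left (m := p + q) (n := p' + q') (u := formsEquiv R L' b f)
      (v := formsEquiv R L' b g) (mem_of_mem_bideg b hf) (mem_of_mem_bideg b hg)
      (formsEquiv R L' b h)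
    rw [formsEquiv_crossedBracket, formsEquiv_mul, formsEquiv_mul, formsEquiv_mul,
      formsEquiv_crossedBracket, formsEquiv_crossedBracket, e]
  skew {p q p' q' f g} hf hg := by
    apply (formsEquiv R L' b).injective
    rw [formsEquiv_neg, formsEquiv_zsmul]
    have e := gerstHom_skew (m := p + q) (n := p' + q') (u := formsEquiv R L' b f)
      (v := formsEquiv R L' b g) (mem_of_mem_bideg b hf) (mem_of_mem_bideg b hg)
    rw [formsEquiv_crossedBracket, formsEquiv_crossedBracket, e]

variable {br : Forms A L' L'' →ₗ[R] Forms A L' L'' →ₗ[R] Forms A L' L''}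

/-- The bracket on `Λ_A (L' ⊕ L''^*)` that corresponds to a bracket of forms. -/
def transported (br : Forms A L' L'' →ₗ[R] Forms A L' L'' →ₗ[R] Forms A L' L'') :
    ExteriorAlgebra A (Semidirect A L' L'') →+ ExteriorAlgebra A (Semidirect A L' L'') →+
      ExteriorAlgebra A (Semidirect A L' L'') :=
  AddMonoidHom.mk' (fun u => AddMonoidHom.mk' (fun v => formsEquiv R L' b
      (br ((formsEquiv R L' b).symm u) ((formsEquiv R L' b).symm v)))
      fun v w => by simp only [map_add])
    fun u v => by ext w; simp [map_add, LinearMap.add_apply]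

theorem transported_apply (u v : ExteriorAlgebra A (Semidirect A L' L'')) :
    transported b br u v =
      formsEquiv R L' b (br ((formsEquiv R L' b).symm u) ((formsEquiv R L' b).symm v)) := rfl

theorem transported_formsEquiv (F G : Forms A L' L'') :
    transported b br (formsEquiv R L' b F) (formsEquiv R L' b G) = formsEquiv R L' b (br F G) := by
  rw [transported_apply, LinearEquiv.symm_apply_apply, LinearEquiv.symm_apply_apply]

theorem IsMonomial.exists_bideg {m : ℕ} {u : ExteriorAlgebra A (Semidirect A L' L'')}
    (hu : IsMonomial (homogeneous A L' L'') m u) :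
    ∃ p q, p + q = m ∧ ∃ F ∈ Forms.bideg R A L' L'' p q, formsEquiv R L' b F = u := by
  obtain ⟨p, q, h, hu⟩ := hu.isBimonomial
  obtain ⟨F, rfl⟩ := (formsEquiv R L' b).surjective u
  exact ⟨p, q, h, F, (formsEquiv_mem_bihom b).mp hu.mem_bihom, rfl⟩

/-- The axioms are given for bihomogeneous forms only. Monomials in elements of `L'` and of `L''^*`
are bihomogeneous, and the signs depend only on the total degree. -/
theorem IsCrossedProductBracket.leibnizOn (h : IsCrossedProductBracket R A L' L'' br) :
    LeibnizOn (homogeneous A L' L'') (transported b br) where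
  leibniz {n x u} w hx hu := by
    obtain ⟨p, q, h0, F, hF, h1⟩ := (isMonomial_ι (A := A) hx).exists_bideg (R := R) b
    obtain ⟨p', q', rfl, G, hG, rfl⟩ := hu.exists_bideg (R := R) b
    obtain ⟨H, rfl⟩ := (formsEquiv R L' b).surjective w
    have e := congrArg (formsEquiv R L' b) (h.leibniz H hF hG)
    rw [map_add, formsEquiv_zsmul, h0, one_mul] at e
    simp only [formsEquiv_mul] at e
    rw [← h1, ← formsEquiv_mul, transported_formsEquiv, transported_formsEquiv,
      transported_formsEquiv, e]
  skew {m n u v} hu hv := by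
    obtain ⟨p, q, rfl, F, hF, rfl⟩ := hu.exists_bideg (R := R) b
    obtain ⟨p', q', rfl, G, hG, rfl⟩ := hv.exists_bideg (R := R) b
    rw [transported_formsEquiv, transported_formsEquiv, h.skew hF hG, formsEquiv_neg,
      formsEquiv_zsmul]

/-- On generators the values are prescribed: two elements of `L'` by `lie_lie`, an element of `L'`
with `A` or `L''^*` by `lie_form` in degrees `0` and `1`, and all pairs without an element of `L'`
by `eq_zero`. The reversed mixed pair comes from skew-symmetry. -/
theorem IsCrossedProductBracket.unique
    {br' : Forms A L' L'' →ₗ[R] Forms A L' L'' →ₗ[R] Forms A L' L''}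
    (h : IsCrossedProductBracket R A L' L'' br) (h' : IsCrossedProductBracket R A L' L'' br')
    (b : DualBasis A L'' n) : br = br' := by
  have deg : ∀ {p q : ℕ} {u}, u ∈ bihom A L' L'' p q →
      (formsEquiv R L' b).symm u ∈ Forms.bideg R A L' L'' p q := fun hu =>
    (formsEquiv_mem_bihom b).mp (by rwa [LinearEquiv.apply_symm_apply])
  have zero : ∀ {p p' : ℕ} {u v}, u ∈ bihom A L' L'' p 0 → v ∈ bihom A L' L'' p' 0 →
      transported b br u v = transported b br' u v := fun hu hv => by
    rw [transported_apply, transported_apply, h.eq_zero (deg hu) (deg hv),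
      h'.eq_zero (deg hu) (deg hv)]
  have form : ∀ (x : L') {p : ℕ} (β : L'' [⋀^Fin p]→ₗ[A] A),
      transported b br (ExteriorAlgebra.ι A (inl x)) (formsEquiv R L' b (Forms.ofForm β)) =
        transported b br' (ExteriorAlgebra.ι A (inl x)) (formsEquiv R L' b (Forms.ofForm β)) :=
    fun x p β => by
      rw [← formsEquiv_const_ι (R := R) b, transported_formsEquiv, transported_formsEquiv,
        h.lie_form, h'.lie_form]
  have lr : ∀ (x : L') (φ : Module.Dual A L''),
      transported b br (ExteriorAlgebra.ι A (inl x)) (ExteriorAlgebra.ι A (inr φ)) =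
        transported b br' (ExteriorAlgebra.ι A (inl x)) (ExteriorAlgebra.ι A (inr φ)) :=
    fun x φ => by rw [← formsEquiv_ofForm_one (R := R) b]; exact form x _
  have hl : ∀ x : L', inl x ∈ homogeneous A L' L'' := fun x => Or.inl ⟨x, rfl⟩
  have hr : ∀ φ : Module.Dual A L'', inr φ ∈ homogeneous A L' L'' := fun φ => Or.inr ⟨φ, rfl⟩
  have e := (h.leibnizOn b).ext closure_homogeneous (h'.leibnizOn b)
    (fun a a' => zero (algebraMap_mem_bihom a) (algebraMap_mem_bihom a'))
    (fun x hx a => by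
      rcases hx with ⟨x, rfl⟩ | ⟨φ, rfl⟩
      · rw [← formsEquiv_ofForm_zero (R := R) b]; exact form x _
      · exact zero (inr_mem_bihom φ) (algebraMap_mem_bihom a))
    (fun x hx y hy => by
      rcases hx with ⟨x, rfl⟩ | ⟨φ, rfl⟩ <;> rcases hy with ⟨y, rfl⟩ | ⟨ψ, rfl⟩
      · rw [← formsEquiv_const_ι (R := R) b, ← formsEquiv_const_ι (R := R) b,
          transported_formsEquiv, transported_formsEquiv, h.lie_lie, h'.lie_lie]
      · exact lr x ψ
      · rw [(h.leibnizOn b).skew (isMonomial_ι (hr φ)) (isMonomial_ι (hl y)), lr,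
          (h'.leibnizOn b).skew (isMonomial_ι (hr φ)) (isMonomial_ι (hl y))]
      · exact zero (inr_mem_bihom φ) (inr_mem_bihom ψ))
  refine LinearMap.ext fun F => LinearMap.ext fun G => (formsEquiv R L' b).injective ?_
  rw [← transported_formsEquiv, ← transported_formsEquiv, e]

end CrossedBracket

/-! ### The bigrading of the forms. -/

section Internal

/-- Independence needs only additive maps `π i` that are faithful on `V i` and kill the other
pieces. Their targets may vary with `i`, so the values of a component on tuples of vectors can
serve. -/
theorem isInternal_of_projections {R B I : Type*} [DecidableEq I] [CommRing R] [AddCommGroup B]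
    [Module R B] (V : I → Submodule R B) {T : I → Type*} [∀ i, AddCommGroup (T i)]
    (π : ∀ i, B →+ T i) (h0 : ∀ i, ∀ f ∈ V i, π i f = 0 → f = 0)
    (h1 : ∀ i j, i ≠ j → ∀ f ∈ V j, π i f = 0)
    (h2 : ∀ f, f ∈ AddSubgroup.closure (⋃ i, (V i : Set B))) : DirectSum.IsInternal V := by
  constructor
  · rw [injective_iff_map_eq_zero]
    intro x hx
    refine DFinsupp.ext fun i => Subtype.ext ?_
    have key : ∀ x : ⨁ i, V i, π i (DirectSum.coeAddMonoidHom V x) = π i (x i) := by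
      intro x
      induction x using DirectSum.induction_on with
      | zero => rw [map_zero]; rfl
      | add x y hx hy => rw [map_add, map_add, hx, hy, DirectSum.add_apply, ← map_add]; rfl
      | of j f =>
        rw [DirectSum.coeAddMonoidHom_of]
        by_cases h : i = j
        · subst h; rw [DirectSum.of_eq_same]
        · rw [DirectSum.of_eq_of_ne _ _ _ h, h1 i j h _ f.2]
          exact (map_zero (π i)).symm
    refine h0 i _ (x i).2 ?_
    rw [← key, hx, map_zero]
  · intro f
    induction h2 f using AddSubgroup.closure_induction with
    | zero => exact ⟨0, map_zero _⟩
    | add f g _ _ hf hg =>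
      obtain ⟨x, rfl⟩ := hf
      obtain ⟨y, rfl⟩ := hg
      exact ⟨x + y, map_add _ _ _⟩
    | neg f _ hf =>
      obtain ⟨x, rfl⟩ := hf
      exact ⟨-x, map_neg _ _⟩
    | mem f hf =>
      obtain ⟨i, hi⟩ := Set.mem_iUnion.mp hf
      exact ⟨DirectSum.of (fun i => V i) i ⟨f, hi⟩, DirectSum.coeAddMonoidHom_of _ _ _⟩

variable {R A L M : Type*} [CommRing R] [CommRing A] [Algebra R A]
  [LieRing L] [Module A L] [LieRingModule L A] [LieRinehartRing A L] [LieAlgebra R L]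
  [LieRinehartAlgebra R A L] [AddCommGroup M] [Module A M]

variable (A L M) in
/-- The values of the component of bidegree `i` of a form. -/
def bidegProj (i : ℕ × ℕ) : Forms A L M →+ ((Fin i.1 → M) → ExteriorAlgebra A L) :=
  AddMonoidHom.mk' (fun F v => GradedRing.proj (fun q : ℕ => ⋀[A]^q L) i.2 (F i.1 v))
    fun F G => funext fun v => by
      rw [DirectSum.add_apply, AlternatingMap.add_apply, map_add]; rfl

theorem bidegProj_apply (i : ℕ × ℕ) (F : Forms A L M) (v : Fin i.1 → M) :
    bidegProj A L M i F v = GradedRing.proj (fun q : ℕ => ⋀[A]^q L) i.2 (F i.1 v) := rfl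

theorem eq_zero_of_bidegProj (i : ℕ × ℕ) {F : Forms A L M} (hF : F ∈ Forms.bideg R A L M i.1 i.2)
    (h : bidegProj A L M i F = 0) : F = 0 := by
  obtain ⟨f, hf, rfl⟩ := (mem_bideg_iff _ _ F).mp hF
  have h' : f = 0 := AlternatingMap.ext fun v => by
    have e := congrFun h v
    rw [bidegProj_apply, DirectSum.of_eq_same, GradedRing.proj_apply,
      DirectSum.decompose_of_mem_same (fun q : ℕ => ⋀[A]^q L) (hf v)] at e
    exact e
  rw [h', map_zero]

theorem bidegProj_of_ne {i j : ℕ × ℕ} (hij : i ≠ j) {F : Forms A L M}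
    (hF : F ∈ Forms.bideg R A L M j.1 j.2) : bidegProj A L M i F = 0 := by
  obtain ⟨f, hf, rfl⟩ := (mem_bideg_iff _ _ F).mp hF
  funext v
  rw [bidegProj_apply]
  by_cases h : i.1 = j.1
  · obtain ⟨p, q⟩ := i
    obtain ⟨p', q'⟩ := j
    obtain rfl : p = p' := h
    rw [DirectSum.of_eq_same, GradedRing.proj_apply,
      DirectSum.decompose_of_mem_ne (fun q : ℕ => ⋀[A]^q L) (hf v)
        fun e => hij (Prod.ext rfl e.symm)]
    rfl
  · rw [DirectSum.of_eq_of_ne _ _ _ h, AlternatingMap.zero_apply, map_zero]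
    rfl

theorem mem_closure_bideg {n : ℕ} (b : DualBasis A M n) (F : Forms A L M) :
    F ∈ AddSubgroup.closure (⋃ i : ℕ × ℕ, (Forms.bideg R A L M i.1 i.2 : Set (Forms A L M))) := by
  have key : ∀ u, (formsEquiv R L b).symm u ∈
      AddSubgroup.closure (⋃ i : ℕ × ℕ, (Forms.bideg R A L M i.1 i.2 : Set (Forms A L M))) := by
    intro u
    induction mem_closure_isMonomial closure_homogeneous u using
      AddSubgroup.closure_induction with
    | zero => rw [map_zero]; exact zero_mem _
    | add u v _ _ hu hv => rw [map_add]; exact add_mem hu hv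
    | neg u _ hu =>
      have e : (formsEquiv R L b).symm (-u) = -(formsEquiv R L b).symm u :=
        (formsEquiv R L b).injective (by
          rw [formsEquiv_neg, LinearEquiv.apply_symm_apply, LinearEquiv.apply_symm_apply])
      rw [e]
      exact neg_mem hu
    | mem u hu =>
      obtain ⟨m, hu⟩ := hu
      obtain ⟨p, q, -, hu⟩ := hu.isBimonomial
      refine AddSubgroup.subset_closure (Set.mem_iUnion.mpr ⟨(p, q), ?_⟩)
      refine (formsEquiv_mem_bihom b).mp ?_
      rw [LinearEquiv.apply_symm_apply]
      exact hu.mem_bihom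
  have h := key (formsEquiv R L b F)
  rwa [LinearEquiv.symm_apply_apply] at h

theorem isInternal_bideg {n : ℕ} (b : DualBasis A M n) :
    DirectSum.IsInternal fun i : ℕ × ℕ => Forms.bideg R A L M i.1 i.2 := by
  have h0 : ∀ i : ℕ × ℕ, ∀ F ∈ Forms.bideg R A L M i.1 i.2, bidegProj A L M i F = 0 → F = 0 :=
    fun i _ hF h => eq_zero_of_bidegProj i hF h
  have h1 : ∀ i j : ℕ × ℕ, i ≠ j → ∀ F ∈ Forms.bideg R A L M j.1 j.2, bidegProj A L M i F = 0 :=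
    fun i j hij _ hF => bidegProj_of_ne hij hF
  have h := isInternal_of_projections (R := R) (B := Forms A L M)
    (fun i : ℕ × ℕ => Forms.bideg R A L M i.1 i.2)
    (T := fun i => (Fin i.1 → M) → ExteriorAlgebra A L) (bidegProj A L M)
  exact h h0 h1 (mem_closure_bideg b)

end Internal

/-! ### The equivalences, by transport to the exterior algebra. -/

section Main

open Semidirect

variable {R A L' L'' : Type*} [CommRing R] [CommRing A] [Algebra R A]
  [LieRing L'] [Module A L'] [LieRingModule L' A] [LieRinehartRing A L'] [LieAlgebra R L']
  [LieRinehartAlgebra R A L']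
  [LieRing L''] [Module A L''] [LieRingModule L'' A] [LieRinehartRing A L''] [LieAlgebra R L'']
  [LieRinehartAlgebra R A L'']
  [LieRingModule L' L''] [LieRinehartModule A L' L'']
  [LieRingModule L'' L'] [LieRinehartModule A L'' L']

theorem isBigradedCommAlgebra_forms {n : ℕ} (b : DualBasis A L'' n) :
    IsBigradedCommAlgebra R (Forms.bideg R A L' L'') (Forms.mul R A L' L'') (Forms.const 1) where
  isInternal := isInternal_bideg b
  mul_mem hf hg := by
    rw [← formsEquiv_mem_bihom b] at hf hg ⊢
    rw [formsEquiv_mul]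
    exact mul_mem_bihom hf hg
  one_mem := by
    rw [← formsEquiv_mem_bihom b, formsEquiv_const, map_one, ← map_one (algebraMap A _)]
    exact algebraMap_mem_bihom 1
  one_mul f := (formsEquiv R L' b).injective (by
    rw [formsEquiv_mul, formsEquiv_const, map_one, one_mul])
  mul_assoc f g h := (formsEquiv R L' b).injective (by
    simp only [formsEquiv_mul, mul_assoc])
  mul_comm hf hg := by
    apply (formsEquiv R L' b).injective
    rw [formsEquiv_zsmul, formsEquiv_mul, formsEquiv_mul]
    exact (hasParity_of_mem (mem_of_mem_bideg b hf)).mul_comm_smul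
      (hasParity_of_mem (mem_of_mem_bideg b hg))

theorem isBigradedGerstenhaberBracket_crossedBracket {n : ℕ} (b : DualBasis A L'' n) :
    IsBigradedGerstenhaberBracket (B := Forms A L' L'') R (Forms.bideg R A L' L'') (Forms.mul R A L' L'')
      (crossedBracket R L' b) where
  mem := (isCrossedProductBracket_crossedBracket b).mem
  eq_zero := (isCrossedProductBracket_crossedBracket b).eq_zero
  skew := (isCrossedProductBracket_crossedBracket b).skew
  jacobi {p q p' q' f g} h hf hg := by
    apply (formsEquiv R L' b).injective
    rw [map_add, formsEquiv_zsmul]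
    have e := gerstHom_jacobi (m := p + q) (n := p' + q') (u := formsEquiv R L' b f)
      (v := formsEquiv R L' b g) (mem_of_mem_bideg b hf) (mem_of_mem_bideg b hg)
      (formsEquiv R L' b h)
    simp only [formsEquiv_crossedBracket]
    exact e
  derivation {p q p' q' f g} h hf hg := by
    apply (formsEquiv R L' b).injective
    rw [map_add, formsEquiv_zsmul]
    have e := (isGradedDer_gerstHom (n := p + q) (v := formsEquiv R L' b f)
      (mem_of_mem_bideg b hf)).map_mul (formsEquiv R L' b g) (formsEquiv R L' b h)
    rw [(hasParity_of_mem (mem_of_mem_bideg b hg)).twist, smul_mul_assoc] at e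
    rw [formsEquiv_crossedBracket, formsEquiv_mul, formsEquiv_mul, formsEquiv_mul,
      formsEquiv_crossedBracket, formsEquiv_crossedBracket]
    exact e

variable [Module.Finite A L'] [Module.Projective A L'] [Module.Finite A L'']
  [Module.Projective A L'']

/-- Since bracket and differential correspond under `formsEquiv`, the derivation rule on forms and
the vanishing of the defect are one equation. The two dual bases serve the two identifications, of
forms on `L''` and of `d_*`. -/
theorem formsEquiv_bracket_defect {m n : ℕ} (c : DualBasis A (Semidirect A L'' L') m)
    (b : DualBasis A L'' n) (k : ℕ) (f g : Forms A L' L'') :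
    Forms.d R A L' L'' (crossedBracket R L' b f g) =
        crossedBracket R L' b (Forms.d R A L' L'' f) g -
          (-1 : ℤ) ^ k • crossedBracket R L' b f (Forms.d R A L' L'' g) ↔
      defect (dualDer R (semidirectPairing A L' L'') c) k (formsEquiv R L' b f)
        (formsEquiv R L' b g) = 0 := by
  rw [← (formsEquiv R L' b).injective.eq_iff, formsEquiv_sub, formsEquiv_zsmul, formsEquiv_d c,
    formsEquiv_crossedBracket, formsEquiv_crossedBracket, formsEquiv_crossedBracket,
    formsEquiv_d c, formsEquiv_d c, ← sub_eq_zero, sub_sub_eq_add_sub, defect, add_sub_right_comm]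

variable (R A L' L'') in
theorem isFormsDifferentialGerstenhaber_iff :
    IsFormsDifferentialGerstenhaber R A L' L'' ↔ IsMatchedPair A L' L'' := by
  obtain ⟨n, ⟨b⟩⟩ := exists_dualBasis (A := A) (M := L'')
  obtain ⟨m, ⟨c⟩⟩ := exists_dualBasis_semidirect (A := A) (L' := L') (L'' := L'')
  constructor
  · rintro ⟨br, hbr, h⟩
    obtain rfl := hbr.unique (isCrossedProductBracket_crossedBracket b) b
    -- The derivation rule is available for bihomogeneous forms only. A general vector is the sum of
    -- one of bidegree `(0, 1)` and one of bidegree `(1, 0)`, and both have the same sign because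
    -- the sign depends on total degree.
    have hom : ∀ {p q : ℕ} {u}, u ∈ bihom A L' L'' p q → p + q = 1 → ∀ v,
        defect (dualDer R (semidirectPairing A L' L'') c) 1 u v = 0 := by
      intro p q u hu h1 v
      obtain ⟨f, rfl⟩ := (formsEquiv R L' b).surjective u
      obtain ⟨g, rfl⟩ := (formsEquiv R L' b).surjective v
      have e := h.d_bracket g ((formsEquiv_mem_bihom b).mp hu)
      rw [h1] at e
      exact (formsEquiv_bracket_defect c b 1 f g).mp e
    have key : ∀ (u : Semidirect A L' L'') (v),
        defect (dualDer R (semidirectPairing A L' L'') c) 1 (ExteriorAlgebra.ι A u) v = 0 := by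
      intro u v
      have hl := hom (inl_mem_bihom (fst u)) rfl v
      have hr := hom (inr_mem_bihom (snd u)) rfl v
      rw [← inl_add_inr u, map_add]
      rw [← add_zero (0 : ExteriorAlgebra A (Semidirect A L' L''))]
      nth_rewrite 1 [← hl]
      rw [← hr]
      simp only [defect, map_add, AddMonoidHom.add_apply, smul_add]
      abel
    exact isMatchedPair_of_defect R c (fun u a => key u _) fun u v => key u _
  · intro h
    refine ⟨crossedBracket R L' b, isCrossedProductBracket_crossedBracket b,
      { isBigradedCommAlgebra_forms b, isBigradedGerstenhaberBracket_crossedBracket b with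
        d_mem := d_mem_bideg
        d_d := fun f => ?_
        d_mul := fun {p q f} g hf => ?_
        d_bracket := fun {p q f} g hf => ?_ }⟩
    · apply (formsEquiv R L' b).injective
      rw [formsEquiv_d c, formsEquiv_d c, dualDer_dualDer, map_zero]
    · apply (formsEquiv R L' b).injective
      have e := (isGradedDer_dualDer R (semidirectPairing A L' L'') c).map_mul
        (formsEquiv R L' b f) (formsEquiv R L' b g)
      rw [(hasParity_of_mem (mem_of_mem_bideg b hf)).twist, one_mul, smul_mul_assoc] at e
      rw [map_add, formsEquiv_zsmul, formsEquiv_d c, formsEquiv_mul, formsEquiv_mul,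
        formsEquiv_mul, formsEquiv_d c, formsEquiv_d c, e]
    · exact (formsEquiv_bracket_defect c b _ f g).mpr
        (defect_semidirect_eq_zero R c h (mem_of_mem_bideg b hf) _)

end Main

end LR

end

theorem theorem4p8 {R A L' L'' : Type*} [CommRing R] [CommRing A] [Algebra R A]
    [LieRing L'] [Module A L'] [LieRingModule L' A] [LieRinehartRing A L'] [LieAlgebra R L']
    [LieRinehartAlgebra R A L']
    [LieRing L''] [Module A L''] [LieRingModule L'' A] [LieRinehartRing A L''] [LieAlgebra R L'']
    [LieRinehartAlgebra R A L'']
    [LieRingModule L' L''] [LR.LieRinehartModule A L' L'']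
    [LieRingModule L'' L'] [LR.LieRinehartModule A L'' L']
    [Module.Finite A L'] [Module.Projective A L'] [Module.Finite A L''] [Module.Projective A L''] :
    -- the brackets and the dual differential that enter the statement exist and are unique
    (∃! br, LR.IsCrossedProductBracket R A L' L'' br) ∧
    (∃! br, LR.IsGerstenhaberBracket R A (LR.Semidirect A L' L'') br) ∧
    (∃! δ, LR.IsDualDifferential R A (LR.Semidirect A L' L'') (LR.Semidirect A L'' L')
      (LR.semidirectPairing A L' L'') δ) ∧
    -- the theorem
    (LR.IsFormsDifferentialGerstenhaber R A L' L'' ↔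
      LR.IsLieRinehartBialgebra R A (LR.Semidirect A L' L'') (LR.Semidirect A L'' L')
        (LR.semidirectPairing A L' L'')) ∧
    -- its corollary
    (LR.IsTwilled R A L' L'' ↔
      LR.IsLieRinehartBialgebra R A (LR.Semidirect A L' L'') (LR.Semidirect A L'' L')
        (LR.semidirectPairing A L' L'')) := by
  obtain ⟨n, ⟨b⟩⟩ := LR.exists_dualBasis (A := A) (M := L'')
  obtain ⟨m, ⟨c⟩⟩ := LR.exists_dualBasis_semidirect (A := A) (L' := L') (L'' := L'')
  have hb := LR.isCrossedProductBracket_crossedBracket (R := R) (L' := L') b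
  refine ⟨⟨_, hb, fun br h => h.unique hb b⟩,
    ⟨_, LR.isGerstenhaberBracket_gerst, fun br h => h.eq_gerst⟩,
    ⟨_, LR.isDualDifferential_dualDiff R _ c,
      fun δ h => h.unique _ c (LR.isDualDifferential_dualDiff R _ c)⟩, ?_, ?_⟩
  · rw [LR.isFormsDifferentialGerstenhaber_iff, LR.isLieRinehartBialgebra_iff]
  · rw [LR.isTwilled_iff, LR.isLieRinehartBialgebra_iff]
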